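/- **Model.** Let $n\ge 1$, $k\in\{1,\dots,n\}$, $q\in(0,1/2]$, $\lambda\in[0,1-q]$, let $\Theta\in\mathbb R^{n\times n}$ be symmetric, and let $D\ge 2$ be an integer. Given a latent assignment $z\in[n]^n$, the variables $Y^\star_{ij}\in\{0,1\}$ ($1\le i<j\le n$) are independent with $\mathbb P[Y^\star_{ij}=1\mid z]=q+\Theta_{z_iz_j}$, and $Y_{ij}=Y_{ji}=Y^\star_{ij}-q$. Under permutation sampling $z$ is a uniform permutation of $[n]$ (expectation $\mathbb E$); under independent sampling the $z_i$ are i.i.d. uniform on $[n]$ (expectation $\widetilde{\mathbb E}$). Put $\bar q=q(1-q)$, $p=q+\lambda$, $\bar p=p(1-q)^2+(1-p)q^2$. **Basis.** A template is a finite simple graph $G=(V,E)$ without isolated nodes and with $1\le|E|\le D$; $\mathcal G_{\le D}$ is a maximal collection of pairwise non-isomorphic templates. For an injection $\pi:V\to[n]$ put $P_{G,\pi}=\prod_{\{u,v\}\in E}Y_{\pi(u)\pi(v)}$ and $\overline P_{G,\pi}=\prod_{l}\big(P_{G_l,\pi}-\mathbb E[P_{G_l,\pi}]\big)$, where $G_1,G_2,\dots$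 are the connected components of $G$. Let $$\Psi_G=\mathbb V(G)^{-1/2}\sum_{\pi}\overline P_{G,\pi},\qquad \mathbb V(G)=\frac{n!}{(n-|V|)!}\,|\mathrm{Aut}(G)|\,\bar q^{|E|}.$$ **Merged graphs.** Let $G^{(1)},G^{(2)}$ be templates with labelings $\pi^{(1)},\pi^{(2)}$. Let $G_\cup,G_\cap,G_\Delta$ be the union, intersection and symmetric difference of the labeled graphs $G^{(1)}[\pi^{(1)}],G^{(2)}[\pi^{(2)}]$ on $[n]$: $V_\cup$ and $V_\cap$ are the union and the intersection of $\pi^{(1)}(V^{(1)})$ and $\pi^{(2)}(V^{(2)})$ (the elements of $V_\cap$ are the matched nodes), and $V_\Delta$ is the set of nodes incident to $E_\Delta$. Let $\#\mathrm{CC}_G$ and $\#\mathrm{CC}_\Delta$ be the numbers of connected components of $G$ and of $G_\Delta$. A connected component of $G_\Delta$ is pure if it contains no matched node; $\#\mathrm{CC}_{\mathrm{pure}}$ is the number of pure components. For $z\in[n]^n$, the graph $\mathcal N[z;G_\cup]$ has one vertex for each pure component and, if $V_\cap\ne\emptyset$, one further vertex $\omega_0$ standing for the remaining nodes of $V_\cup$;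 two vertices are adjacent if some node $a$ of the first and some node $b$ of the second satisfy $z_a=z_b$. Let $\mathcal A$ be the event that $\mathcal N[z;G_\cup]$ is connected. **Conditions**, with constants $c_{\mathtt s}>1$, $c_{\mathtt m},c_{\mathtt v,1},c_{\mathtt v,2},c_{\mathtt v,3},c_{\mathtt{vd},1},c_{\mathtt{vd},2}\ge0$ and $c_{\mathtt v,4}\ge1$. In the first part of C-Variance and in C-Variance-Permutation, $(G^{(1)},\pi^{(1)}),(G^{(2)},\pi^{(2)})$ range over all pairs of labeled templates whose labeled graphs are not equal, i.e. whose node matching is not perfect. * C-Signal: $\Theta_{ij}\in[0,\lambda]$ for all $i,j$, and $\frac kn\vee\frac{\lambda k}{\sqrt{nq}}\vee\frac\lambda q\le D^{-8c_{\mathtt s}}$. * C-Moment: $|\mathbb E[P_{G,\pi}]|\le (D^{c_{\mathtt m}}\lambda)^{|E|}\big(D^{c_{\mathtt m}}\tfrac kn\big)^{|V|-\#\mathrm{CC}_G}$ for all templates $G$ and all $\pi$. * C-Variance: (1) $\big|\mathbb E[P_{G^{(1)},\pi^{(1)}}P_{G^{(2)},\pi^{(2)}}]\big|\le c_{\mathtt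 v,2}(D^{c_{\mathtt v,1}}\lambda)^{|E_\Delta|}\bar p^{|E_\cap|}\big(D^{c_{\mathtt v,1}}\tfrac kn\big)^{|V_\Delta|-\#\mathrm{CC}_\Delta}$; (2) $\big|\mathbb E[P_{G,\pi}^2]-\bar q^{|E|}\big|\le c_{\mathtt v,3}D^{-c_{\mathtt v,4}}\bar q^{|E|}$ for all templates $G$ and all $\pi$. * C-Variance-Permutation: $$\big|\widetilde{\mathbb E}[\mathbf 1_{\mathcal A}P_{G^{(1)},\pi^{(1)}}P_{G^{(2)},\pi^{(2)}}]\big|\le c_{\mathtt{vd},2}D^{c_{\mathtt{vd},1}}(D^{c_{\mathtt{vd},1}}\lambda)^{|E_\Delta|}\bar p^{|E_\cap|}\Big(D^{c_{\mathtt{vd},1}}\frac kn\Big)^{|V_\Delta|-\#\mathrm{CC}_\Delta}\Big(c_{\mathtt{vd},2}\frac{D^{c_{\mathtt{vd},1}}}{\sqrt n}\Big)^{\#\mathrm{CC}_{\mathrm{pure}}}.$$ **Theorem.** For all values of the constants $c_{\mathtt m},c_{\mathtt v,1},\dots,c_{\mathtt v,4},c_{\mathtt{vd},1},c_{\mathtt{vd},2}$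 in the ranges above there are $c_0>1$ and $c>0$, depending only on these constants, such that the following holds for every $c_{\mathtt s}\ge c_0$ and all $D\ge2$, $n$, $k$, $q$, $\lambda$, $\Theta$ as above. If, under permutation sampling, C-Signal, C-Moment, C-Variance and C-Variance-Permutation hold with these constants, then for all real numbers $\alpha_\emptyset$ and $(\alpha_G)_{G\in\mathcal G_{\le D}}$, with $\|\alpha\|_2^2=\alpha_\emptyset^2+\sum_G\alpha_G^2$, $$\big(1-cD^{-c_{\mathtt s}/2}\big)\|\alpha\|_2^2\le\mathbb E\Big[\Big(\alpha_\emptyset+\sum_{G\in\mathcal G_{\le D}}\alpha_G\Psi_G\Big)^2\Big]\le\big(1+cD^{-c_{\mathtt s}/2}\big)\|\alpha\|_2^2 .$$ -/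

import Mathlib

open Finset
open scoped symmDiff

noncomputable section

namespace NearOrtho

/- ### The latent structure random graph model

An observed simple graph on the nodes `Fin n` (the adjacency `Y⋆`) is encoded by its edge set
`S : Finset (Sym2 (Fin n))`, contained in `allEdges n`. -/

/-- The unordered pairs `{i, j}`, `i ≠ j`, of nodes. -/
def allEdges (n : ℕ) : Finset (Sym2 (Fin n)) :=
  univ.filter fun e => ¬ e.IsDiag

/-- The connection probability `q + Θ (z i) (z j)` of the pair `e = {i, j}`, `i < j`, given the
latent assignment `z`. -/
def edgeProb {n : ℕ} (q : ℝ) (Θ : Matrix (Fin n) (Fin n) ℝ) (z : Fin n → Fin n)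
    (e : Sym2 (Fin n)) : ℝ :=
  q + Θ (z e.inf) (z e.sup)

/-- Expectation of `f` given `z`: the edges are independent, the pair `e` being present with
probability `edgeProb q Θ z e`. -/
def condExpect {n : ℕ} (q : ℝ) (Θ : Matrix (Fin n) (Fin n) ℝ) (z : Fin n → Fin n)
    (f : Finset (Sym2 (Fin n)) → ℝ) : ℝ :=
  ∑ S ∈ (allEdges n).powerset,
    (∏ e ∈ S, edgeProb q Θ z e) * (∏ e ∈ allEdges n \ S, (1 - edgeProb q Θ z e)) * f S

/-- Expectation under permutation sampling: `z` is a uniform permutation of the labels. -/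
def permExpect {n : ℕ} (q : ℝ) (Θ : Matrix (Fin n) (Fin n) ℝ)
    (f : Finset (Sym2 (Fin n)) → ℝ) : ℝ :=
  (∑ σ : Equiv.Perm (Fin n), condExpect q Θ σ f) / (n.factorial : ℝ)

/-- Expectation, under independent sampling (`z` uniform on all maps), of a function of both the
latent assignment and the observed graph. -/
def indepExpect {n : ℕ} (q : ℝ) (Θ : Matrix (Fin n) (Fin n) ℝ)
    (f : (Fin n → Fin n) → Finset (Sym2 (Fin n)) → ℝ) : ℝ :=
  (∑ z : Fin n → Fin n, condExpect q Θ z (f z)) / (n : ℝ) ^ n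

/-- The centered adjacency `Y = Y⋆ - q`, at the pair `e`. -/
def centeredAdj {n : ℕ} (q : ℝ) (S : Finset (Sym2 (Fin n))) (e : Sym2 (Fin n)) : ℝ :=
  (if e ∈ S then 1 else 0) - q

/- ### Templates and invariant polynomials -/

/-- A finite graph, with vertex set `Fin order`. -/
structure FinGraph where
  order : ℕ
  graph : SimpleGraph (Fin order)

/-- The number `|E|` of edges. -/
def FinGraph.size (G : FinGraph) : ℕ := G.graph.edgeSet.ncard

/-- At least one and at most `D` edges, and no isolated node. -/
def FinGraph.IsTemplate (D : ℕ) (G : FinGraph) : Prop :=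
  1 ≤ G.size ∧ G.size ≤ D ∧ ∀ v, ∃ w, G.graph.Adj v w

/-- `𝒢` is a maximal collection of pairwise non-isomorphic templates with at most `D` edges. -/
def IsTemplateCollection (D : ℕ) (𝒢 : Finset FinGraph) : Prop :=
  (∀ G ∈ 𝒢, G.IsTemplate D) ∧
  (∀ G ∈ 𝒢, ∀ H ∈ 𝒢, Nonempty (G.graph ≃g H.graph) → G = H) ∧
  (∀ G : FinGraph, G.IsTemplate D → ∃ H ∈ 𝒢, Nonempty (G.graph ≃g H.graph))

/-- `|Aut(G)|`. -/
def FinGraph.numAut (G : FinGraph) : ℕ := Nat.card (G.graph ≃g G.graph)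

open scoped Classical in
/-- `P_{G,π} = ∏_{(u,v) ∈ E} Y_{π(u),π(v)}`. -/
def monomial {n : ℕ} (q : ℝ) (G : FinGraph) (π : Fin G.order ↪ Fin n)
    (S : Finset (Sym2 (Fin n))) : ℝ :=
  ∏ e ∈ univ.filter (fun e : Sym2 (Fin G.order) => e ∈ G.graph.edgeSet),
    centeredAdj q S (e.map π)

open scoped Classical in
/-- `P_{G_l,π}` for the connected component `G_l = C` of `G`. -/
def componentMonomial {n : ℕ} (q : ℝ) (G : FinGraph) (C : G.graph.ConnectedComponent)
    (π : Fin G.order ↪ Fin n) (S : Finset (Sym2 (Fin n))) : ℝ :=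
  ∏ e ∈ univ.filter (fun e : Sym2 (Fin G.order) => e ∈ G.graph.edgeSet ∧ ∀ v ∈ e, v ∈ C.supp),
    centeredAdj q S (e.map π)

open scoped Classical in
/-- `P̄_{G,π}`: the product over the connected components `G_l` of `P_{G_l,π} - 𝔼[P_{G_l,π}]`,
the expectation being under permutation sampling. -/
def centeredMonomial {n : ℕ} (q : ℝ) (Θ : Matrix (Fin n) (Fin n) ℝ) (G : FinGraph)
    (π : Fin G.order ↪ Fin n) (S : Finset (Sym2 (Fin n))) : ℝ :=
  ∏ C : G.graph.ConnectedComponent,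
    (componentMonomial q G C π S - permExpect q Θ (componentMonomial q G C π))

/-- `q̄ = q (1 - q)`. -/
def qbar (q : ℝ) : ℝ := q * (1 - q)

/-- `p̄ = p (1 - q)² + (1 - p) q²` with `p = lam + q`. -/
def pbar (lam q : ℝ) : ℝ := (lam + q) * (1 - q) ^ 2 + (1 - (lam + q)) * q ^ 2

/-- The variance proxy `𝕍(G) = n! / (n - |V|)! · |Aut(G)| · q̄^|E|`. -/
def varianceProxy (n : ℕ) (q : ℝ) (G : FinGraph) : ℝ :=
  (n.descFactorial G.order : ℝ) * (G.numAut : ℝ) * qbar q ^ G.size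

/-- The basis element `Ψ_G = 𝕍(G)^{-1/2} ∑_π P̄_{G,π}`. -/
def basisPoly {n : ℕ} (q : ℝ) (Θ : Matrix (Fin n) (Fin n) ℝ) (G : FinGraph)
    (S : Finset (Sym2 (Fin n))) : ℝ :=
  (∑ π : Fin G.order ↪ Fin n, centeredMonomial q Θ G π S) / √(varianceProxy n q G)

/- ### Node matchings and merged graphs -/

/-- No node of either graph appears in two pairs. -/
def IsNodeMatching {G H : FinGraph} (M : Set (Fin G.order × Fin H.order)) : Prop :=
  ∀ a ∈ M, ∀ b ∈ M, (a.1 = b.1 ↔ a.2 = b.2)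

/-- All nodes of both graphs are matched, and all edges of both graphs are matched. -/
def IsPerfectMatching {G H : FinGraph} (M : Set (Fin G.order × Fin H.order)) : Prop :=
  IsNodeMatching M ∧ (∀ v, ∃ w, (v, w) ∈ M) ∧ (∀ w, ∃ v, (v, w) ∈ M) ∧
  ∀ a ∈ M, ∀ b ∈ M, (G.graph.Adj a.1 b.1 ↔ H.graph.Adj a.2 b.2)

/-- `(π₁, π₂) ∈ Π(M)`. -/
def Compatible {n : ℕ} {G H : FinGraph} (M : Set (Fin G.order × Fin H.order))
    (π₁ : Fin G.order ↪ Fin n) (π₂ : Fin H.order ↪ Fin n) : Prop :=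
  ∀ v w, π₁ v = π₂ w ↔ (v, w) ∈ M

section Merged

variable {n : ℕ} {G H : FinGraph} (π₁ : Fin G.order ↪ Fin n) (π₂ : Fin H.order ↪ Fin n)

/-- The intersection graph `G_∩` of the labeled graphs `G[π₁]` and `H[π₂]`. -/
def interGraph : SimpleGraph (Fin n) := G.graph.map π₁ ⊓ H.graph.map π₂

/-- The symmetric difference graph `G_Δ`. Its node set `V_Δ` is `(diffGraph π₁ π₂).support`. -/
def diffGraph : SimpleGraph (Fin n) := G.graph.map π₁ ∆ H.graph.map π₂

/-- `V_∪`, the node set of the merged graph `G_∪`. -/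
def unionNodes : Set (Fin n) := Set.range π₁ ∪ Set.range π₂

/-- `V_∩`, the labels of the matched nodes. -/
def interNodes : Set (Fin n) := Set.range π₁ ∩ Set.range π₂

/-- The connected components of `G_Δ`, regarded as a graph on `V_Δ`. -/
def diffComponents : Set (diffGraph π₁ π₂).ConnectedComponent :=
  {C | C.supp ⊆ (diffGraph π₁ π₂).support}

/-- The pure connected components of `G_Δ`: all their nodes are unmatched nodes of `G[π₁]`, or all
their nodes are unmatched nodes of `H[π₂]`. -/
def pureComponents : Set (diffGraph π₁ π₂).ConnectedComponent :=
  {C | C ∈ diffComponents π₁ π₂ ∧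
    (C.supp ⊆ Set.range π₁ \ Set.range π₂ ∨ C.supp ⊆ Set.range π₂ \ Set.range π₁)}

/-- `|E_Δ|`. -/
def numDiffEdges : ℕ := (diffGraph π₁ π₂).edgeSet.ncard

/-- `|E_∩|`. -/
def numInterEdges : ℕ := (interGraph π₁ π₂).edgeSet.ncard

/-- `|V_Δ| - #CC_Δ` (a nonnegative number). -/
def diffRank : ℕ := (diffGraph π₁ π₂).support.ncard - (diffComponents π₁ π₂).ncard

/-- `#CC_pure`. -/
def numPure : ℕ := (pureComponents π₁ π₂).ncard

/-- The node set of `ω₀`: the nodes of `G_∪` outside the pure connected components of `G_Δ`. -/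
def restNodes : Set (Fin n) :=
  unionNodes π₁ π₂ \ ⋃ C ∈ pureComponents π₁ π₂, C.supp

/-- The vertices of the graph `𝒩[z; G_∪]`, each given by its node set: the pure connected components
of `G_Δ`, and `ω₀` if `V_∩` is not empty. -/
def labelBlocks : Set (Set (Fin n)) :=
  {B | (∃ C ∈ pureComponents π₁ π₂, B = C.supp) ∨
    ((interNodes π₁ π₂).Nonempty ∧ B = restNodes π₁ π₂)}

/-- The graph `𝒩[z; G_∪]`: two blocks are adjacent if a node of one has the same latent
assignment as a node of the other. -/
def labelGraph (z : Fin n → Fin n) : SimpleGraph (labelBlocks π₁ π₂) :=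
  SimpleGraph.fromRel fun A B => ∃ a ∈ A.1, ∃ b ∈ B.1, z a = z b

end Merged

/- ### The conditions -/

/-- `C-Signal`. -/
def CSignal (n D k : ℕ) (lam q : ℝ) (Θ : Matrix (Fin n) (Fin n) ℝ) (cs : ℝ) : Prop :=
  (∀ i j, Θ i j ∈ Set.Icc 0 lam) ∧
  max (max ((k : ℝ) / n) (lam * k / √(n * q))) (lam / q) ≤ (D : ℝ) ^ (-(8 * cs))

/-- `C-Moment`, under permutation sampling. -/
def CMoment (n D k : ℕ) (lam q : ℝ) (Θ : Matrix (Fin n) (Fin n) ℝ) (cm : ℝ) : Prop :=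
  ∀ G : FinGraph, G.IsTemplate D → ∀ π : Fin G.order ↪ Fin n,
    |permExpect q Θ (monomial q G π)| ≤
      ((D : ℝ) ^ cm * lam) ^ G.size *
        ((D : ℝ) ^ cm * (k / n)) ^ (G.order - Nat.card G.graph.ConnectedComponent)

/-- `C-Variance`, under permutation sampling. -/
def CVariance (n D k : ℕ) (lam q : ℝ) (Θ : Matrix (Fin n) (Fin n) ℝ)
    (cv1 cv2 cv3 cv4 : ℝ) : Prop :=
  (∀ G H : FinGraph, G.IsTemplate D → H.IsTemplate D →
    ∀ M : Set (Fin G.order × Fin H.order), IsNodeMatching M → ¬ IsPerfectMatching M →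
    ∀ (π₁ : Fin G.order ↪ Fin n) (π₂ : Fin H.order ↪ Fin n), Compatible M π₁ π₂ →
      |permExpect q Θ (fun S => monomial q G π₁ S * monomial q H π₂ S)| ≤
        cv2 * ((D : ℝ) ^ cv1 * lam) ^ numDiffEdges π₁ π₂ * pbar lam q ^ numInterEdges π₁ π₂ *
          ((D : ℝ) ^ cv1 * (k / n)) ^ diffRank π₁ π₂) ∧
  (∀ G : FinGraph, G.IsTemplate D → ∀ π : Fin G.order ↪ Fin n,
    |permExpect q Θ (fun S => monomial q G π S ^ 2) - qbar q ^ G.size| ≤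
      cv3 * (D : ℝ) ^ (-cv4) * qbar q ^ G.size)

open scoped Classical in
/-- `C-Variance-Permutation`; the expectation is under independent sampling, on the event that
the graph `𝒩[z; G_∪]` is connected. -/
def CVariancePerm (n D k : ℕ) (lam q : ℝ) (Θ : Matrix (Fin n) (Fin n) ℝ)
    (cvd1 cvd2 : ℝ) : Prop :=
  ∀ G H : FinGraph, G.IsTemplate D → H.IsTemplate D →
    ∀ M : Set (Fin G.order × Fin H.order), IsNodeMatching M → ¬ IsPerfectMatching M →
    ∀ (π₁ : Fin G.order ↪ Fin n) (π₂ : Fin H.order ↪ Fin n), Compatible M π₁ π₂ →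
      |indepExpect q Θ (fun z S =>
          (if (labelGraph π₁ π₂ z).Connected then 1 else 0) *
            (monomial q G π₁ S * monomial q H π₂ S))| ≤
        cvd2 * (D : ℝ) ^ cvd1 * ((D : ℝ) ^ cvd1 * lam) ^ numDiffEdges π₁ π₂ *
          pbar lam q ^ numInterEdges π₁ π₂ * ((D : ℝ) ^ cvd1 * (k / n)) ^ diffRank π₁ π₂ *
          (cvd2 * ((D : ℝ) ^ cvd1 / √n)) ^ numPure π₁ π₂

end NearOrtho

end

/-! The theorem is a Gram matrix estimate. Every nonempty edge set `H` on the nodes with at most `D`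
edges is a copy of exactly one template. Since each copy of `G` arises from `|Aut G|` labelings,
`Ψ_G` is a combination, with equal coefficients of square sum one, of the polynomials
`centeredEdgePoly q Θ H / w ^ |H|`, where `w = √q̄` and `H` runs over the copies of `G`
(`basisPoly_eq`, `exists_coeff`). It therefore suffices that the Gram matrix of these normalised
polynomials, indexed by all edge sets with at most `D` edges, is close to the identity in operator
norm.

Entries. For `H ≠ H'` the entry is at most `36 u^|H ∆ H'| κ^rk(H ∆ H') s^p`, where `u` is `λ / √q̄`
times a power of `D`, `κ = k/n`, `s = n^(-1/2)` and `p` is the number of pure components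
(`abs_permExpect_centered_mul_le`). The factor `s` per pure component is the heart of the proof. A
uniform permutation, seen on few nodes, is an independent labeling conditioned to be injective.
Inclusion-exclusion over the blocks required to be jointly injective (`permAvg_centered_le`) kills
every term in which some centered block is decoupled from the others, and the remaining alternating
sum vanishes unless each centered block shares a label with another block. To estimate that event
(`avg_prod_hits_le`), the blocks are grouped into clusters with common labels. A cluster of several
blocks is controlled by C-Variance-Permutation, which yields `s` per pure block. A block that is
alone in its cluster, or has been replaced by its mean, forces a coincidence of labels; each lost
label costs `1/n = s²` and accounts for at most two blocks (`card_add_card_le_labelLoss`). The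
result is `abs_permAvg_centered_le`.

The nonpure components are expanded into monomial minus mean. A component replaced by its mean
contains an edge that is no longer doubled, and a spare factor `1/D` for that edge makes the sum
over all choices bounded. On the diagonal the term without replacements is sandwiched pointwise
between powers of `q̄` and `p̄`.

Summation. A Schur test with weights `s^|V(H)|` (`abs_quadratic_form_le`) controls the operator
norm. The number of unmatched nodes is at most the rank of `H ∆ H'` plus the number of pure
components (`card_verts_symmDiff_le`), and `κ = (k/√n) s`, so each node of `H'` outside `H` is
discounted by `1/n`, which pays for its choice. The changed edges lie among `O(D²)` pairs, each with
a small factor `x` dominating both `u` and `u k/√n`; this is where C-Signal enters. -/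

noncomputable section

namespace NearOrtho

section Components

/- ### Components of edge sets -/

variable {n : ℕ}

open scoped Classical in
/-- The nodes incident to an edge set. -/
def verts (F : Finset (Sym2 (Fin n))) : Finset (Fin n) :=
  univ.filter fun v => ∃ e ∈ F, v ∈ e

/-- Two edge sets without common node. -/
def VDisj (A B : Finset (Sym2 (Fin n))) : Prop := Disjoint (verts A) (verts B)

/-- `d` is a union of connected components of the edge set `F`. -/
def IsClosedIn (F d : Finset (Sym2 (Fin n))) : Prop :=
  d ⊆ F ∧ ∀ e ∈ F, ∀ e' ∈ d, (∃ v, v ∈ e ∧ v ∈ e') → e ∈ d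

/-- A nonempty connected edge set. -/
def IsConn (c : Finset (Sym2 (Fin n))) : Prop :=
  c.Nonempty ∧ ∀ d, IsClosedIn c d → d.Nonempty → d = c

open scoped Classical in
/-- The connected components of an edge set. -/
def comps (F : Finset (Sym2 (Fin n))) : Finset (Finset (Sym2 (Fin n))) :=
  F.powerset.filter fun c => IsClosedIn F c ∧ IsConn c

/-- The rank of an edge set in the graphic matroid. -/
def rk (F : Finset (Sym2 (Fin n))) : ℕ := (verts F).card - (comps F).card

variable {A B F c c' d : Finset (Sym2 (Fin n))} {e : Sym2 (Fin n)} {v : Fin n}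

lemma mem_verts : v ∈ verts F ↔ ∃ e ∈ F, v ∈ e := by simp [verts]

lemma exists_mem_sym2 (e : Sym2 (Fin n)) : ∃ v, v ∈ e := by
  induction e with | _ a b => exact ⟨a, by simp⟩

lemma verts_mono (h : A ⊆ B) : verts A ⊆ verts B := by
  intro v hv
  obtain ⟨e, he, hv⟩ := mem_verts.1 hv
  exact mem_verts.2 ⟨e, h he, hv⟩

lemma verts_union : verts (A ∪ B) = verts A ∪ verts B := by
  ext v
  simp only [mem_verts, mem_union, or_and_right, exists_or]

@[simp] lemma verts_empty : verts (∅ : Finset (Sym2 (Fin n))) = ∅ := by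
  ext v; simp [mem_verts]

lemma verts_biUnion {ι : Type*} [DecidableEq ι] (s : Finset ι) (g : ι → Finset (Sym2 (Fin n))) :
    verts (s.biUnion g) = s.biUnion fun i => verts (g i) := by
  ext v
  simp only [mem_verts, mem_biUnion]
  constructor
  · rintro ⟨e, ⟨i, hi, he⟩, hv⟩; exact ⟨i, hi, e, he, hv⟩
  · rintro ⟨i, hi, e, he, hv⟩; exact ⟨e, ⟨i, hi, he⟩, hv⟩

lemma verts_nonempty (h : F.Nonempty) : (verts F).Nonempty := by
  obtain ⟨e, he⟩ := h
  obtain ⟨v, hv⟩ := exists_mem_sym2 e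
  exact ⟨v, mem_verts.2 ⟨e, he, hv⟩⟩

lemma card_verts_le : (verts F).card ≤ 2 * F.card := by
  have h : verts F = F.biUnion fun e => e.toFinset := by
    ext v; simp [mem_verts]
  rw [h, mul_comm]
  refine card_biUnion_le_card_mul _ _ _ fun e _ => ?_
  by_cases he : e.IsDiag
  · rw [Sym2.card_toFinset_of_isDiag _ he]; norm_num
  · rw [Sym2.card_toFinset_of_not_isDiag _ he]

lemma VDisj.symm (h : VDisj A B) : VDisj B A := Disjoint.symm h

lemma VDisj.mono (h : VDisj A B) (hc : c ⊆ A) (hd : d ⊆ B) : VDisj c d :=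
  Disjoint.mono (verts_mono hc) (verts_mono hd) h

lemma vdisj_empty_right : VDisj A ∅ := by simp [VDisj]

lemma vdisj_union_right : VDisj c (A ∪ B) ↔ VDisj c A ∧ VDisj c B := by
  simp [VDisj, verts_union]

lemma vdisj_biUnion_right {s : Finset (Finset (Sym2 (Fin n)))} :
    VDisj A (s.biUnion id) ↔ ∀ c ∈ s, VDisj A c := by
  simp [VDisj, verts_biUnion, disjoint_biUnion_right]

lemma vdisj_biUnion_left {s : Finset (Finset (Sym2 (Fin n)))} :
    VDisj (s.biUnion id) A ↔ ∀ c ∈ s, VDisj c A := by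
  simp [VDisj, verts_biUnion, disjoint_biUnion_left]

lemma VDisj.not_mem (h : VDisj A B) {e' : Sym2 (Fin n)} (he : e ∈ A) (he' : e' ∈ B)
    (hv : v ∈ e) : v ∉ e' := fun hv' =>
  disjoint_left.1 h (mem_verts.2 ⟨e, he, hv⟩) (mem_verts.2 ⟨e', he', hv'⟩)

lemma VDisj.disjoint (h : VDisj A B) : Disjoint A B := by
  refine disjoint_left.2 fun e ha hb => ?_
  obtain ⟨v, hv⟩ := exists_mem_sym2 e
  exact h.not_mem ha hb hv hv

lemma not_vdisj_iff : ¬ VDisj A B ↔ ∃ e ∈ A, ∃ e' ∈ B, ∃ v, v ∈ e ∧ v ∈ e' := by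
  rw [VDisj, not_disjoint_iff]
  constructor
  · rintro ⟨v, h1, h2⟩
    obtain ⟨e, he, hv⟩ := mem_verts.1 h1
    obtain ⟨e', he', hv'⟩ := mem_verts.1 h2
    exact ⟨e, he, e', he', v, hv, hv'⟩
  · rintro ⟨e, he, e', he', v, hv, hv'⟩
    exact ⟨v, mem_verts.2 ⟨e, he, hv⟩, mem_verts.2 ⟨e', he', hv'⟩⟩

lemma not_vdisj_self (h : A.Nonempty) : ¬ VDisj A A := fun h' =>
  h.ne_empty (disjoint_self.1 h'.disjoint)

lemma mem_comps : c ∈ comps F ↔ IsClosedIn F c ∧ IsConn c := by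
  simp only [comps, mem_filter, mem_powerset, and_iff_right_iff_imp]
  exact fun h => h.1.1

lemma subset_of_mem_comps (h : c ∈ comps F) : c ⊆ F := (mem_comps.1 h).1.1

lemma nonempty_of_mem_comps (h : c ∈ comps F) : c.Nonempty := (mem_comps.1 h).2.1

lemma isConn_of_mem_comps (h : c ∈ comps F) : IsConn c := (mem_comps.1 h).2

lemma IsClosedIn.mono (h : IsClosedIn F d) (h1 : d ⊆ A) (h2 : A ⊆ F) : IsClosedIn A d :=
  ⟨h1, fun e he e' he' hv => h.2 e (h2 he) e' he' hv⟩

lemma IsClosedIn.inter (h : IsClosedIn F c) (h' : IsClosedIn F d) : IsClosedIn F (c ∩ d) :=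
  ⟨inter_subset_left.trans h.1, fun e he e' he' hv => mem_inter.2
    ⟨h.2 e he e' (mem_inter.1 he').1 hv, h'.2 e he e' (mem_inter.1 he').2 hv⟩⟩

lemma IsClosedIn.sdiff (h : IsClosedIn F d) : IsClosedIn F (F \ d) :=
  ⟨sdiff_subset, fun e he e' he' ⟨v, hv, hv'⟩ => mem_sdiff.2 ⟨he, fun hd =>
    (mem_sdiff.1 he').2 (h.2 e' (mem_sdiff.1 he').1 e hd ⟨v, hv', hv⟩)⟩⟩

/-- If the two shared a node, an edge of one would lie in the other by closedness; the intersection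
would then be a nonempty closed part of each, hence equal to both. -/
lemma comps_vdisj (h : c ∈ comps F) (h' : c' ∈ comps F) (hne : c ≠ c') : VDisj c c' := by
  by_contra hc
  obtain ⟨e, he, e', he', v, hv, hv'⟩ := not_vdisj_iff.1 hc
  rw [mem_comps] at h h'
  have h1 := h'.1.2 e (h.1.1 he) e' he' ⟨v, hv, hv'⟩
  have h2 : (c ∩ c').Nonempty := ⟨e, mem_inter.2 ⟨he, h1⟩⟩
  have hcl := h.1.inter h'.1
  have e1 := h.2.2 _ (hcl.mono inter_subset_left h.1.1) h2
  have e2 := h'.2.2 _ (hcl.mono inter_subset_right h'.1.1) h2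
  exact hne (e1.symm.trans e2)

/-- The component is the intersection of all closed sets containing `e`. It is connected because
complements of closed sets are closed: a nonempty closed part avoiding `e` would lie in its own
complement. -/
lemma exists_comp (he : e ∈ F) : ∃ c ∈ comps F, e ∈ c := by
  classical
  let c := F.filter fun e' => ∀ d, IsClosedIn F d → e ∈ d → e' ∈ d
  have hec : e ∈ c := mem_filter.2 ⟨he, fun d _ h => h⟩
  have hcl : IsClosedIn F c := ⟨filter_subset _ _, fun a ha a' ha' hv =>
    mem_filter.2 ⟨ha, fun d hd hed => hd.2 a ha a' ((mem_filter.1 ha').2 d hd hed) hv⟩⟩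
  refine ⟨c, mem_comps.2 ⟨hcl, ⟨e, hec⟩, fun d hd hdn => ?_⟩, hec⟩
  have hdF : IsClosedIn F d := ⟨hd.1.trans hcl.1, fun a ha a' ha' hv =>
    hd.2 a (hcl.2 a ha a' (hd.1 ha') hv) a' ha' hv⟩
  by_cases hed : e ∈ d
  · exact hd.1.antisymm fun a ha => (mem_filter.1 ha).2 d hdF hed
  · obtain ⟨a, ha⟩ := hdn
    have := (mem_filter.1 (hd.1 ha)).2 _ hdF.sdiff (mem_sdiff.2 ⟨he, hed⟩)
    exact absurd ha (mem_sdiff.1 this).2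

lemma biUnion_comps : (comps F).biUnion id = F := by
  ext e
  simp only [mem_biUnion, id]
  exact ⟨fun ⟨c, hc, he⟩ => subset_of_mem_comps hc he, exists_comp⟩

lemma mem_comps_of_subset (h : c ∈ comps F) (h1 : c ⊆ A) (h2 : A ⊆ F) : c ∈ comps A :=
  mem_comps.2 ⟨(mem_comps.1 h).1.mono h1 h2, (mem_comps.1 h).2⟩

lemma comps_of_isConn (h : IsConn c) : comps c = {c} := by
  ext d
  rw [mem_comps, mem_singleton]
  constructor
  · rintro ⟨h1, h2⟩; exact h.2 d h1 h2.1
  · rintro rfl; exact ⟨⟨Subset.rfl, fun e he _ _ _ => he⟩, h⟩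

@[simp] lemma comps_empty : comps (∅ : Finset (Sym2 (Fin n))) = ∅ := by
  ext c
  simp only [notMem_empty, iff_false]
  intro h
  exact (nonempty_of_mem_comps h).ne_empty (subset_empty.1 (subset_of_mem_comps h))

lemma VDisj.isClosedIn_union (h : VDisj A B) (hc : IsClosedIn A c) : IsClosedIn (A ∪ B) c := by
  refine ⟨hc.1.trans subset_union_left, fun e he e' he' hv => ?_⟩
  rcases mem_union.1 he with he | he
  · exact hc.2 e he e' he' hv
  · obtain ⟨v, h1, h2⟩ := hv
    exact absurd h1 (h.not_mem (hc.1 he') he h2)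

lemma comps_union (h : VDisj A B) : comps (A ∪ B) = comps A ∪ comps B := by
  ext c
  rw [mem_union]
  constructor
  · intro hc
    by_cases hA : (c ∩ A).Nonempty
    · left
      refine mem_comps_of_subset hc ?_ subset_union_left
      have h1 : IsClosedIn (A ∪ B) A := h.isClosedIn_union ⟨Subset.rfl, fun e he _ _ _ => he⟩
      have h2 := ((mem_comps.1 hc).1.inter h1).mono inter_subset_left (subset_of_mem_comps hc)
      exact inter_eq_left.1 ((isConn_of_mem_comps hc).2 _ h2 hA)
    · right
      refine mem_comps_of_subset hc (fun e he => ?_) subset_union_right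
      exact (mem_union.1 (subset_of_mem_comps hc he)).resolve_left
        fun h => hA ⟨e, mem_inter.2 ⟨he, h⟩⟩
  · rintro (hc | hc)
    · exact mem_comps.2 ⟨h.isClosedIn_union (mem_comps.1 hc).1, (mem_comps.1 hc).2⟩
    · rw [union_comm]
      exact mem_comps.2 ⟨h.symm.isClosedIn_union (mem_comps.1 hc).1, (mem_comps.1 hc).2⟩

/-- A family of connected, pairwise node-disjoint edge sets. -/
def IsConnFamily (s : Finset (Finset (Sym2 (Fin n)))) : Prop :=
  (∀ c ∈ s, IsConn c) ∧ ∀ c ∈ s, ∀ c' ∈ s, c ≠ c' → VDisj c c'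

lemma isConnFamily_comps : IsConnFamily (comps F) :=
  ⟨fun _ h => isConn_of_mem_comps h, fun _ h _ h' => comps_vdisj h h'⟩

lemma IsConnFamily.mono {s t : Finset (Finset (Sym2 (Fin n)))} (h : IsConnFamily t) (hs : s ⊆ t) :
    IsConnFamily s :=
  ⟨fun c hc => h.1 c (hs hc), fun c hc c' hc' => h.2 c (hs hc) c' (hs hc')⟩

/-- A node-disjoint connected family is recovered from its union, so families of components and edge
sets can be used interchangeably. -/
lemma comps_biUnion {s : Finset (Finset (Sym2 (Fin n)))} (h : IsConnFamily s) :
    comps (s.biUnion id) = s := by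
  induction s using Finset.induction_on with
  | empty => simp
  | insert c s hc ih =>
    rw [biUnion_insert, comps_union, ih (h.mono (subset_insert _ _)), id,
      comps_of_isConn (h.1 c (mem_insert_self _ _))]
    · rfl
    · rw [vdisj_biUnion_right]
      exact fun c' hc' => h.2 c (mem_insert_self _ _) c' (mem_insert_of_mem hc')
        (fun h => hc (h ▸ hc'))

lemma IsConnFamily.card_biUnion {s : Finset (Finset (Sym2 (Fin n)))} (h : IsConnFamily s) :
    (s.biUnion id).card = ∑ c ∈ s, c.card :=
  Finset.card_biUnion fun c hc c' hc' hne => (h.2 c hc c' hc' hne).disjoint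

lemma IsConnFamily.card_le {s : Finset (Finset (Sym2 (Fin n)))} (h : IsConnFamily s) :
    s.card ≤ (s.biUnion id).card := by
  rw [h.card_biUnion, card_eq_sum_ones]
  exact sum_le_sum fun c hc => (h.1 c hc).1.card_pos

lemma card_comps_le : (comps F).card ≤ F.card := by
  simpa [biUnion_comps] using (isConnFamily_comps (F := F)).card_le

lemma verts_eq_biUnion_comps : verts F = (comps F).biUnion verts := by
  conv_lhs => rw [← biUnion_comps (F := F), verts_biUnion]
  rfl

lemma card_verts_eq : (verts F).card = ∑ c ∈ comps F, (verts c).card := by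
  rw [verts_eq_biUnion_comps, Finset.card_biUnion]
  exact fun c hc c' hc' hne => comps_vdisj hc hc' hne

lemma card_comps_le_card_verts : (comps F).card ≤ (verts F).card := by
  rw [card_verts_eq, card_eq_sum_ones]
  exact sum_le_sum fun c hc => (verts_nonempty (nonempty_of_mem_comps hc)).card_pos

lemma rk_add_card_comps : rk F + (comps F).card = (verts F).card :=
  Nat.sub_add_cancel card_comps_le_card_verts

lemma comps_disjoint_of_vdisj (h : VDisj A B) : Disjoint (comps A) (comps B) := by
  refine disjoint_left.2 fun c ha hb => not_vdisj_self (nonempty_of_mem_comps ha) ?_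
  exact h.mono (subset_of_mem_comps ha) (subset_of_mem_comps hb)

lemma rk_union (h : VDisj A B) : rk (A ∪ B) = rk A + rk B := by
  have h1 := rk_add_card_comps (F := A)
  have h2 := rk_add_card_comps (F := B)
  have h3 := rk_add_card_comps (F := A ∪ B)
  rw [comps_union h, verts_union, card_union_of_disjoint h,
    card_union_of_disjoint (comps_disjoint_of_vdisj h)] at h3
  omega

@[simp] lemma rk_empty : rk (∅ : Finset (Sym2 (Fin n))) = 0 := by simp [rk]

lemma rk_biUnion {s : Finset (Finset (Sym2 (Fin n)))} (h : IsConnFamily s) :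
    rk (s.biUnion id) = ∑ c ∈ s, rk c := by
  induction s using Finset.induction_on with
  | empty => simp
  | insert c s hc ih =>
    rw [biUnion_insert, rk_union, ih (h.mono (subset_insert _ _)), sum_insert hc]
    · rfl
    · rw [vdisj_biUnion_right]
      exact fun c' hc' => h.2 c (mem_insert_self _ _) c' (mem_insert_of_mem hc')
        (fun h => hc (h ▸ hc'))

/- ### Pure components -/

open scoped Classical in
/-- The components of `A` that have no node in common with `B`. -/
def purePart (A B : Finset (Sym2 (Fin n))) : Finset (Finset (Sym2 (Fin n))) :=
  (comps A).filter fun c => VDisj c B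

/-- The pure components of the pair `A`, `B`. -/
def pureBlocks (A B : Finset (Sym2 (Fin n))) : Finset (Finset (Sym2 (Fin n))) :=
  purePart A B ∪ purePart B A

lemma mem_purePart : c ∈ purePart A B ↔ c ∈ comps A ∧ VDisj c B := by simp [purePart]

lemma purePart_subset : purePart A B ⊆ comps A :=
  fun _ h => (mem_purePart.1 h).1

lemma purePart_disjoint : Disjoint (purePart A B) (purePart B A) := by
  refine disjoint_left.2 fun c ha hb => ?_
  rw [mem_purePart] at ha hb
  exact not_vdisj_self (nonempty_of_mem_comps ha.1)
    (ha.2.mono Subset.rfl (subset_of_mem_comps hb.1))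

lemma isConnFamily_pureBlocks : IsConnFamily (pureBlocks A B) := by
  refine ⟨fun c hc => ?_, fun c hc c' hc' hne => ?_⟩
  · rcases mem_union.1 hc with hc | hc <;> exact isConn_of_mem_comps (purePart_subset hc)
  · rcases mem_union.1 hc with hc | hc <;> rcases mem_union.1 hc' with hc' | hc' <;>
      rw [mem_purePart] at hc hc'
    · exact comps_vdisj hc.1 hc'.1 hne
    · exact hc.2.mono Subset.rfl (subset_of_mem_comps hc'.1)
    · exact hc.2.mono Subset.rfl (subset_of_mem_comps hc'.1)
    · exact comps_vdisj hc.1 hc'.1 hne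

/-- A component of `A ∆ B` without matched nodes cannot mix edges of `A` and `B`, since the node
where the two kinds meet would be matched. This reconciles pure components of `G_Δ` with components
of one edge set that avoid the other. -/
lemma mem_comps_symmDiff_iff : c ∈ pureBlocks A B ↔
    c ∈ comps (A ∆ B) ∧ Disjoint (verts c) (verts A ∩ verts B) := by
  have key : ∀ A B : Finset (Sym2 (Fin n)), c ∈ purePart A B →
      c ∈ comps (A ∆ B) ∧ Disjoint (verts c) (verts A ∩ verts B) := by
    intro A B hc
    rw [mem_purePart] at hc
    have hcl := (mem_comps.1 hc.1).1
    refine ⟨mem_comps.2 ⟨⟨fun e he => ?_, fun e he e' he' hv => ?_⟩, (mem_comps.1 hc.1).2⟩, ?_⟩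
    · rw [mem_symmDiff]
      exact Or.inl ⟨hcl.1 he, fun h => disjoint_left.1 hc.2.disjoint he h⟩
    · rcases mem_symmDiff.1 he with h | h
      · exact hcl.2 e h.1 e' he' hv
      · obtain ⟨v, h1, h2⟩ := hv
        exact absurd h1 (hc.2.not_mem he' h.1 h2)
    · exact Disjoint.mono_right inter_subset_right hc.2
  constructor
  · intro h
    rcases mem_union.1 h with h | h
    · exact key A B h
    · have := key B A h
      rwa [symmDiff_comm, inter_comm] at this
  · rintro ⟨hc, hd⟩
    have key2 : ∀ A B : Finset (Sym2 (Fin n)), c ∈ comps (A ∆ B) →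
        Disjoint (verts c) (verts A ∩ verts B) → (c ∩ A).Nonempty → c ∈ purePart A B := by
      intro A B hc hd hne
      have hcl := (mem_comps.1 hc).1
      have hcA : c ⊆ A := by
        have : IsClosedIn c (c ∩ A) := by
          refine ⟨inter_subset_left, fun e he e' he' ⟨v, h1, h2⟩ => ?_⟩
          rw [mem_inter] at he' ⊢
          refine ⟨he, ?_⟩
          by_contra hA
          have hB : e ∈ B := by
            rcases mem_symmDiff.1 (hcl.1 he) with h | h
            · exact absurd h.1 hA
            · exact h.1
          exact disjoint_left.1 hd (mem_verts.2 ⟨e, he, h1⟩)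
            (mem_inter.2 ⟨mem_verts.2 ⟨e', he'.2, h2⟩, mem_verts.2 ⟨e, hB, h1⟩⟩)
        exact inter_eq_left.1 ((isConn_of_mem_comps hc).2 _ this hne)
      have hcB : VDisj c B := by
        refine disjoint_left.2 fun v h1 h2 => disjoint_left.1 hd h1
          (mem_inter.2 ⟨verts_mono hcA h1, h2⟩)
      refine mem_purePart.2 ⟨mem_comps.2 ⟨⟨hcA, fun e he e' he' hv => ?_⟩,
        isConn_of_mem_comps hc⟩, hcB⟩
      refine hcl.2 e (mem_symmDiff.2 (Or.inl ⟨he, fun hB => ?_⟩)) e' he' hv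
      obtain ⟨v, h1, h2⟩ := hv
      exact hcB.not_mem he' hB h2 h1
    rw [pureBlocks, mem_union]
    by_cases hA : (c ∩ A).Nonempty
    · exact Or.inl (key2 A B hc hd hA)
    · right
      rw [symmDiff_comm] at hc
      rw [inter_comm] at hd
      refine key2 B A hc hd ?_
      obtain ⟨e, he⟩ := nonempty_of_mem_comps hc
      refine ⟨e, mem_inter.2 ⟨he, ?_⟩⟩
      rcases mem_symmDiff.1 (subset_of_mem_comps hc he) with h | h
      · exact h.1
      · exact absurd ⟨e, mem_inter.2 ⟨he, h.1⟩⟩ hA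

lemma pureBlocks_eq : pureBlocks A B =
    (comps (A ∆ B)).filter fun c => Disjoint (verts c) (verts A ∩ verts B) := by
  ext c; rw [mem_comps_symmDiff_iff, mem_filter]

lemma verts_symmDiff_subset_verts : verts A ∆ verts B ⊆ verts (A ∆ B) := by
  intro v hv
  rcases mem_symmDiff.1 hv with ⟨h1, h2⟩ | ⟨h1, h2⟩ <;> obtain ⟨e, he, hve⟩ := mem_verts.1 h1 <;>
    refine mem_verts.2 ⟨e, mem_symmDiff.2 ?_, hve⟩
  · exact Or.inl ⟨he, fun h => h2 (mem_verts.2 ⟨e, h, hve⟩)⟩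
  · exact Or.inr ⟨he, fun h => h2 (mem_verts.2 ⟨e, h, hve⟩)⟩

/-- The number of unmatched nodes is at most the rank of the symmetric difference plus the number
of pure components. -/
lemma card_verts_symmDiff_le :
    (verts A ∆ verts B).card ≤ rk (A ∆ B) + (pureBlocks A B).card := by
  have h1 := rk_add_card_comps (F := A ∆ B)
  -- Each nonpure component contains a matched node, and distinct components contain distinct ones.
  -- Hence the nonpure components are at most as many as the matched nodes of `A ∆ B`.
  have h2 : ((comps (A ∆ B)).filter
      fun c => ¬ Disjoint (verts c) (verts A ∩ verts B)).card ≤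
      (verts (A ∆ B) \ (verts A ∆ verts B)).card := by
    have hch : ∀ c ∈ (comps (A ∆ B)).filter
        (fun c => ¬ Disjoint (verts c) (verts A ∩ verts B)),
        ∃ v, v ∈ verts c ∧ v ∈ verts A ∩ verts B := by
      intro c hc
      exact not_disjoint_iff.1 (mem_filter.1 hc).2
    rcases isEmpty_or_nonempty (Fin n) with hn | hn
    · rw [filter_eq_empty_iff.2 fun c hc h => ?_]
      · simp
      · exact hn.elim (hch c (mem_filter.2 ⟨hc, h⟩)).choose
    choose! g hg using hch
    refine card_le_card_of_injOn g (fun c hc => ?_) (fun c hc c' hc' heq => ?_)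
    · have := hg c hc
      have hc1 := subset_of_mem_comps (mem_filter.1 hc).1
      refine mem_coe.2 (mem_sdiff.2 ⟨verts_mono hc1 this.1, fun h => ?_⟩)
      have h3 := mem_inter.1 this.2
      rcases mem_symmDiff.1 h with h | h
      · exact h.2 h3.2
      · exact h.2 h3.1
    · by_contra hne
      have := comps_vdisj (mem_filter.1 hc).1 (mem_filter.1 hc').1 hne
      exact disjoint_left.1 this (hg c hc).1 (heq ▸ (hg c' hc').1)
  have h3 := Finset.card_filter_add_card_filter_not (s := comps (A ∆ B))
    (fun c => Disjoint (verts c) (verts A ∩ verts B))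
  have h4 := card_sdiff_add_card_eq_card (verts_symmDiff_subset_verts (A := A) (B := B))
  rw [← pureBlocks_eq] at h3
  omega

end Components

section LabeledGraphs

/- ### Edge sets of labeled graphs -/

variable {n m : ℕ}

open scoped Classical in
/-- The edge set of the labeled graph `G[π]`. -/
def edgeImage (G : SimpleGraph (Fin m)) (π : Fin m ↪ Fin n) : Finset (Sym2 (Fin n)) :=
  (univ.filter fun e : Sym2 (Fin m) => e ∈ G.edgeSet).map π.sym2Map

open scoped Classical in
/-- The edge set of a component of the labeled graph `G[π]`. -/
def compEdges (G : SimpleGraph (Fin m)) (π : Fin m ↪ Fin n) (C : G.ConnectedComponent) :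
    Finset (Sym2 (Fin n)) :=
  (univ.filter fun e : Sym2 (Fin m) => e ∈ G.edgeSet ∧ ∀ v ∈ e, v ∈ C.supp).map π.sym2Map

variable {G : SimpleGraph (Fin m)} {π : Fin m ↪ Fin n} {C C' : G.ConnectedComponent}

lemma mem_edgeImage {e : Sym2 (Fin n)} :
    e ∈ edgeImage G π ↔ ∃ a ∈ G.edgeSet, a.map π = e := by
  simp [edgeImage]

lemma mem_compEdges {e : Sym2 (Fin n)} :
    e ∈ compEdges G π C ↔ ∃ a ∈ G.edgeSet, (∀ v ∈ a, v ∈ C.supp) ∧ a.map π = e := by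
  simp [compEdges, and_assoc]

lemma compEdges_subset : compEdges G π C ⊆ edgeImage G π := by
  intro e he
  obtain ⟨a, ha, _, h⟩ := mem_compEdges.1 he
  exact mem_edgeImage.2 ⟨a, ha, h⟩

lemma supp_of_mem_edge {a : Sym2 (Fin m)} (ha : a ∈ G.edgeSet) {v : Fin m} (hv : v ∈ a)
    (hC : v ∈ C.supp) : ∀ w ∈ a, w ∈ C.supp := by
  induction a with | _ x y =>
  rw [SimpleGraph.mem_edgeSet] at ha
  simp only [Sym2.mem_iff] at hv ⊢
  have hxy : x ∈ C.supp ↔ y ∈ C.supp := C.mem_supp_congr_adj ha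
  rintro w (rfl | rfl) <;> rcases hv with rfl | rfl <;> tauto

lemma share_map {a b : Sym2 (Fin m)} (h : ∃ v, v ∈ a.map π ∧ v ∈ b.map π) :
    ∃ v, v ∈ a ∧ v ∈ b := by
  obtain ⟨v, h1, h2⟩ := h
  rw [Sym2.mem_map] at h1 h2
  obtain ⟨x, hx, rfl⟩ := h1
  obtain ⟨y, hy, hxy⟩ := h2
  exact ⟨x, hx, π.injective hxy ▸ hy⟩

lemma compEdges_mem_comps (h : (compEdges G π C).Nonempty) :
    compEdges G π C ∈ comps (edgeImage G π) := by
  refine mem_comps.2 ⟨⟨compEdges_subset, ?_⟩, h, ?_⟩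
  · intro e he e' he' hv
    obtain ⟨a, ha, rfl⟩ := mem_edgeImage.1 he
    obtain ⟨b, hb, hbC, rfl⟩ := mem_compEdges.1 he'
    obtain ⟨v, hva, hvb⟩ := share_map hv
    exact mem_compEdges.2 ⟨a, ha, supp_of_mem_edge ha hva (hbC v hvb), rfl⟩
  · rintro d hd ⟨e, he⟩
    refine hd.1.antisymm fun e' he' => ?_
    obtain ⟨a, ha, haC, rfl⟩ := mem_compEdges.1 (hd.1 he)
    obtain ⟨v, hv⟩ := exists_mem_sym2 a
    -- A closed set containing one edge at a node contains all edges there; this propagates along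
    -- walks through the component.
    have key : ∀ w, G.Reachable v w → ∀ b ∈ G.edgeSet, w ∈ b → b.map π ∈ d := by
      rintro w ⟨p⟩
      have hstep : ∀ u : Fin m, u ∈ C.supp → (∃ b ∈ G.edgeSet, u ∈ b ∧ b.map π ∈ d) →
          ∀ b ∈ G.edgeSet, u ∈ b → b.map π ∈ d := by
        rintro u hu ⟨b, hb, hub, hbd⟩ b' hb' hub'
        refine hd.2 _ (mem_compEdges.2 ⟨b', hb', supp_of_mem_edge hb' hub' hu, rfl⟩) _ hbd
          ⟨π u, ?_, ?_⟩
        · exact Sym2.mem_map.2 ⟨u, hub', rfl⟩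
        · exact Sym2.mem_map.2 ⟨u, hub, rfl⟩
      have hgen : ∀ {u w : Fin m} (p : G.Walk u w), u ∈ C.supp →
          (∀ b ∈ G.edgeSet, u ∈ b → b.map π ∈ d) → ∀ b ∈ G.edgeSet, w ∈ b → b.map π ∈ d := by
        intro u w p
        induction p with
        | nil => exact fun _ h => h
        | cons hadj p ih =>
          intro hu h
          have hu' := (C.mem_supp_congr_adj hadj).1 hu
          exact ih hu' (hstep _ hu' ⟨_, hadj, Sym2.mem_mk_right _ _, h _ hadj
            (Sym2.mem_mk_left _ _)⟩)
      exact hgen p (haC v hv) (hstep v (haC v hv) ⟨a, ha, hv, he⟩)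
    obtain ⟨b, hb, hbC, rfl⟩ := mem_compEdges.1 he'
    obtain ⟨w, hw⟩ := exists_mem_sym2 b
    have h1 := haC v hv
    have h2 := hbC w hw
    rw [SimpleGraph.ConnectedComponent.mem_supp_iff] at h1 h2
    exact key w (SimpleGraph.ConnectedComponent.exact (h1.trans h2.symm)) b hb hw

lemma exists_compEdges_eq {c : Finset (Sym2 (Fin n))} (hc : c ∈ comps (edgeImage G π)) :
    ∃ C, compEdges G π C = c := by
  obtain ⟨e, he⟩ := nonempty_of_mem_comps hc
  obtain ⟨a, ha, rfl⟩ := mem_edgeImage.1 (subset_of_mem_comps hc he)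
  obtain ⟨v, hv⟩ := exists_mem_sym2 a
  have hmem : a.map π ∈ compEdges G π (G.connectedComponentMk v) :=
    mem_compEdges.2 ⟨a, ha, supp_of_mem_edge ha hv rfl, rfl⟩
  refine ⟨G.connectedComponentMk v, ?_⟩
  by_contra hne
  exact disjoint_left.1 (comps_vdisj (compEdges_mem_comps ⟨_, hmem⟩) hc hne).disjoint hmem he

/-- Nonemptiness is essential: all isolated nodes have the same, empty, edge set. -/
lemma compEdges_injective (h : (compEdges G π C).Nonempty)
    (heq : compEdges G π C = compEdges G π C') : C = C' := by
  obtain ⟨e, he⟩ := h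
  have he' := heq ▸ he
  obtain ⟨a, ha, haC, rfl⟩ := mem_compEdges.1 he
  obtain ⟨b, hb, hbC, hab⟩ := mem_compEdges.1 he'
  obtain rfl := π.sym2Map.injective hab
  obtain ⟨v, hv⟩ := exists_mem_sym2 b
  exact (haC v hv).symm.trans (hbC v hv)

lemma compEdges_nonempty_iff :
    (compEdges G π C).Nonempty ↔ ∃ v ∈ C.supp, v ∈ G.support := by
  constructor
  · rintro ⟨e, he⟩
    obtain ⟨a, ha, haC, rfl⟩ := mem_compEdges.1 he
    induction a with | _ x y =>
    exact ⟨x, haC x (Sym2.mem_mk_left _ _), y, ha⟩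
  · rintro ⟨v, hv, w, hw⟩
    exact ⟨_, mem_compEdges.2 ⟨s(v, w), hw, supp_of_mem_edge hw (Sym2.mem_mk_left _ _) hv, rfl⟩⟩

lemma supp_subset_support (h : ∃ v ∈ C.supp, v ∈ G.support) : C.supp ⊆ G.support := by
  obtain ⟨v, hv, hvs⟩ := h
  intro w hw
  obtain ⟨p⟩ := SimpleGraph.ConnectedComponent.exact
    ((C.mem_supp_iff w).1 hw |>.trans ((C.mem_supp_iff v).1 hv).symm)
  cases p with
  | nil => exact hvs
  | cons h _ => exact ⟨_, h⟩

lemma verts_edgeImage : (verts (edgeImage G π) : Set (Fin n)) = π '' G.support := by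
  ext v
  simp only [mem_coe, mem_verts, mem_edgeImage]
  constructor
  · rintro ⟨_, ⟨a, ha, rfl⟩, hv⟩
    obtain ⟨x, hx, rfl⟩ := Sym2.mem_map.1 hv
    induction a with | _ y z =>
    rw [Sym2.mem_iff] at hx
    rcases hx with rfl | rfl
    · exact ⟨x, ⟨z, ha⟩, rfl⟩
    · exact ⟨x, ⟨y, SimpleGraph.Adj.symm ha⟩, rfl⟩
  · rintro ⟨x, ⟨y, hxy⟩, rfl⟩
    exact ⟨_, ⟨s(x, y), hxy, rfl⟩, Sym2.mem_map.2 ⟨x, Sym2.mem_mk_left _ _, rfl⟩⟩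

lemma verts_compEdges (h : (compEdges G π C).Nonempty) :
    (verts (compEdges G π C) : Set (Fin n)) = π '' C.supp := by
  have hs := supp_subset_support (compEdges_nonempty_iff.1 h)
  ext v
  simp only [mem_coe, mem_verts, mem_compEdges]
  constructor
  · rintro ⟨_, ⟨a, ha, haC, rfl⟩, hv⟩
    obtain ⟨x, hx, rfl⟩ := Sym2.mem_map.1 hv
    exact ⟨x, haC x hx, rfl⟩
  · rintro ⟨x, hx, rfl⟩
    obtain ⟨y, hxy⟩ := hs hx
    exact ⟨_, ⟨s(x, y), hxy, supp_of_mem_edge hxy (Sym2.mem_mk_left _ _) hx, rfl⟩,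
      Sym2.mem_map.2 ⟨x, Sym2.mem_mk_left _ _, rfl⟩⟩

/-- The components with an edge correspond to the components of the edge set. -/
lemma card_comps_edgeImage :
    (comps (edgeImage G π)).card = {C : G.ConnectedComponent | C.supp ⊆ G.support}.ncard := by
  classical
  have h1 : {C : G.ConnectedComponent | C.supp ⊆ G.support} =
      {C : G.ConnectedComponent | (compEdges G π C).Nonempty} := by
    ext C
    rw [Set.mem_ofPred_eq, Set.mem_ofPred_eq, compEdges_nonempty_iff]
    refine ⟨fun h => ?_, supp_subset_support⟩
    obtain ⟨v, hv⟩ := C.nonempty_supp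
    exact ⟨v, hv, h hv⟩
  have h2 : (comps (edgeImage G π) : Set _) =
      compEdges G π '' {C : G.ConnectedComponent | (compEdges G π C).Nonempty} := by
    ext c
    rw [mem_coe, Set.mem_image]
    constructor
    · intro hc
      obtain ⟨C, rfl⟩ := exists_compEdges_eq hc
      exact ⟨C, nonempty_of_mem_comps hc, rfl⟩
    · rintro ⟨C, hC, rfl⟩
      exact compEdges_mem_comps hC
  rw [h1, ← Set.ncard_coe_finset, h2]
  exact Set.InjOn.ncard_image fun C hC C' _ h => compEdges_injective hC h

lemma card_verts_edgeImage : (verts (edgeImage G π)).card = G.support.ncard := by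
  rw [← Set.ncard_coe_finset, verts_edgeImage, Set.ncard_image_of_injective _ π.injective]

lemma card_edgeImage : (edgeImage G π).card = G.edgeSet.ncard := by
  classical
  rw [edgeImage, card_map, ← Set.ncard_coe_finset]
  congr 1
  ext e; simp

lemma rk_edgeImage :
    rk (edgeImage G π) =
      G.support.ncard - {C : G.ConnectedComponent | C.supp ⊆ G.support}.ncard := by
  rw [rk, card_comps_edgeImage, card_verts_edgeImage]

lemma support_eq_univ (hG : ∀ v, ∃ w, G.Adj v w) : G.support = Set.univ :=
  Set.eq_univ_of_forall hG

lemma rk_edgeImage_of_no_isolated (hG : ∀ v, ∃ w, G.Adj v w) :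
    rk (edgeImage G π) = m - Nat.card G.ConnectedComponent := by
  rw [rk_edgeImage, support_eq_univ hG]
  simp [Set.ncard_univ]

/-- The rank is the number of nodes minus the number of components, isolated nodes included. -/
lemma rk_edgeImage_add_card (G : SimpleGraph (Fin m)) (π : Fin m ↪ Fin n) :
    rk (edgeImage G π) + Nat.card G.ConnectedComponent = m := by
  classical
  have h1 := rk_add_card_comps (F := edgeImage G π)
  rw [card_comps_edgeImage, card_verts_edgeImage] at h1
  -- The remaining components are the isolated nodes, so they add as much to the number of nodes as
  -- to the number of components.
  have h2 : {C : G.ConnectedComponent | C.supp ⊆ G.support}ᶜ =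
      G.connectedComponentMk '' G.supportᶜ := by
    ext C
    simp only [Set.mem_compl_iff, Set.mem_ofPred_eq, Set.mem_image]
    constructor
    · intro h
      obtain ⟨v, hv, hvs⟩ := Set.not_subset.1 h
      exact ⟨v, hvs, hv⟩
    · rintro ⟨v, hv, rfl⟩ h
      exact hv (h rfl)
  have h3 : (G.connectedComponentMk '' G.supportᶜ).ncard = G.supportᶜ.ncard := by
    refine Set.InjOn.ncard_image fun v hv w _ hvw => ?_
    obtain ⟨p⟩ := SimpleGraph.ConnectedComponent.exact hvw
    cases p with
    | nil => rfl
    | cons h _ => exact absurd ⟨_, h⟩ hv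
  have h4 := Set.ncard_add_ncard_compl {C : G.ConnectedComponent | C.supp ⊆ G.support}
  have h5 := Set.ncard_add_ncard_compl G.support
  rw [h2, h3] at h4
  rw [Nat.card_fin] at h5
  omega

/- ### Subadditivity of the rank -/

lemma edgeImage_fromEdgeSet {F : Finset (Sym2 (Fin n))} (hF : F ⊆ allEdges n) :
    edgeImage (SimpleGraph.fromEdgeSet (F : Set (Sym2 (Fin n)))) (Function.Embedding.refl _) =
      F := by
  ext e
  simp only [mem_edgeImage, SimpleGraph.edgeSet_fromEdgeSet, Function.Embedding.coe_refl,
    Sym2.map_id, id, exists_eq_right, Set.mem_sdiff, mem_coe]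
  refine ⟨fun h => h.1, fun h => ⟨h, ?_⟩⟩
  simpa [allEdges] using hF h

/-- The rank is `n` minus the dimension of the kernel of the graph Laplacian, that is, of the
functions constant along edges. The kernel of a union is the intersection of the kernels, and the
dimension formula gives subadditivity. -/
lemma rk_union_le {A B : Finset (Sym2 (Fin n))} (hA : A ⊆ allEdges n) (hB : B ⊆ allEdges n) :
    rk (A ∪ B) ≤ rk A + rk B := by
  classical
  let Γ := fun F : Finset (Sym2 (Fin n)) => SimpleGraph.fromEdgeSet (F : Set (Sym2 (Fin n)))
  let W := fun F => LinearMap.ker ((Γ F).lapMatrix ℝ).toLin'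
  have hW : ∀ F, ∀ x, x ∈ W F ↔ ∀ i j, (Γ F).Adj i j → x i = x j := by
    intro F x
    rw [LinearMap.mem_ker, Matrix.toLin'_apply,
      SimpleGraph.lapMatrix_mulVec_eq_zero_iff_forall_adj]
  have hrk : ∀ F, F ⊆ allEdges n → rk F + Module.finrank ℝ (W F) = n := by
    intro F hF
    have h := rk_edgeImage_add_card (Γ F) (Function.Embedding.refl _)
    rw [edgeImage_fromEdgeSet hF, Nat.card_eq_fintype_card,
      SimpleGraph.card_connectedComponent_eq_finrank_ker_toLin'_lapMatrix] at h
    exact h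
  have hinf : W (A ∪ B) = W A ⊓ W B := by
    ext x
    rw [Submodule.mem_inf, hW, hW, hW]
    simp only [Γ, coe_union, SimpleGraph.fromEdgeSet_adj, Set.mem_union]
    constructor
    · exact fun h => ⟨fun i j hij => h i j ⟨Or.inl hij.1, hij.2⟩,
        fun i j hij => h i j ⟨Or.inr hij.1, hij.2⟩⟩
    · rintro ⟨h1, h2⟩ i j ⟨h | h, hne⟩
      exacts [h1 i j ⟨h, hne⟩, h2 i j ⟨h, hne⟩]
  have h1 := Submodule.finrank_sup_add_finrank_inf_eq (W A) (W B)
  have h2 := Submodule.finrank_le (W A ⊔ W B)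
  rw [Module.finrank_fin_fun] at h2
  have hA' := hrk A hA
  have hB' := hrk B hB
  have hAB := hrk (A ∪ B) (union_subset hA hB)
  rw [hinf] at hAB
  omega

lemma rk_biUnion_le {ι : Type*} [DecidableEq ι] (s : Finset ι)
    (g : ι → Finset (Sym2 (Fin n))) (hg : ∀ i ∈ s, g i ⊆ allEdges n) :
    rk (s.biUnion g) ≤ ∑ i ∈ s, rk (g i) := by
  induction s using Finset.induction_on with
  | empty => simp
  | insert i s hi ih =>
    rw [biUnion_insert, sum_insert hi]
    have h1 : ∀ j ∈ s, g j ⊆ allEdges n := fun j hj => hg j (mem_insert_of_mem hj)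
    exact (rk_union_le (hg i (mem_insert_self _ _)) (biUnion_subset.2 h1)).trans
      (Nat.add_le_add_left (ih h1) _)

lemma rk_singleton_le (e : Sym2 (Fin n)) : rk {e} ≤ 1 := by
  have h1 := rk_add_card_comps (F := ({e} : Finset (Sym2 (Fin n))))
  have h2 := card_verts_le (F := ({e} : Finset (Sym2 (Fin n))))
  have h3 : 0 < (comps ({e} : Finset (Sym2 (Fin n)))).card := by
    obtain ⟨c, hc, _⟩ := exists_comp (mem_singleton_self e)
    exact card_pos.2 ⟨c, hc⟩
  rw [card_singleton] at h2
  omega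

lemma rk_le_card {F : Finset (Sym2 (Fin n))} (hF : F ⊆ allEdges n) : rk F ≤ F.card := by
  classical
  have h : F.biUnion (fun e => {e}) = F := by ext; simp
  calc rk F = rk (F.biUnion fun e => {e}) := by rw [h]
    _ ≤ ∑ e ∈ F, rk {e} := rk_biUnion_le _ _ fun e he => singleton_subset_iff.2 (hF he)
    _ ≤ ∑ e ∈ F, 1 := sum_le_sum fun e _ => rk_singleton_le e
    _ = F.card := by simp

/-- With all `n` nodes kept, rank plus number of components is `n`, and adding edges can only merge
components. -/
lemma rk_mono {A B : Finset (Sym2 (Fin n))} (h : A ⊆ B) (hB : B ⊆ allEdges n) :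
    rk A ≤ rk B := by
  classical
  let Γ := fun F : Finset (Sym2 (Fin n)) => SimpleGraph.fromEdgeSet (F : Set (Sym2 (Fin n)))
  have h1 := rk_edgeImage_add_card (Γ A) (Function.Embedding.refl _)
  have h2 := rk_edgeImage_add_card (Γ B) (Function.Embedding.refl _)
  rw [edgeImage_fromEdgeSet (h.trans hB)] at h1
  rw [edgeImage_fromEdgeSet hB] at h2
  have h3 : Nat.card (Γ B).ConnectedComponent ≤ Nat.card (Γ A).ConnectedComponent := by
    have hle : Γ A ≤ Γ B := SimpleGraph.fromEdgeSet_mono (by exact_mod_cast h)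
    refine Nat.card_le_card_of_surjective
      (SimpleGraph.ConnectedComponent.map (SimpleGraph.Hom.ofLE hle)) fun C => ?_
    induction C using SimpleGraph.ConnectedComponent.ind with | _ v =>
    exact ⟨(Γ A).connectedComponentMk v, rfl⟩
  omega

end LabeledGraphs

section Sampling

/- ### Averages over latent assignments -/

variable {n : ℕ}

/-- The average over all maps `z`. -/
def avg (f : (Fin n → Fin n) → ℝ) : ℝ := (∑ z, f z) / (n : ℝ) ^ n

/-- The average over all permutations. -/
def permAvg (f : (Fin n → Fin n) → ℝ) : ℝ :=
  (∑ σ : Equiv.Perm (Fin n), f σ) / (n.factorial : ℝ)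

/-- For `n = 0` this is `0 ^ 0 = 1`, the number of maps on the empty set, so averages need no
positivity assumption. -/
lemma pow_self_pos (n : ℕ) : (0 : ℝ) < (n : ℝ) ^ n := by
  rcases Nat.eq_zero_or_pos n with rfl | h
  · simp
  · positivity

lemma avg_mono {f g : (Fin n → Fin n) → ℝ} (h : ∀ z, f z ≤ g z) : avg f ≤ avg g :=
  div_le_div_of_nonneg_right (sum_le_sum fun z _ => h z) (pow_self_pos n).le

lemma avg_nonneg {f : (Fin n → Fin n) → ℝ} (h : ∀ z, 0 ≤ f z) : 0 ≤ avg f :=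
  div_nonneg (sum_nonneg fun z _ => h z) (pow_self_pos n).le

lemma avg_const (c : ℝ) : avg (fun _ : Fin n → Fin n => c) = c := by
  have := (pow_self_pos n).ne'
  simp [avg]

lemma avg_mul_left (c : ℝ) (f : (Fin n → Fin n) → ℝ) : avg (fun z => c * f z) = c * avg f := by
  rw [avg, avg, ← mul_sum, mul_div_assoc]

lemma avg_add (f g : (Fin n → Fin n) → ℝ) : avg (fun z => f z + g z) = avg f + avg g := by
  rw [avg, avg, avg, sum_add_distrib, add_div]

lemma avg_sub (f g : (Fin n → Fin n) → ℝ) : avg (fun z => f z - g z) = avg f - avg g := by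
  rw [avg, avg, avg, sum_sub_distrib, sub_div]

lemma avg_sum {ι : Type*} (s : Finset ι) (f : ι → (Fin n → Fin n) → ℝ) :
    avg (fun z => ∑ i ∈ s, f i z) = ∑ i ∈ s, avg (f i) := by
  simp only [avg]
  rw [sum_comm, sum_div]

lemma abs_avg_le (f : (Fin n → Fin n) → ℝ) : |avg f| ≤ avg fun z => |f z| := by
  rw [avg, avg, abs_div, abs_of_pos (pow_self_pos n)]
  exact div_le_div_of_nonneg_right (abs_sum_le_sum_abs _ _) (pow_self_pos n).le

lemma permAvg_nonneg {f : (Fin n → Fin n) → ℝ} (h : ∀ z, 0 ≤ f z) : 0 ≤ permAvg f :=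
  div_nonneg (sum_nonneg fun z _ => h z) (by positivity)

lemma permAvg_mono {f g : (Fin n → Fin n) → ℝ} (h : ∀ z, f z ≤ g z) : permAvg f ≤ permAvg g :=
  div_le_div_of_nonneg_right (sum_le_sum fun z _ => h z) (by positivity)

lemma permAvg_const (c : ℝ) : permAvg (fun _ : Fin n → Fin n => c) = c := by
  have : (n.factorial : ℝ) ≠ 0 := by positivity
  rw [permAvg, sum_const, card_univ, Fintype.card_perm, Fintype.card_fin, nsmul_eq_mul]
  field_simp

lemma permAvg_sum {ι : Type*} (s : Finset ι) (f : ι → (Fin n → Fin n) → ℝ) :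
    permAvg (fun z => ∑ i ∈ s, f i z) = ∑ i ∈ s, permAvg (f i) := by
  simp only [permAvg]
  rw [sum_comm, sum_div]

lemma permAvg_mul_left (c : ℝ) (f : (Fin n → Fin n) → ℝ) :
    permAvg (fun z => c * f z) = c * permAvg f := by
  rw [permAvg, permAvg, ← mul_sum, mul_div_assoc]

lemma dependsOn_mono {f : (Fin n → Fin n) → ℝ} {A B : Finset (Fin n)}
    (hf : DependsOn f (A : Set (Fin n))) (h : A ⊆ B) : DependsOn f (B : Set (Fin n)) :=
  fun _ _ hxy => hf fun i hi => hxy i (h hi)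

lemma dependsOn_mul {f g : (Fin n → Fin n) → ℝ} {A : Set (Fin n)}
    (hf : DependsOn f A) (hg : DependsOn g A) : DependsOn (fun z => f z * g z) A :=
  fun _ _ hxy => congrArg₂ _ (hf hxy) (hg hxy)

lemma dependsOn_prod {ι : Type*} (s : Finset ι) {f : ι → (Fin n → Fin n) → ℝ} {A : Set (Fin n)}
    (hf : ∀ i ∈ s, DependsOn (f i) A) : DependsOn (fun z => ∏ i ∈ s, f i z) A :=
  fun _ _ hxy => prod_congr rfl fun i hi => hf i hi hxy

/-- Functions of disjoint sets of coordinates are independent. -/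
lemma avg_mul_of_dependsOn {f g : (Fin n → Fin n) → ℝ} {A B : Finset (Fin n)}
    (hf : DependsOn f (A : Set (Fin n))) (hg : DependsOn g (B : Set (Fin n)))
    (hAB : Disjoint A B) : avg (fun z => f z * g z) = avg f * avg g := by
  -- Exchange the coordinates in `B` between two independent samples. Afterwards the first sample
  -- carries both the `A`-labels seen by `f` and the `B`-labels seen by `g`.
  let e : (Fin n → Fin n) × (Fin n → Fin n) ≃ (Fin n → Fin n) × (Fin n → Fin n) :=
    Function.Involutive.toPerm
      (fun p => (fun v => if v ∈ B then p.2 v else p.1 v, fun v => if v ∈ B then p.1 v else p.2 v))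
      (by
        rintro ⟨x, y⟩
        refine Prod.ext ?_ ?_ <;> funext v <;> by_cases hv : v ∈ B <;> simp [hv])
  have h : (∑ z, f z) * ∑ z, g z = (n : ℝ) ^ n * ∑ z, f z * g z := by
    rw [sum_mul_sum, ← Fintype.sum_prod_type' (f := fun x y => f x * g y)]
    have h1 : ∀ p : (Fin n → Fin n) × (Fin n → Fin n),
        f p.1 * g p.2 = f (e p).1 * g (e p).1 := by
      rintro ⟨x, y⟩
      congr 1
      · refine hf fun v hv => ?_
        have : v ∉ B := fun h => disjoint_left.1 hAB hv h
        change x v = if v ∈ B then y v else x v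
        rw [if_neg this]
      · refine hg fun v hv => ?_
        change y v = if v ∈ B then y v else x v
        rw [if_pos (mem_coe.1 hv)]
    rw [sum_congr rfl fun p _ => h1 p, e.sum_comp (fun p => f p.1 * g p.1),
      Fintype.sum_prod_type_right]
    simp
  have h0 := (pow_self_pos n).ne'
  rw [avg, avg, avg, div_mul_div_comm, h]
  field_simp

lemma avg_prod_of_dependsOn {ι : Type*} (s : Finset ι) {f : ι → (Fin n → Fin n) → ℝ}
    {B : ι → Finset (Fin n)} (hf : ∀ i ∈ s, DependsOn (f i) (B i : Set (Fin n)))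
    (hB : ∀ i ∈ s, ∀ j ∈ s, i ≠ j → Disjoint (B i) (B j)) :
    avg (fun z => ∏ i ∈ s, f i z) = ∏ i ∈ s, avg (f i) := by
  classical
  induction s using Finset.induction_on with
  | empty => simpa using avg_const 1
  | insert i s hi ih =>
    simp only [prod_insert hi]
    rw [avg_mul_of_dependsOn (A := B i) (B := s.biUnion B) (hf i (mem_insert_self _ _)), ih]
    · exact fun j hj => hf j (mem_insert_of_mem hj)
    · exact fun j hj k hk => hB j (mem_insert_of_mem hj) k (mem_insert_of_mem hk)
    · exact dependsOn_prod s fun j hj =>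
        dependsOn_mono (hf j (mem_insert_of_mem hj)) (subset_biUnion_of_mem B hj)
    · rw [disjoint_biUnion_right]
      exact fun j hj => hB i (mem_insert_self _ _) j (mem_insert_of_mem hj)
        (fun h => hi (h ▸ hj))

open scoped Classical in
/-- The indicator of a proposition. -/
def ind (p : Prop) : ℝ := if p then 1 else 0

lemma ind_of_true {p : Prop} (h : p) : ind p = 1 := by simp [ind, h]

lemma ind_of_false {p : Prop} (h : ¬ p) : ind p = 0 := by simp [ind, h]

lemma ind_nonneg (p : Prop) : 0 ≤ ind p := by unfold ind; split_ifs <;> norm_num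

lemma ind_le_one (p : Prop) : ind p ≤ 1 := by unfold ind; split_ifs <;> norm_num

lemma ind_mono {p q : Prop} (h : p → q) : ind p ≤ ind q := by
  by_cases hp : p
  · rw [ind_of_true hp, ind_of_true (h hp)]
  · rw [ind_of_false hp]; exact ind_nonneg q

/-- The indicator that the labels of the nodes in `A` are distinct. -/
def injInd (A : Finset (Fin n)) (z : Fin n → Fin n) : ℝ := ind (Set.InjOn z A)

lemma dependsOn_injInd (A : Finset (Fin n)) : DependsOn (injInd A) (A : Set (Fin n)) := by
  intro x y hxy
  have : Set.InjOn x A ↔ Set.InjOn y A := Set.EqOn.injOn_iff hxy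
  simp only [injInd, this]

/-- Conditionally on being injective on `A`, the labels of the nodes in `A` are those of a
uniform permutation. -/
lemma avg_mul_injInd {f : (Fin n → Fin n) → ℝ} {A : Finset (Fin n)}
    (hf : DependsOn f (A : Set (Fin n))) :
    avg (fun z => f z * injInd A z) = avg (injInd A) * permAvg f := by
  have hfac : (n.factorial : ℝ) ≠ 0 := by positivity
  have h1 : ∀ σ : Equiv.Perm (Fin n), ∑ z : Fin n → Fin n, f z * injInd A z =
      ∑ z : Fin n → Fin n, f (σ ∘ z) * injInd A z := by
    intro σ
    rw [← (Equiv.arrowCongr (Equiv.refl (Fin n)) σ).sum_comp]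
    refine sum_congr rfl fun z _ => ?_
    have h2 : (Equiv.arrowCongr (Equiv.refl (Fin n)) σ) z = σ ∘ z := rfl
    rw [h2, injInd, injInd]
    congr 2
    exact propext ⟨fun h a ha b hb hab => h ha hb (congrArg σ hab),
      fun h => σ.injective.comp_injOn h⟩
  -- A map injective on `A` agrees there with some permutation `τ`, and right translation by `τ`
  -- permutes the group.
  have h2 : ∀ z : Fin n → Fin n, ∑ σ : Equiv.Perm (Fin n), f (σ ∘ z) * injInd A z =
      injInd A z * ∑ σ : Equiv.Perm (Fin n), f σ := by
    intro z
    by_cases hz : Set.InjOn z A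
    · obtain ⟨τ, hτ⟩ : ∃ τ : Equiv.Perm (Fin n), ∀ v ∈ A, τ v = z v := by
        obtain ⟨g, hg⟩ := Finset.exists_equiv_extend_of_card_eq (s := A) (t := univ) (f := z)
          (by simp) (by simp) hz
        refine ⟨g.trans (Equiv.subtypeUnivEquiv (by simp)), fun v hv => hg v hv⟩
      rw [injInd, ind_of_true hz, one_mul]
      simp only [mul_one]
      refine (sum_congr rfl fun σ _ => ?_).trans
        (Equiv.sum_comp (Equiv.mulRight τ) fun σ : Equiv.Perm (Fin n) => f σ)
      exact hf fun v hv => by simp [hτ v hv]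
    · rw [injInd, ind_of_false hz]; simp
  have h3 : (n.factorial : ℝ) * ∑ z : Fin n → Fin n, f z * injInd A z =
      (∑ z, injInd A z) * ∑ σ : Equiv.Perm (Fin n), f σ := by
    rw [sum_mul, ← sum_congr rfl fun z _ => h2 z, sum_comm, ← sum_congr rfl fun σ _ => h1 σ]
    simp [Fintype.card_perm]
  rw [avg, avg, permAvg, div_mul_div_comm, ← h3]
  have := (pow_self_pos n).ne'
  field_simp

/-- Resampling one label. -/
lemma sum_sum_update (v : Fin n) (f : (Fin n → Fin n) → ℝ) :
    ∑ z, ∑ y, f (Function.update z v y) = n * ∑ z, f z := by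
  let e : (Fin n → Fin n) × Fin n ≃ (Fin n → Fin n) × Fin n :=
    Function.Involutive.toPerm (fun p => (Function.update p.1 v p.2, p.1 v))
      (by rintro ⟨x, y⟩; simp)
  rw [← Fintype.sum_prod_type' (f := fun z y => f (Function.update z v y))]
  have : ∀ p : (Fin n → Fin n) × Fin n, f (Function.update p.1 v p.2) = f (e p).1 := fun p => rfl
  rw [sum_congr rfl fun p _ => this p, e.sum_comp (fun p => f p.1), Fintype.sum_prod_type_right]
  simp

/-- Resampling the label of `v` alone leaves `g` and `z a` fixed, and exactly one of the `n` values
produces the coincidence. -/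
lemma avg_mul_ind_eq {g : (Fin n → Fin n) → ℝ} {A : Finset (Fin n)} {v a : Fin n}
    (hg : DependsOn g (A : Set (Fin n))) (hv : v ∉ A) (hav : a ≠ v) :
    n * avg (fun z => g z * ind (z v = z a)) = avg g := by
  rw [avg, avg, ← mul_div_assoc, ← sum_sum_update v]
  congr 1
  refine sum_congr rfl fun z _ => ?_
  have : ∀ y, g (Function.update z v y) = g z := fun y => hg fun i hi =>
    Function.update_of_ne (fun h : i = v => hv (h ▸ hi)) _ _
  simp only [this, Function.update_self, Function.update_of_ne hav]
  rw [← mul_sum, sum_eq_single (z a) (fun y _ hy => ind_of_false hy) (by simp),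
    ind_of_true rfl, mul_one]

lemma avg_mul_ind_mem_le {g : (Fin n → Fin n) → ℝ} {A : Finset (Fin n)} {v : Fin n}
    (hg : DependsOn g (A : Set (Fin n))) (hg0 : ∀ z, 0 ≤ g z) (hv : v ∉ A) :
    n * avg (fun z => g z * ind (z v ∈ A.image z)) ≤ A.card * avg g := by
  calc n * avg (fun z => g z * ind (z v ∈ A.image z))
      ≤ n * avg (fun z => ∑ a ∈ A, g z * ind (z v = z a)) := by
        refine mul_le_mul_of_nonneg_left (avg_mono fun z => ?_) (Nat.cast_nonneg n)
        rw [← mul_sum]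
        refine mul_le_mul_of_nonneg_left ?_ (hg0 z)
        by_cases h : z v ∈ A.image z
        · rw [ind_of_true h]
          obtain ⟨a, ha, hav⟩ := mem_image.1 h
          refine le_trans ?_ (single_le_sum (fun a _ => ind_nonneg _) ha)
          rw [ind_of_true hav.symm]
        · rw [ind_of_false h]
          exact sum_nonneg fun a _ => ind_nonneg _
    _ = ∑ a ∈ A, avg g := by
        rw [avg_sum, mul_sum]
        exact sum_congr rfl fun a ha => avg_mul_ind_eq hg hv fun h => hv (h ▸ ha)
    _ = A.card * avg g := by simp

/-- The number of labels lost by coincidences when the nodes in `F` are added to those in `A`. -/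
def labelLoss (A F : Finset (Fin n)) (z : Fin n → Fin n) : ℕ :=
  F.card + (A.image z).card - ((A ∪ F).image z).card

lemma card_image_union_le (A F : Finset (Fin n)) (z : Fin n → Fin n) :
    ((A ∪ F).image z).card ≤ F.card + (A.image z).card := by
  rw [image_union, add_comm]
  exact (card_union_le _ _).trans (Nat.add_le_add_left card_image_le _)

/-- An exponential moment of the number of coincidences. The nodes of `F` are added one at a time: a
new node repeats one of at most `N` earlier labels with probability at most `N / n`, and is then
weighted by `n`, so it costs a factor `1 + N`. -/
lemma avg_mul_pow_labelLoss_le {g : (Fin n → Fin n) → ℝ} {A F : Finset (Fin n)} {N : ℕ}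
    (hg : DependsOn g (A : Set (Fin n))) (hg0 : ∀ z, 0 ≤ g z) (hAF : Disjoint A F)
    (hN : A.card + F.card ≤ N) :
    avg (fun z => g z * (n : ℝ) ^ labelLoss A F z) ≤ (1 + N : ℝ) ^ F.card * avg g := by
  induction F using Finset.induction_on with
  | empty => simp [labelLoss]
  | insert v F hv ih =>
    rw [card_insert_of_notMem hv] at hN
    rw [disjoint_insert_right] at hAF
    have ih' := ih hAF.2 (by omega)
    have hn : 0 < n := v.pos
    have hvAF : v ∉ A ∪ F := by simp [hAF.1, hv]
    set G : (Fin n → Fin n) → ℝ := fun z => g z * (n : ℝ) ^ labelLoss A F z with hG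
    have hG0 : ∀ z, 0 ≤ G z := fun z => mul_nonneg (hg0 z) (by positivity)
    have hGd : DependsOn G ((A ∪ F : Finset (Fin n)) : Set (Fin n)) := by
      intro x y hxy
      have h1 : g x = g y := hg fun i hi => hxy i (by simp [mem_coe.1 hi])
      have h2 : A.image x = A.image y := image_congr fun i hi => hxy i (by simp [mem_coe.1 hi])
      have h3 : (A ∪ F).image x = (A ∪ F).image y := image_congr fun i hi => hxy i hi
      simp only [hG, labelLoss, h1, h2, h3]
    have hstep : ∀ z, g z * (n : ℝ) ^ labelLoss A (insert v F) z ≤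
        G z + n * (G z * ind (z v ∈ (A ∪ F).image z)) := by
      intro z
      have hc := card_image_union_le A F z
      by_cases h : z v ∈ (A ∪ F).image z
      · rw [ind_of_true h]
        have : labelLoss A (insert v F) z = labelLoss A F z + 1 := by
          rw [labelLoss, labelLoss, union_insert, image_insert, insert_eq_of_mem h,
            card_insert_of_notMem hv]
          omega
        rw [this, pow_succ]
        have := hG0 z
        simp only [hG] at this ⊢
        linarith
      · rw [ind_of_false h]
        have : labelLoss A (insert v F) z = labelLoss A F z := by
          rw [labelLoss, labelLoss, union_insert, image_insert, card_insert_of_notMem h,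
            card_insert_of_notMem hv]
          omega
        rw [this]
        simp [hG]
    have hcard : ((A ∪ F).card : ℝ) ≤ N := by
      rw [card_union_of_disjoint hAF.2]; exact_mod_cast (by omega)
    have h0 : 0 ≤ avg G := avg_nonneg hG0
    calc avg (fun z => g z * (n : ℝ) ^ labelLoss A (insert v F) z)
        ≤ avg (fun z => G z + n * (G z * ind (z v ∈ (A ∪ F).image z))) := avg_mono hstep
      _ = avg G + n * avg (fun z => G z * ind (z v ∈ (A ∪ F).image z)) := by
          rw [avg_add, avg_mul_left]
      _ ≤ avg G + (A ∪ F).card * avg G := by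
          linarith [avg_mul_ind_mem_le hGd hG0 hvAF]
      _ ≤ (1 + N) * avg G := by nlinarith
      _ ≤ (1 + N) * ((1 + N : ℝ) ^ F.card * avg g) := by gcongr
      _ = _ := by rw [card_insert_of_notMem hv, pow_succ]; ring

/-- Union bound for the probability that some labels coincide. -/
lemma one_sub_le_avg_injInd (hn : 0 < n) (A : Finset (Fin n)) :
    1 - (A.card : ℝ) ^ 2 / n ≤ avg (injInd A) := by
  have hn' : (0 : ℝ) < n := by exact_mod_cast hn
  have h1 : ∀ z : Fin n → Fin n, 1 - injInd A z ≤
      ∑ v ∈ A, ∑ a ∈ A.erase v, 1 * ind (z v = z a) := by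
    intro z
    by_cases h : Set.InjOn z A
    · rw [injInd, ind_of_true h, sub_self]
      exact sum_nonneg fun v _ => sum_nonneg fun a _ => by rw [one_mul]; exact ind_nonneg _
    · rw [injInd, ind_of_false h, sub_zero]
      simp only [Set.InjOn, not_forall] at h
      obtain ⟨v, hv, a, ha, hva, hne⟩ := h
      refine le_trans ?_ (single_le_sum (fun v _ => sum_nonneg fun a _ => by
        rw [one_mul]; exact ind_nonneg _) (mem_coe.1 hv))
      refine le_trans ?_ (single_le_sum (fun a _ => by
        rw [one_mul]; exact ind_nonneg _) (mem_erase.2 ⟨Ne.symm hne, ha⟩))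
      rw [one_mul, ind_of_true hva]
  have h2 : ∀ v a : Fin n, a ≠ v → avg (fun z => 1 * ind (z v = z a)) = 1 / n := by
    intro v a hav
    have := avg_mul_ind_eq (n := n) (g := fun _ => 1) (A := ∅) (v := v) (a := a)
      (fun _ _ _ => rfl) (by simp) hav
    rw [avg_const] at this
    rw [eq_div_iff hn'.ne', mul_comm]; exact this
  have h3 : 1 - avg (injInd A) ≤ (A.card : ℝ) ^ 2 / n := by
    calc 1 - avg (injInd A) = avg (fun z => 1 - injInd A z) := by rw [avg_sub, avg_const]
      _ ≤ avg (fun z => ∑ v ∈ A, ∑ a ∈ A.erase v, 1 * ind (z v = z a)) := avg_mono h1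
      _ = ∑ v ∈ A, ∑ a ∈ A.erase v, (1 / n : ℝ) := by
          rw [avg_sum]
          refine sum_congr rfl fun v _ => ?_
          rw [avg_sum]
          exact sum_congr rfl fun a ha => h2 v a (mem_erase.1 ha).1
      _ ≤ ∑ v ∈ A, ∑ a ∈ A, (1 / n : ℝ) := by
          refine sum_le_sum fun v _ => sum_le_sum_of_subset_of_nonneg (erase_subset _ _) ?_
          intros; positivity
      _ = (A.card : ℝ) ^ 2 / n := by simp; ring
  linarith

end Sampling

section Decoupling

/- ### Decoupling of centered blocks under permutation sampling -/

variable {n : ℕ} {ι : Type*} [DecidableEq ι]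

/-- Some node of `A` has the same label as some node of `C`. -/
def Hits (z : Fin n → Fin n) (A C : Finset (Fin n)) : Prop := ∃ a ∈ A, ∃ b ∈ C, z a = z b

lemma Hits.mono {z : Fin n → Fin n} {A C C' : Finset (Fin n)} (h : Hits z A C) (hC : C ⊆ C') :
    Hits z A C' := by
  obtain ⟨a, ha, b, hb, hab⟩ := h
  exact ⟨a, ha, b, hC hb, hab⟩

lemma Hits.symm {z : Fin n → Fin n} {A C : Finset (Fin n)} (h : Hits z A C) : Hits z C A := by
  obtain ⟨a, ha, b, hb, hab⟩ := h
  exact ⟨b, hb, a, ha, hab.symm⟩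

lemma injOn_union_iff {z : Fin n → Fin n} {A C : Finset (Fin n)} (h : ¬ Hits z A C) :
    Set.InjOn z ((C ∪ A : Finset (Fin n)) : Set (Fin n)) ↔
      Set.InjOn z (C : Set (Fin n)) ∧ Set.InjOn z (A : Set (Fin n)) := by
  constructor
  · exact fun h' => ⟨h'.mono (by simp), h'.mono (by simp)⟩
  · rintro ⟨h1, h2⟩ a ha b hb hab
    simp only [coe_union, Set.mem_union, mem_coe] at ha hb
    rcases ha with ha | ha <;> rcases hb with hb | hb
    · exact h1 ha hb hab
    · exact absurd ⟨b, hb, a, ha, hab.symm⟩ h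
    · exact absurd ⟨a, ha, b, hb, hab⟩ h
    · exact h2 ha hb hab

lemma injInd_nonneg (A : Finset (Fin n)) (z : Fin n → Fin n) : 0 ≤ injInd A z := ind_nonneg _

lemma ind_and (p q : Prop) : ind (p ∧ q) = ind p * ind q := by
  by_cases hp : p <;> by_cases hq : q <;> simp [ind, hp, hq]

/-- If each of the functions `f i` is centered, then only the latent assignments for which each
block meets another block contribute. -/
theorem permAvg_centered_le (P : Finset ι) (B : ι → Finset (Fin n)) (B₀ : Finset (Fin n))
    (hB : ∀ i ∈ P, ∀ j ∈ P, i ≠ j → Disjoint (B i) (B j)) (hB₀ : ∀ i ∈ P, Disjoint (B i) B₀)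
    (f : ι → (Fin n → Fin n) → ℝ) (f₀ : (Fin n → Fin n) → ℝ)
    (hf : ∀ i ∈ P, DependsOn (f i) (B i : Set (Fin n))) (hf₀ : DependsOn f₀ (B₀ : Set (Fin n)))
    (hfn : ∀ i ∈ P, ∀ z, 0 ≤ f i z) (hf₀n : ∀ z, 0 ≤ f₀ z) :
    avg (injInd (B₀ ∪ P.biUnion B)) *
        |permAvg fun z => f₀ z * ∏ i ∈ P, (f i z - permAvg (f i))| ≤
      2 ^ P.card * avg fun z => injInd B₀ z * (∏ i ∈ P, injInd (B i) z) *
        ind (∀ i ∈ P, Hits z (B i) ((B₀ ∪ P.biUnion B) \ B i)) *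
        (f₀ z * ∏ i ∈ P, (f i z + permAvg (f i))) := by
  set V : Finset ι → Finset (Fin n) := fun S => B₀ ∪ S.biUnion B with hV
  set h : (Fin n → Fin n) → ℝ := fun z => f₀ z * ∏ i ∈ P, (f i z - permAvg (f i)) with hh
  -- The terms of the inclusion-exclusion: the blocks in `S` have labels distinct jointly with `B₀`,
  -- while every block is injective on its own. For `S = P` this is injectivity on the whole node
  -- set, i.e. permutation sampling.
  set E : Finset ι → (Fin n → Fin n) → ℝ := fun S z =>
    injInd (V S) z * ∏ i ∈ P, injInd (B i) z with hE
  have hVmono : ∀ {S T : Finset ι}, S ⊆ T → V S ⊆ V T := fun hST =>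
    union_subset_union_right (biUnion_subset_biUnion_of_subset_left _ hST)
  have hBV : ∀ {i : ι} {S : Finset ι}, i ∈ S → B i ⊆ V S := fun hi =>
    (subset_biUnion_of_mem B hi).trans subset_union_right
  have hBVd : ∀ {i : ι} {S : Finset ι}, i ∈ P → S ⊆ P → i ∉ S → Disjoint (B i) (V S) := by
    intro i S hi hS hiS
    rw [disjoint_union_right, disjoint_biUnion_right]
    exact ⟨hB₀ i hi, fun j hj => hB i hi j (hS hj) fun h => hiS (h ▸ hj)⟩
  -- the full term
  have hfull : avg (fun z => h z * E P z) = avg (injInd (V P)) * permAvg h := by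
    rw [← avg_mul_injInd (A := V P)]
    · congr 1; funext z
      congr 1
      by_cases hz : Set.InjOn z (V P)
      · simp only [hE, injInd]
        rw [prod_eq_one, mul_one]
        exact fun i hi => ind_of_true (hz.mono (hBV hi))
      · simp only [hE, injInd, ind_of_false hz, zero_mul]
    · refine dependsOn_mul (dependsOn_mono hf₀ subset_union_left) (dependsOn_prod _ fun i hi => ?_)
      exact fun x y hxy => congrArg (· - _) (dependsOn_mono (hf i hi) (hBV hi) hxy)
  -- the other terms vanish
  have hzero : ∀ S ∈ P.powerset, S ≠ P → avg (fun z => h z * E S z) = 0 := by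
    intro S hS hne
    rw [mem_powerset] at hS
    obtain ⟨i, hi, hiS⟩ : ∃ i ∈ P, i ∉ S := by
      by_contra hcon
      push Not at hcon
      exact hne (hS.antisymm hcon)
    have hrw : (fun z => h z * E S z) = fun z =>
        ((f i z - permAvg (f i)) * injInd (B i) z) *
        (f₀ z * (∏ j ∈ P.erase i, (f j z - permAvg (f j))) *
          (injInd (V S) z * ∏ j ∈ P.erase i, injInd (B j) z)) := by
      funext z
      simp only [hh, hE]
      rw [← mul_prod_erase P _ hi, ← mul_prod_erase P (fun j => injInd (B j) z) hi]
      ring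
    have hSi : S ⊆ P.erase i := fun j hj => mem_erase.2 ⟨fun h => hiS (h ▸ hj), hS hj⟩
    rw [hrw, avg_mul_of_dependsOn (A := B i) (B := V (P.erase i))]
    -- The block `i ∉ S` is independent of all other factors, and its centering constant is its mean
    -- conditionally on injectivity within the block.
    · have : avg (fun z => (f i z - permAvg (f i)) * injInd (B i) z) = 0 := by
        simp only [sub_mul]
        rw [avg_sub, avg_mul_injInd (hf i hi), avg_mul_left]
        ring
      rw [this, zero_mul]
    · exact dependsOn_mul (fun x y hxy => congrArg (· - _) (hf i hi hxy)) (dependsOn_injInd _)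
    · refine dependsOn_mul (dependsOn_mul (dependsOn_mono hf₀ subset_union_left)
        (dependsOn_prod _ fun j hj => ?_)) (dependsOn_mul
          (dependsOn_mono (dependsOn_injInd _) (hVmono hSi)) (dependsOn_prod _ fun j hj =>
            dependsOn_mono (dependsOn_injInd _) (hBV hj)))
      exact fun x y hxy => congrArg (· - _)
        (dependsOn_mono (hf j (mem_of_mem_erase hj)) (hBV hj) hxy)
    · exact hBVd hi (erase_subset _ _) (notMem_erase _ _)
  -- inclusion-exclusion
  set J : (Fin n → Fin n) → ℝ := fun z => ∑ S ∈ P.powerset, (-1) ^ (P \ S).card * E S z with hJ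
  have hmain : avg (injInd (V P)) * permAvg h = avg fun z => h z * J z := by
    have : (fun z => h z * J z) =
        fun z => ∑ S ∈ P.powerset, (-1) ^ (P \ S).card * (h z * E S z) := by
      funext z
      simp only [hJ, mul_sum]
      exact sum_congr rfl fun S _ => by ring
    rw [this, avg_sum, sum_eq_single P]
    · rw [avg_mul_left, hfull]; simp
    · intro S hS hne
      rw [avg_mul_left, hzero S hS hne, mul_zero]
    · intro hP; exact absurd (mem_powerset_self P) hP
  -- If block `i` meets no other block, requiring it to be injective jointly with the others adds no
  -- constraint. The terms for `S` and `insert i S` then agree up to sign and cancel.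
  have hJzero : ∀ z, ∀ i ∈ P, ¬ Hits z (B i) (V P \ B i) → J z = 0 := by
    intro z i hi hit
    simp only [hJ]
    conv_lhs => rw [← insert_erase hi]
    rw [sum_powerset_insert (notMem_erase i P), ← sum_add_distrib]
    refine sum_eq_zero fun S hS => ?_
    rw [mem_powerset] at hS
    have hiS : i ∉ S := fun h => notMem_erase i P (hS h)
    have hSP : S ⊆ P := hS.trans (erase_subset _ _)
    rw [insert_erase hi]
    have hcard : (P \ S).card = (P \ insert i S).card + 1 := by
      rw [sdiff_insert, card_erase_of_mem (mem_sdiff.2 ⟨hi, hiS⟩)]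
      have : 0 < (P \ S).card := card_pos.2 ⟨i, mem_sdiff.2 ⟨hi, hiS⟩⟩
      omega
    have hEeq : E (insert i S) z = E S z := by
      have hVi : V (insert i S) = V S ∪ B i := by
        simp only [hV]
        rw [biUnion_insert, ← union_assoc, union_comm B₀, union_assoc, union_comm]
      have hnh : ¬ Hits z (B i) (V S) := fun hc => hit (hc.mono fun v hv =>
        mem_sdiff.2 ⟨hVmono hSP hv, fun hvi => disjoint_left.1 (hBVd hi hSP hiS) hvi hv⟩)
      simp only [hE, injInd]
      rw [hVi, propext (injOn_union_iff hnh), ind_and, mul_assoc]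
      congr 1
      rw [← mul_prod_erase P _ hi, ← mul_assoc, ← ind_and, and_self]
    rw [hcard, hEeq, pow_succ]
    ring
  -- the final bound
  have hx : ∀ i ∈ P, 0 ≤ permAvg (f i) := fun i hi => permAvg_nonneg (hfn i hi)
  have hbound : ∀ z, |h z * J z| ≤ 2 ^ P.card * (injInd B₀ z * (∏ i ∈ P, injInd (B i) z) *
        ind (∀ i ∈ P, Hits z (B i) (V P \ B i)) *
        (f₀ z * ∏ i ∈ P, (f i z + permAvg (f i)))) := by
    intro z
    have hprod0 : 0 ≤ ∏ i ∈ P, injInd (B i) z := prod_nonneg fun i _ => ind_nonneg _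
    have hh0 : |h z| ≤ f₀ z * ∏ i ∈ P, (f i z + permAvg (f i)) := by
      simp only [hh]
      rw [abs_mul, abs_of_nonneg (hf₀n z), abs_prod]
      refine mul_le_mul_of_nonneg_left (prod_le_prod (fun i _ => abs_nonneg _) fun i hi => ?_)
        (hf₀n z)
      have h1 := hfn i hi z
      have h2 := hx i hi
      rw [abs_le]; constructor <;> linarith
    have hrhs0 : 0 ≤ f₀ z * ∏ i ∈ P, (f i z + permAvg (f i)) := (abs_nonneg _).trans hh0
    by_cases hz : ∀ i ∈ P, Hits z (B i) (V P \ B i)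
    · rw [ind_of_true hz, mul_one, abs_mul, mul_comm |h z|, ← mul_assoc]
      refine mul_le_mul ?_ hh0 (abs_nonneg _) (mul_nonneg (by positivity)
        (mul_nonneg (ind_nonneg _) hprod0))
      calc |J z| ≤ ∑ S ∈ P.powerset, |(-1) ^ (P \ S).card * E S z| := abs_sum_le_sum_abs _ _
        _ ≤ ∑ S ∈ P.powerset, injInd B₀ z * ∏ i ∈ P, injInd (B i) z := by
            refine sum_le_sum fun S _ => ?_
            rw [abs_mul, abs_pow, abs_neg, abs_one, one_pow, one_mul, abs_of_nonneg]
            · exact mul_le_mul_of_nonneg_right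
                (ind_mono fun h => h.mono (by simp [hV])) hprod0
            · exact mul_nonneg (ind_nonneg _) hprod0
        _ = _ := by simp [card_powerset]
    · rw [ind_of_false hz]
      push Not at hz
      obtain ⟨i, hi, hit⟩ := hz
      rw [hJzero z i hi hit]
      simp
  calc avg (injInd (V P)) * |permAvg h|
      = |avg (injInd (V P)) * permAvg h| := by
        rw [abs_mul, abs_of_nonneg (avg_nonneg fun z => injInd_nonneg _ z)]
    _ = |avg fun z => h z * J z| := by rw [hmain]
    _ ≤ avg fun z => |h z * J z| := abs_avg_le _
    _ ≤ _ := by rw [← avg_mul_left]; exact avg_mono hbound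

end Decoupling

section Linking

/- ### Clusters of blocks with common labels -/

variable {n : ℕ} {ι : Type*} [DecidableEq ι]

/-- The blocks `B i`, `i ∈ K`, cannot be split into two families without a common label. -/
def Linked (B : ι → Finset (Fin n)) (K : Finset ι) (z : Fin n → Fin n) : Prop :=
  ∀ S ⊆ K, S.Nonempty → (∀ i ∈ S, ∀ j ∈ K, Hits z (B i) (B j) → j ∈ S) → S = K

lemma hits_congr {x y : Fin n → Fin n} {A C : Finset (Fin n)} (hA : ∀ v ∈ A, x v = y v)
    (hC : ∀ v ∈ C, x v = y v) : Hits x A C ↔ Hits y A C := by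
  constructor <;> rintro ⟨a, ha, b, hb, hab⟩ <;> refine ⟨a, ha, b, hb, ?_⟩
  · rw [← hA a ha, ← hC b hb, hab]
  · rw [hA a ha, hC b hb, hab]

omit [DecidableEq ι] in
lemma dependsOn_linked (B : ι → Finset (Fin n)) (K : Finset ι) :
    DependsOn (fun z => ind (Linked B K z)) ((K.biUnion B : Finset (Fin n)) : Set (Fin n)) := by
  intro x y hxy
  have h : ∀ i ∈ K, ∀ v ∈ B i, x v = y v := fun i hi v hv =>
    hxy v (mem_biUnion.2 ⟨i, hi, hv⟩)
  have : Linked B K x ↔ Linked B K y := by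
    unfold Linked
    refine forall_congr' fun S => forall_congr' fun hS => forall_congr' fun _ => ?_
    have : (∀ i ∈ S, ∀ j ∈ K, Hits x (B i) (B j) → j ∈ S) ↔
        (∀ i ∈ S, ∀ j ∈ K, Hits y (B i) (B j) → j ∈ S) := by
      refine forall_congr' fun i => forall_congr' fun hi => forall_congr' fun j =>
        forall_congr' fun hj => ?_
      rw [hits_congr (h i (hS hi)) (h j hj)]
    rw [this]
  simp only [this]

/-- A map sending each index in `J` to a representative of its cluster. -/
lemma exists_cluster_map (B : ι → Finset (Fin n)) (J : Finset ι) (z : Fin n → Fin n) :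
    ∃ φ : ι → ι, (∀ j ∈ J, φ j ∈ J) ∧ (∀ j ∉ J, φ j = j) ∧
      (∀ b, Linked B (J.filter fun j => φ j = b) z) ∧
      (∀ i ∈ J, ∀ j ∈ J, Hits z (B i) (B j) → φ i = φ j) := by
  -- Edges join indices in `J` only, so every index outside `J` is its own representative; this
  -- keeps the number of possible cluster maps finite and small.
  let G : SimpleGraph ι := SimpleGraph.fromRel fun i j => i ∈ J ∧ j ∈ J ∧ Hits z (B i) (B j)
  have hadj : ∀ {i j}, G.Adj i j → i ∈ J ∧ j ∈ J ∧ Hits z (B i) (B j) := by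
    intro i j h
    rcases (SimpleGraph.fromRel_adj _ _ _).1 h with ⟨_, h | h⟩
    · exact h
    · exact ⟨h.2.1, h.1, h.2.2.symm⟩
  let φ : ι → ι := fun j => (G.connectedComponentMk j).out
  have hφr : ∀ j, G.Reachable (φ j) j := fun j =>
    SimpleGraph.ConnectedComponent.exact (Quot.out_eq (G.connectedComponentMk j))
  have hφeq : ∀ {i j}, G.Reachable i j → φ i = φ j := fun h => by
    simp only [φ]; rw [SimpleGraph.ConnectedComponent.sound h]
  refine ⟨φ, fun j hj => ?_, fun j hj => ?_, fun b S hS hSn hcl => ?_, fun i hi j hj h => ?_⟩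
  · obtain ⟨p⟩ := (hφr j).symm
    have hgen : ∀ {i k : ι} (p : G.Walk i k), i ∈ J → k ∈ J := by
      intro i k p
      induction p with
      | nil => exact id
      | cons h p ih => exact fun _ => ih (hadj h).2.1
    exact hgen p hj
  · obtain ⟨p⟩ := (hφr j).symm
    have hgen : ∀ {i k : ι} (p : G.Walk i k), i ∉ J → k = i := by
      intro i k p hi
      cases p with
      | nil => rfl
      | cons h _ => exact absurd (hadj h).1 hi
    exact hgen p hj
  · refine hS.antisymm fun k hk => ?_
    obtain ⟨i, hi⟩ := hSn
    have hiK := mem_filter.1 (hS hi)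
    have hkK := mem_filter.1 hk
    have hr : G.Reachable i k :=
      (hφr i).symm.trans (by rw [hiK.2, ← hkK.2]; exact hφr k)
    have hgen : ∀ {i k : ι} (p : G.Walk i k), i ∈ S → k ∈ S := by
      intro i k p
      induction p with
      | nil => exact id
      | cons h p ih =>
        intro hi
        have h1 := hadj h
        have h2 := mem_filter.1 (hS hi)
        exact ih (hcl _ hi _ (mem_filter.2 ⟨h1.2.1, (hφeq h.reachable).symm.trans h2.2⟩) h1.2.2)
    obtain ⟨p⟩ := hr
    exact hgen p hi
  · by_cases hij : i = j
    · rw [hij]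
    · exact hφeq (SimpleGraph.Adj.reachable
        ((SimpleGraph.fromRel_adj _ _ _).2 ⟨hij, Or.inl ⟨hi, hj, h⟩⟩))

/-- If every free block `i ∈ F` and every isolated fixed block `i ∈ S` meets another block, then
at least half as many labels are lost. -/
lemma card_add_card_le_labelLoss {B : ι → Finset (Fin n)} {J F S : Finset ι} {z : Fin n → Fin n}
    (hJF : Disjoint J F) (hSJ : S ⊆ J)
    (hB : ∀ i ∈ J ∪ F, ∀ j ∈ J ∪ F, i ≠ j → Disjoint (B i) (B j))
    (hS : ∀ i ∈ S, ∀ j ∈ J, i ≠ j → ¬ Hits z (B i) (B j))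
    (hH : ∀ i ∈ S ∪ F, Hits z (B i) ((J ∪ F).biUnion B \ B i)) :
    S.card + F.card ≤ 2 * labelLoss (J.biUnion B) (F.biUnion B) z := by
  classical
  set A := J.biUnion B
  set C := F.biUnion B
  have hAC : (J ∪ F).biUnion B = A ∪ C := Finset.union_biUnion
  rw [hAC] at hH
  rcases isEmpty_or_nonempty (Fin n) with hn | hn
  · have : S ∪ F = ∅ := eq_empty_of_forall_notMem fun i hi =>
      hn.elim (hH i hi).choose
    rw [union_eq_empty] at this
    simp [this]
  have hdA : Disjoint A C := by
    rw [disjoint_biUnion_left]; intro i hi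
    rw [disjoint_biUnion_right]; intro j hj
    exact hB i (mem_union_left _ hi) j (mem_union_right _ hj)
      fun h => disjoint_left.1 hJF hi (h ▸ hj)
  unfold Hits at hH
  choose! a ha b hb hab using hH
  have hSF : Disjoint S F := hJF.mono_left hSJ
  set Y := (A ∪ C).image z
  -- Double counting by label. The loss is the sum over the labels `y` that occur of `ν y - 1`,
  -- where `ν` counts the nodes of `C` with label `y`, and all of `A` together at most once; `μ`
  -- counts the blocks whose chosen colliding node has label `y`.
  set ν : Fin n → ℕ := fun y => (C.filter fun v => z v = y).card +
    if y ∈ A.image z then 1 else 0 with hν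
  set μ : Fin n → ℕ := fun y => ((S ∪ F).filter fun i => z (a i) = y).card with hμ
  have haA : ∀ i ∈ S, a i ∈ A := fun i hi =>
    mem_biUnion.2 ⟨i, hSJ hi, ha i (mem_union_left _ hi)⟩
  have haC : ∀ i ∈ F, a i ∈ C := fun i hi =>
    mem_biUnion.2 ⟨i, hi, ha i (mem_union_right _ hi)⟩
  have hsumν : ∑ y ∈ Y, ν y = C.card + (A.image z).card := by
    simp only [hν]
    rw [sum_add_distrib]
    congr 1
    · exact (card_eq_sum_card_fiberwise fun v hv =>
        mem_image_of_mem z (mem_union_right _ hv)).symm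
    · rw [sum_ite_mem, inter_eq_right.2 (image_subset_image subset_union_left)]
      simp
  have hsumμ : ∑ y ∈ Y, μ y = S.card + F.card := by
    rw [← card_union_of_disjoint hSF]
    refine (card_eq_sum_card_fiberwise fun i hi => mem_image_of_mem z ?_).symm
    rcases mem_union.1 hi with h | h
    · exact mem_union_left _ (haA i h)
    · exact mem_union_right _ (haC i h)
  -- This is `μ ≤ 2 (ν - 1)`. It follows from `ν ≥ 1`, from `μ ≤ ν` (free blocks have distinct nodes
  -- in `C`, and the isolated fixed blocks use a label at most once), and from `ν ≥ 2` whenever `μ >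
  -- 0`, because the colliding partner is counted as well.
  have hkey : ∀ y ∈ Y, μ y + 2 ≤ 2 * ν y := by
    intro y hy
    have hν1 : 1 ≤ ν y := by
      obtain ⟨v, hv, hvy⟩ := mem_image.1 hy
      rcases mem_union.1 hv with h | h
      · have : y ∈ A.image z := mem_image.2 ⟨v, h, hvy⟩
        simp only [hν, if_pos this]; omega
      · have : 0 < (C.filter fun v => z v = y).card :=
          card_pos.2 ⟨v, mem_filter.2 ⟨h, hvy⟩⟩
        simp only [hν]; omega
    rcases Nat.eq_zero_or_pos (μ y) with h0 | hpos
    · omega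
    have hμF : (F.filter fun i => z (a i) = y).card ≤ (C.filter fun v => z v = y).card := by
      refine card_le_card_of_injOn a (fun i hi => ?_) fun i hi j hj hij => ?_
      · have := mem_filter.1 hi
        exact mem_coe.2 (mem_filter.2 ⟨haC i this.1, this.2⟩)
      · have hi' := (mem_filter.1 hi).1
        have hj' := (mem_filter.1 hj).1
        by_contra hne
        exact disjoint_left.1 (hB i (mem_union_right _ hi') j (mem_union_right _ hj') hne)
          (ha i (mem_union_right _ hi')) (hij ▸ ha j (mem_union_right _ hj'))
    have hμS : (S.filter fun i => z (a i) = y).card ≤ if y ∈ A.image z then 1 else 0 := by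
      split_ifs with hyA
      · refine card_le_one.2 fun i hi j hj => ?_
        rw [mem_filter] at hi hj
        by_contra hne
        exact hS i hi.1 j (hSJ hj.1) hne ⟨a i, ha i (mem_union_left _ hi.1), a j,
          ha j (mem_union_left _ hj.1), hi.2.trans hj.2.symm⟩
      · rw [Nat.le_zero, card_eq_zero, filter_eq_empty_iff]
        exact fun i hi h => hyA (mem_image.2 ⟨a i, haA i hi, h⟩)
    have hμle : μ y ≤ ν y := by
      simp only [hμ, hν, filter_union]
      refine (card_union_le _ _).trans ?_
      omega
    have hν2 : 2 ≤ ν y := by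
      obtain ⟨i, hi⟩ := card_pos.1 hpos
      obtain ⟨hi, hiy⟩ := mem_filter.1 hi
      have hbi := mem_sdiff.1 (hb i hi)
      have hby : z (b i) = y := (hab i hi).symm.trans hiy
      rcases mem_union.1 hi with hiS | hiF
      · have hyA : y ∈ A.image z := mem_image.2 ⟨a i, haA i hiS, hiy⟩
        have hbC : b i ∈ C := by
          refine (mem_union.1 hbi.1).resolve_left fun hbA => ?_
          obtain ⟨k, hk, hbk⟩ := mem_biUnion.1 hbA
          exact hS i hiS k hk (fun h => hbi.2 (h ▸ hbk)) ⟨a i, ha i hi, b i, hbk, hab i hi⟩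
        have : 0 < (C.filter fun v => z v = y).card :=
          card_pos.2 ⟨b i, mem_filter.2 ⟨hbC, hby⟩⟩
        simp only [hν, if_pos hyA]; omega
      · have haf : a i ∈ C.filter fun v => z v = y := mem_filter.2 ⟨haC i hiF, hiy⟩
        rcases mem_union.1 hbi.1 with hbA | hbC
        · have hyA : y ∈ A.image z := mem_image.2 ⟨b i, hbA, hby⟩
          have : 0 < (C.filter fun v => z v = y).card := card_pos.2 ⟨_, haf⟩
          simp only [hν, if_pos hyA]; omega
        · have : 1 < (C.filter fun v => z v = y).card :=
            one_lt_card.2 ⟨a i, haf, b i, mem_filter.2 ⟨hbC, hby⟩,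
              fun h => hbi.2 (h ▸ ha i hi)⟩
          simp only [hν]; omega
    omega
  have h1 : ∑ y ∈ Y, (μ y + 2) ≤ ∑ y ∈ Y, 2 * ν y := sum_le_sum hkey
  rw [sum_add_distrib, hsumμ, ← mul_sum, hsumν, sum_const, smul_eq_mul] at h1
  have h2 : Y.card ≤ C.card + (A.image z).card := card_image_union_le A C z
  have h3 : labelLoss A C z = C.card + (A.image z).card - Y.card := rfl
  omega

/-- Counts the candidate cluster maps: self-maps of `J` extended by the identity. -/
lemma card_piFinset_cluster [Fintype ι] (J : Finset ι) :
    (Fintype.piFinset fun j => if j ∈ J then J else {j}).card = J.card ^ J.card := by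
  rw [Fintype.card_piFinset]
  have : ∀ j, (if j ∈ J then J else {j}).card = if j ∈ J then J.card else 1 := by
    intro j; split_ifs <;> simp
  simp only [this]
  rw [prod_ite_mem]
  simp

/-- Bound for a product of block functions on the event that each of the blocks in `T ∪ F` meets
another block, in terms of bounds for clusters; the blocks in `F` carry no function. -/
theorem avg_prod_hits_le [Fintype ι] (J F T : Finset ι) (hJF : Disjoint J F) (hTJ : T ⊆ J)
    (B : ι → Finset (Fin n))
    (hB : ∀ i ∈ J ∪ F, ∀ j ∈ J ∪ F, i ≠ j → Disjoint (B i) (B j))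
    (f : ι → (Fin n → Fin n) → ℝ) (hf : ∀ i ∈ J, DependsOn (f i) (B i : Set (Fin n)))
    (hfn : ∀ i ∈ J, ∀ z, 0 ≤ f i z) (W : ι → ℝ) {s : ℝ} (hs0 : 0 ≤ s) (hs1 : s ≤ 1)
    (hsn : s ^ 2 * n = 1)
    (hW : ∀ K ⊆ J, K.Nonempty →
      avg (fun z => ind (Linked B K z) * ∏ j ∈ K, (injInd (B j) z * f j z)) ≤
        ∏ j ∈ K, (W j * if 2 ≤ K.card ∧ j ∈ T then s else 1))
    {N : ℕ} (hN : ((J ∪ F).biUnion B).card ≤ N) :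
    avg (fun z => (∏ j ∈ J, (injInd (B j) z * f j z)) *
        ind (∀ i ∈ T ∪ F, Hits z (B i) ((J ∪ F).biUnion B \ B i))) ≤
      (J.card : ℝ) ^ J.card * (1 + N : ℝ) ^ (F.biUnion B).card * (∏ j ∈ J, W j) *
        s ^ (T.card + F.card) := by
  classical
  set Φ := Fintype.piFinset fun j => if j ∈ J then J else {j} with hΦ
  set fib : (ι → ι) → ι → Finset ι := fun φ b => J.filter fun j => φ j = b with hfib
  -- The blocks of `T` that are alone in their cluster. They must meet a free block and are paid for
  -- by lost labels; the other blocks of `T` get their factor `s` from the cluster bound.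
  set S : (ι → ι) → Finset ι := fun φ => T.filter fun j => ¬ 2 ≤ (fib φ (φ j)).card with hS
  set A := J.biUnion B with hA
  set C := F.biUnion B with hC
  set g : (ι → ι) → (Fin n → Fin n) → ℝ := fun φ z =>
    ∏ b ∈ J, (ind (Linked B (fib φ b) z) * ∏ j ∈ fib φ b, (injInd (B j) z * f j z)) with hg
  have hBJ : ∀ i ∈ J, ∀ j ∈ J, i ≠ j → Disjoint (B i) (B j) := fun i hi j hj =>
    hB i (mem_union_left _ hi) j (mem_union_left _ hj)
  have hu0 : ∀ z, ∀ j ∈ J, 0 ≤ injInd (B j) z * f j z := fun z j hj =>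
    mul_nonneg (injInd_nonneg _ _) (hfn j hj z)
  have hfibJ : ∀ φ b, fib φ b ⊆ J := fun φ b => filter_subset _ _
  have hg0 : ∀ φ z, 0 ≤ g φ z := fun φ z => prod_nonneg fun b _ =>
    mul_nonneg (ind_nonneg _) (prod_nonneg fun j hj => hu0 z j (hfibJ φ b hj))
  have hmaps : ∀ φ ∈ Φ, ∀ j ∈ J, φ j ∈ J := by
    intro φ hφ j hj
    have := Fintype.mem_piFinset.1 hφ j
    rwa [if_pos hj] at this
  have hdep1 : ∀ φ b, DependsOn (fun z => ind (Linked B (fib φ b) z) *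
      ∏ j ∈ fib φ b, (injInd (B j) z * f j z))
      (((fib φ b).biUnion B : Finset (Fin n)) : Set (Fin n)) := by
    intro φ b
    refine dependsOn_mul (dependsOn_linked _ _) (dependsOn_prod _ fun j hj => ?_)
    exact dependsOn_mono (dependsOn_mul (dependsOn_injInd _) (hf j (hfibJ φ b hj)))
      (subset_biUnion_of_mem B hj)
  have hdep : ∀ φ, DependsOn (g φ) (A : Set (Fin n)) := fun φ =>
    dependsOn_prod _ fun b _ => dependsOn_mono (hdep1 φ b)
      (biUnion_subset_biUnion_of_subset_left _ (hfibJ φ b))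
  have hdAC : Disjoint A C := by
    rw [disjoint_biUnion_left]; intro i hi
    rw [disjoint_biUnion_right]; intro j hj
    exact hB i (mem_union_left _ hi) j (mem_union_right _ hj)
      fun h => disjoint_left.1 hJF hi (h ▸ hj)
  have hcardAC : A.card + C.card ≤ N := by
    rw [← card_union_of_disjoint hdAC, hA, hC, ← Finset.union_biUnion]; exact hN
  -- pointwise bound
  have hpt : ∀ z, (∏ j ∈ J, (injInd (B j) z * f j z)) *
      ind (∀ i ∈ T ∪ F, Hits z (B i) ((J ∪ F).biUnion B \ B i)) ≤
      ∑ φ ∈ Φ, s ^ ((S φ).card + F.card) * (g φ z * (n : ℝ) ^ labelLoss A C z) := by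
    intro z
    have hnn : ∀ φ ∈ Φ, 0 ≤ s ^ ((S φ).card + F.card) * (g φ z * (n : ℝ) ^ labelLoss A C z) :=
      fun φ _ => mul_nonneg (pow_nonneg hs0 _) (mul_nonneg (hg0 φ z) (by positivity))
    by_cases hH : ∀ i ∈ T ∪ F, Hits z (B i) ((J ∪ F).biUnion B \ B i)
    swap
    · rw [ind_of_false hH, mul_zero]; exact sum_nonneg hnn
    rw [ind_of_true hH, mul_one]
    obtain ⟨φ, hφ1, hφ2, hφ3, hφ4⟩ := exists_cluster_map B J z
    have hφΦ : φ ∈ Φ := by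
      refine Fintype.mem_piFinset.2 fun j => ?_
      split_ifs with hj
      · exact hφ1 j hj
      · exact mem_singleton.2 (hφ2 j hj)
    refine le_trans ?_ (single_le_sum hnn hφΦ)
    have hgz : g φ z = ∏ j ∈ J, (injInd (B j) z * f j z) := by
      simp only [hg]
      rw [← prod_fiberwise_of_maps_to (g := φ) hφ1 fun j => injInd (B j) z * f j z]
      refine prod_congr rfl fun b _ => ?_
      rw [ind_of_true (hφ3 b), one_mul]
    have hloss : (S φ).card + F.card ≤ 2 * labelLoss A C z := by
      refine card_add_card_le_labelLoss hJF ((filter_subset _ _).trans hTJ) hB ?_ ?_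
      · intro i hi j hj hne hit
        obtain ⟨hiT, hi2⟩ := mem_filter.1 hi
        refine hi2 (one_lt_card.2 ⟨i, mem_filter.2 ⟨hTJ hiT, rfl⟩, j, mem_filter.2 ⟨hj, ?_⟩, hne⟩)
        exact (hφ4 i (hTJ hiT) j hj hit).symm
      · intro i hi
        refine hH i ?_
        rcases mem_union.1 hi with h | h
        · exact mem_union_left _ (mem_filter.1 h).1
        · exact mem_union_right _ h
    -- Since `s² n = 1`, the weight `n ^ labelLoss` buys two factors `s` per lost label, which is
    -- enough by `hloss`. The weight is later averaged out by `avg_mul_pow_labelLoss_le`.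
    have h1 : 1 ≤ s ^ ((S φ).card + F.card) * (n : ℝ) ^ labelLoss A C z := by
      calc (1 : ℝ) = (s ^ 2 * n) ^ labelLoss A C z := by rw [hsn, one_pow]
        _ = s ^ (2 * labelLoss A C z) * (n : ℝ) ^ labelLoss A C z := by rw [mul_pow, pow_mul]
        _ ≤ _ := by
            refine mul_le_mul_of_nonneg_right ?_ (by positivity)
            exact pow_le_pow_of_le_one hs0 hs1 hloss
    calc ∏ j ∈ J, (injInd (B j) z * f j z) = 1 * g φ z := by rw [hgz, one_mul]
      _ ≤ (s ^ ((S φ).card + F.card) * (n : ℝ) ^ labelLoss A C z) * g φ z :=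
          mul_le_mul_of_nonneg_right h1 (hg0 φ z)
      _ = _ := by ring
  -- clusters
  have hclus : ∀ φ ∈ Φ, avg (g φ) ≤ (∏ j ∈ J, W j) * s ^ (T.card - (S φ).card) := by
    intro φ hφ
    have h1 : avg (g φ) = ∏ b ∈ J, avg (fun z => ind (Linked B (fib φ b) z) *
        ∏ j ∈ fib φ b, (injInd (B j) z * f j z)) := by
      -- Distinct clusters have disjoint node sets, so their labels are independent.
      refine avg_prod_of_dependsOn J (B := fun b => (fib φ b).biUnion B)
        (fun b _ => hdep1 φ b) fun b _ b' _ hne => ?_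
      rw [disjoint_biUnion_left]; intro i hi
      rw [disjoint_biUnion_right]; intro j hj
      refine hBJ i (hfibJ φ b hi) j (hfibJ φ b' hj) fun h => hne ?_
      rw [← (mem_filter.1 hi).2, ← (mem_filter.1 hj).2, h]
    have h2 : avg (g φ) ≤ ∏ b ∈ J, ∏ j ∈ fib φ b,
        (W j * if 2 ≤ (fib φ b).card ∧ j ∈ T then s else 1) := by
      rw [h1]
      refine prod_le_prod (fun b _ => avg_nonneg fun z => mul_nonneg (ind_nonneg _)
        (prod_nonneg fun j hj => hu0 z j (hfibJ φ b hj))) fun b _ => ?_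
      -- An index that represents no cluster has an empty fiber and contributes a factor at most
      -- one.
      rcases (fib φ b).eq_empty_or_nonempty with he | hne
      · rw [he]
        simp only [prod_empty, mul_one]
        calc avg (fun z => ind (Linked B ∅ z)) ≤ avg (fun _ => 1) :=
              avg_mono fun z => ind_le_one _
          _ = 1 := avg_const 1
      · exact hW _ (hfibJ φ b) hne
    refine h2.trans (le_of_eq ?_)
    have h3 : ∏ b ∈ J, ∏ j ∈ fib φ b, (W j * if 2 ≤ (fib φ b).card ∧ j ∈ T then s else 1) =
        ∏ j ∈ J, (W j * if 2 ≤ (fib φ (φ j)).card ∧ j ∈ T then s else 1) := by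
      rw [← prod_fiberwise_of_maps_to (g := φ) (hmaps φ hφ) fun j =>
        W j * if 2 ≤ (fib φ (φ j)).card ∧ j ∈ T then s else 1]
      refine prod_congr rfl fun b _ => prod_congr rfl fun j hj => ?_
      rw [(mem_filter.1 hj).2]
    rw [h3, prod_mul_distrib, ← prod_filter, prod_const]
    congr 2
    have h4 := Finset.card_filter_add_card_filter_not (s := T)
      (fun j => 2 ≤ (fib φ (φ j)).card)
    have h5 : J.filter (fun j => 2 ≤ (fib φ (φ j)).card ∧ j ∈ T) =
        T.filter fun j => 2 ≤ (fib φ (φ j)).card := by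
      ext j
      simp only [mem_filter]
      exact ⟨fun h => ⟨h.2.2, h.2.1⟩, fun h => ⟨hTJ h.1, h.2, h.1⟩⟩
    rw [h5]
    have h6 : (S φ).card = (T.filter fun j => ¬ 2 ≤ (fib φ (φ j)).card).card := rfl
    omega
  have hN0 : (0 : ℝ) ≤ (1 + N : ℝ) ^ C.card := by positivity
  calc avg (fun z => (∏ j ∈ J, (injInd (B j) z * f j z)) *
        ind (∀ i ∈ T ∪ F, Hits z (B i) ((J ∪ F).biUnion B \ B i)))
      ≤ avg (fun z => ∑ φ ∈ Φ, s ^ ((S φ).card + F.card) *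
          (g φ z * (n : ℝ) ^ labelLoss A C z)) := avg_mono hpt
    _ = ∑ φ ∈ Φ, s ^ ((S φ).card + F.card) *
          avg (fun z => g φ z * (n : ℝ) ^ labelLoss A C z) := by
        rw [avg_sum]; exact sum_congr rfl fun φ _ => avg_mul_left _ _
    _ ≤ ∑ φ ∈ Φ, (1 + N : ℝ) ^ C.card * (∏ j ∈ J, W j) * s ^ (T.card + F.card) := by
        refine sum_le_sum fun φ hφ => ?_
        have hle : (S φ).card ≤ T.card := card_filter_le _ _
        calc s ^ ((S φ).card + F.card) * avg (fun z => g φ z * (n : ℝ) ^ labelLoss A C z)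
            ≤ s ^ ((S φ).card + F.card) * ((1 + N : ℝ) ^ C.card *
                ((∏ j ∈ J, W j) * s ^ (T.card - (S φ).card))) := by
              refine mul_le_mul_of_nonneg_left ?_ (pow_nonneg hs0 _)
              exact (avg_mul_pow_labelLoss_le (hdep φ) (hg0 φ) hdAC hcardAC).trans
                (mul_le_mul_of_nonneg_left (hclus φ hφ) hN0)
          _ = (1 + N : ℝ) ^ C.card * (∏ j ∈ J, W j) *
                s ^ ((S φ).card + F.card + (T.card - (S φ).card)) := by rw [pow_add s]; ring
          _ = _ := by congr 2; omega
    _ = _ := by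
        rw [sum_const, card_piFinset_cluster, nsmul_eq_mul, Nat.cast_pow]; ring

end Linking

section Moments

/- ### Conditional moments -/

variable {n : ℕ}

/-- The product of the centered adjacencies over an edge set. -/
def edgePoly (q : ℝ) (F S : Finset (Sym2 (Fin n))) : ℝ := ∏ e ∈ F, centeredAdj q S e

/-- The signal `Θ (z i) (z j)` at the pair `e = {i, j}`. -/
def signal (Θ : Matrix (Fin n) (Fin n) ℝ) (z : Fin n → Fin n) (e : Sym2 (Fin n)) : ℝ :=
  Θ (z e.inf) (z e.sup)

/-- The conditional moment of order `k` of the centered adjacency at `e`. -/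
def edgeMom (q : ℝ) (Θ : Matrix (Fin n) (Fin n) ℝ) (z : Fin n → Fin n) (e : Sym2 (Fin n))
    (k : ℕ) : ℝ :=
  edgeProb q Θ z e * (1 - q) ^ k + (1 - edgeProb q Θ z e) * (-q) ^ k

/-- The conditional expectation of `P_A P_B`. -/
def pairMom (q : ℝ) (Θ : Matrix (Fin n) (Fin n) ℝ) (A B : Finset (Sym2 (Fin n)))
    (z : Fin n → Fin n) : ℝ :=
  (∏ e ∈ A ∆ B, signal Θ z e) * ∏ e ∈ A ∩ B, (qbar q + (1 - 2 * q) * signal Θ z e)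

variable {q : ℝ} {Θ : Matrix (Fin n) (Fin n) ℝ} {A B : Finset (Sym2 (Fin n))}
  {z : Fin n → Fin n}

lemma edgeMom_zero (e : Sym2 (Fin n)) : edgeMom q Θ z e 0 = 1 := by simp [edgeMom]

lemma edgeMom_one (e : Sym2 (Fin n)) : edgeMom q Θ z e 1 = signal Θ z e := by
  simp only [edgeMom, edgeProb, signal]; ring

lemma edgeMom_two (e : Sym2 (Fin n)) :
    edgeMom q Θ z e 2 = qbar q + (1 - 2 * q) * signal Θ z e := by
  simp only [edgeMom, edgeProb, signal, qbar]; ring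

lemma condExpect_sum {ι : Type*} (s : Finset ι) (f : ι → Finset (Sym2 (Fin n)) → ℝ) :
    condExpect q Θ z (fun S => ∑ i ∈ s, f i S) = ∑ i ∈ s, condExpect q Θ z (f i) := by
  simp only [condExpect, mul_sum]
  rw [sum_comm]

lemma condExpect_mul_left (c : ℝ) (f : Finset (Sym2 (Fin n)) → ℝ) :
    condExpect q Θ z (fun S => c * f S) = c * condExpect q Θ z f := by
  simp only [condExpect, mul_sum]
  exact sum_congr rfl fun S _ => by ring

lemma condExpect_sub (f g : Finset (Sym2 (Fin n)) → ℝ) :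
    condExpect q Θ z (fun S => f S - g S) = condExpect q Θ z f - condExpect q Θ z g := by
  simp only [condExpect, mul_sub, sum_sub_distrib]

lemma permExpect_eq (f : Finset (Sym2 (Fin n)) → ℝ) :
    permExpect q Θ f = permAvg fun z => condExpect q Θ z f := rfl

lemma indepExpect_eq (f : (Fin n → Fin n) → Finset (Sym2 (Fin n)) → ℝ) :
    indepExpect q Θ f = avg fun z => condExpect q Θ z (f z) := rfl

lemma permExpect_sum {ι : Type*} (s : Finset ι) (f : ι → Finset (Sym2 (Fin n)) → ℝ) :
    permExpect q Θ (fun S => ∑ i ∈ s, f i S) = ∑ i ∈ s, permExpect q Θ (f i) := by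
  simp only [permExpect_eq, condExpect_sum]
  rw [permAvg_sum]

lemma permExpect_mul_left (c : ℝ) (f : Finset (Sym2 (Fin n)) → ℝ) :
    permExpect q Θ (fun S => c * f S) = c * permExpect q Θ f := by
  simp only [permExpect_eq, condExpect_mul_left]
  rw [permAvg_mul_left]

/-- Independence of the edges: expanding the product of the two-term moments over the set of present
edges recovers the sum that defines the conditional expectation. -/
lemma condExpect_prod_pow (m : Sym2 (Fin n) → ℕ) :
    condExpect q Θ z (fun S => ∏ e ∈ allEdges n, centeredAdj q S e ^ m e) =
      ∏ e ∈ allEdges n, edgeMom q Θ z e (m e) := by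
  simp only [edgeMom]
  rw [prod_add, condExpect]
  refine sum_congr rfl fun S hS => ?_
  rw [mem_powerset] at hS
  rw [prod_mul_distrib, prod_mul_distrib, ← prod_sdiff hS]
  have h1 : ∏ e ∈ S, centeredAdj q S e ^ m e = ∏ e ∈ S, (1 - q) ^ m e :=
    prod_congr rfl fun e he => by simp [centeredAdj, he]
  have h2 : ∏ e ∈ allEdges n \ S, centeredAdj q S e ^ m e =
      ∏ e ∈ allEdges n \ S, (-q) ^ m e :=
    prod_congr rfl fun e he => by simp [centeredAdj, (mem_sdiff.1 he).2]
  rw [h1, h2]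
  ring

/-- The multiplicity of the edges in `P_A P_B`. -/
def pairMult (A B : Finset (Sym2 (Fin n))) (e : Sym2 (Fin n)) : ℕ :=
  (if e ∈ A then 1 else 0) + if e ∈ B then 1 else 0

lemma edgePoly_eq (hA : A ⊆ allEdges n) (S : Finset (Sym2 (Fin n))) :
    edgePoly q A S = ∏ e ∈ allEdges n, centeredAdj q S e ^ (if e ∈ A then 1 else 0) := by
  have : ∀ e, centeredAdj q S e ^ (if e ∈ A then 1 else 0) =
      if e ∈ A then centeredAdj q S e else 1 := fun e => by split_ifs <;> simp
  simp only [this]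
  rw [prod_ite_mem, inter_eq_right.2 hA, edgePoly]

lemma edgePoly_mul (hA : A ⊆ allEdges n) (hB : B ⊆ allEdges n) (S : Finset (Sym2 (Fin n))) :
    edgePoly q A S * edgePoly q B S =
      ∏ e ∈ allEdges n, centeredAdj q S e ^ pairMult A B e := by
  rw [edgePoly_eq hA, edgePoly_eq hB, ← prod_mul_distrib]
  exact prod_congr rfl fun e _ => by rw [pairMult, pow_add]

lemma prod_edgeMom_pairMult (hA : A ⊆ allEdges n) (hB : B ⊆ allEdges n) :
    ∏ e ∈ allEdges n, edgeMom q Θ z e (pairMult A B e) = pairMom q Θ A B z := by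
  have hsub : A ∆ B ∪ A ∩ B ⊆ allEdges n := by
    intro e he
    simp only [mem_union, mem_symmDiff, mem_inter] at he
    rcases he with (h | h) | h
    exacts [hA h.1, hB h.1, hA h.1]
  have hd : Disjoint (A ∆ B) (A ∩ B) := by
    refine disjoint_left.2 fun e h1 h2 => ?_
    rw [mem_symmDiff] at h1
    rw [mem_inter] at h2
    tauto
  rw [← prod_subset hsub, prod_union hd, pairMom]
  · congr 1
    · refine prod_congr rfl fun e he => ?_
      have : pairMult A B e = 1 := by
        rcases mem_symmDiff.1 he with h | h <;> simp [pairMult, h.1, h.2]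
      rw [this, edgeMom_one]
    · refine prod_congr rfl fun e he => ?_
      have : pairMult A B e = 2 := by
        have := mem_inter.1 he
        simp [pairMult, this.1, this.2]
      rw [this, edgeMom_two]
  · intro e _ he
    have : pairMult A B e = 0 := by
      simp only [mem_union, mem_symmDiff, mem_inter] at he
      by_cases h1 : e ∈ A <;> by_cases h2 : e ∈ B <;> simp_all [pairMult]
    rw [this, edgeMom_zero]

lemma condExpect_edgePoly_mul (hA : A ⊆ allEdges n) (hB : B ⊆ allEdges n) :
    condExpect q Θ z (fun S => edgePoly q A S * edgePoly q B S) = pairMom q Θ A B z := by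
  simp only [edgePoly_mul hA hB]
  rw [condExpect_prod_pow, prod_edgeMom_pairMult hA hB]

@[simp] lemma edgePoly_empty (S : Finset (Sym2 (Fin n))) : edgePoly q ∅ S = 1 := rfl

lemma condExpect_edgePoly (hA : A ⊆ allEdges n) :
    condExpect q Θ z (edgePoly q A) = pairMom q Θ A ∅ z := by
  rw [← condExpect_edgePoly_mul hA (empty_subset _)]
  simp

/-- Conditional expectation of a product of a monomial and centered monomials. -/
lemma condExpect_mul_prod_sub (P : Finset (Finset (Sym2 (Fin n))))
    (hP : ∀ c ∈ P, c ⊆ allEdges n) (hd : ∀ c ∈ P, ∀ c' ∈ P, c ≠ c' → Disjoint c c')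
    (x : Finset (Sym2 (Fin n)) → ℝ) (m : Sym2 (Fin n) → ℕ)
    (hm : ∀ c ∈ P, ∀ e ∈ c, m e = 0) :
    condExpect q Θ z (fun S => (∏ e ∈ allEdges n, centeredAdj q S e ^ m e) *
        ∏ c ∈ P, (edgePoly q c S - x c)) =
      (∏ e ∈ allEdges n, edgeMom q Θ z e (m e)) * ∏ c ∈ P, (pairMom q Θ c ∅ z - x c) := by
  induction P using Finset.induction_on generalizing m with
  | empty => simpa using condExpect_prod_pow m
  | insert c P hc ih =>
    have hcP := hP c (mem_insert_self _ _)
    have ih' := ih (fun c' h => hP c' (mem_insert_of_mem h))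
      (fun c' h c'' h' => hd c' (mem_insert_of_mem h) c'' (mem_insert_of_mem h'))
    -- Expanding the factor of `c` either moves its edges into the monomial, raising the
    -- multiplicities, or leaves the constant. The induction is therefore run for all
    -- multiplicities.
    set m' : Sym2 (Fin n) → ℕ := fun e => m e + if e ∈ c then 1 else 0 with hm'
    have h1 := ih' m fun c' h => hm c' (mem_insert_of_mem h)
    have h2 := ih' m' fun c' h e he => by
      have h3 : e ∉ c := fun h4 => disjoint_left.1
        (hd c (mem_insert_self _ _) c' (mem_insert_of_mem h) fun h => hc (h ▸ ‹c' ∈ P›)) h4 he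
      simp [hm', h3, hm c' (mem_insert_of_mem h) e he]
    have hrw : (fun S => (∏ e ∈ allEdges n, centeredAdj q S e ^ m e) *
        ∏ c ∈ insert c P, (edgePoly q c S - x c)) =
        fun S => ((∏ e ∈ allEdges n, centeredAdj q S e ^ m' e) *
          ∏ c ∈ P, (edgePoly q c S - x c)) - x c *
          ((∏ e ∈ allEdges n, centeredAdj q S e ^ m e) * ∏ c ∈ P, (edgePoly q c S - x c)) := by
      funext S
      rw [prod_insert hc]
      simp only [hm', pow_add]
      rw [prod_mul_distrib, ← edgePoly_eq hcP]
      ring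
    have hmom : ∏ e ∈ allEdges n, edgeMom q Θ z e (m' e) =
        (∏ e ∈ allEdges n, edgeMom q Θ z e (m e)) * pairMom q Θ c ∅ z := by
      rw [← prod_edgeMom_pairMult hcP (empty_subset _), ← prod_mul_distrib]
      refine prod_congr rfl fun e _ => ?_
      by_cases he : e ∈ c
      · simp [hm', pairMult, he, hm c (mem_insert_self _ _) e he, edgeMom_zero]
      · simp [hm', pairMult, he, edgeMom_zero]
    rw [hrw, condExpect_sub, condExpect_mul_left, h1, h2, hmom, prod_insert hc]
    ring

lemma inf_mem_sym2 (e : Sym2 (Fin n)) : e.inf ∈ e := by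
  induction e with | _ a b =>
  rw [Sym2.inf_mk, Sym2.mem_iff]
  rcases le_total a b with h | h <;> simp [h]

lemma sup_mem_sym2 (e : Sym2 (Fin n)) : e.sup ∈ e := by
  induction e with | _ a b =>
  rw [Sym2.sup_mk, Sym2.mem_iff]
  rcases le_total a b with h | h <;> simp [h]

lemma dependsOn_pairMom : DependsOn (pairMom q Θ A B)
    ((verts A ∪ verts B : Finset (Fin n)) : Set (Fin n)) := by
  intro x y hxy
  have h : ∀ e ∈ A ∪ B, signal Θ x e = signal Θ y e := by
    intro e he
    have hv : ∀ v ∈ e, x v = y v := by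
      intro v hv
      refine hxy v ?_
      rw [← verts_union]
      exact mem_verts.2 ⟨e, he, hv⟩
    rw [signal, signal, hv _ (inf_mem_sym2 e), hv _ (sup_mem_sym2 e)]
  rw [pairMom, pairMom]
  congr 1
  · refine prod_congr rfl fun e he => h e ?_
    rw [mem_union]
    rcases mem_symmDiff.1 he with h | h
    exacts [Or.inl h.1, Or.inr h.1]
  · refine prod_congr rfl fun e he => ?_
    rw [h e (mem_union_left _ (mem_inter.1 he).1)]

variable {lam : ℝ}

/-- Positivity comes from `Θ ≥ 0` and `q ≤ 1/2`. It permits discarding indicators and replacing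
absolute values by plain averages everywhere below. -/
lemma pairMom_nonneg (hq : 0 ≤ q) (hq2 : q ≤ 1 / 2) (hΘ : ∀ i j, Θ i j ∈ Set.Icc 0 lam) :
    0 ≤ pairMom q Θ A B z := by
  refine mul_nonneg (prod_nonneg fun e _ => (hΘ _ _).1) (prod_nonneg fun e _ => ?_)
  have h1 : 0 ≤ signal Θ z e := (hΘ _ _).1
  have h2 : 0 ≤ qbar q := mul_nonneg hq (by linarith)
  have h3 : 0 ≤ 1 - 2 * q := by linarith
  positivity

lemma pbar_eq : pbar lam q = qbar q + (1 - 2 * q) * lam := by simp only [pbar, qbar]; ring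

/-- Each doubled edge has conditional second moment between `q̄` and `p̄`, whatever the labels; with
the next lemma this gives the diagonal of the Gram matrix. -/
lemma pairMom_self_le (hq : 0 ≤ q) (hq2 : q ≤ 1 / 2) (hΘ : ∀ i j, Θ i j ∈ Set.Icc 0 lam) :
    pairMom q Θ A A z ≤ pbar lam q ^ A.card := by
  rw [pairMom, symmDiff_self, inter_self]
  have h2 : 0 ≤ qbar q := mul_nonneg hq (by linarith)
  have h3 : 0 ≤ 1 - 2 * q := by linarith
  simp only [bot_eq_empty, prod_empty, one_mul]
  rw [← prod_const]
  refine prod_le_prod (fun e _ => ?_) fun e _ => ?_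
  · have h1 : 0 ≤ signal Θ z e := (hΘ _ _).1
    positivity
  · have h1 : signal Θ z e ≤ lam := (hΘ _ _).2
    rw [pbar_eq]
    gcongr

lemma qbar_pow_le_pairMom_self (hq : 0 ≤ q) (hq2 : q ≤ 1 / 2)
    (hΘ : ∀ i j, Θ i j ∈ Set.Icc 0 lam) : qbar q ^ A.card ≤ pairMom q Θ A A z := by
  rw [pairMom, symmDiff_self, inter_self]
  have h2 : 0 ≤ qbar q := mul_nonneg hq (by linarith)
  have h3 : 0 ≤ 1 - 2 * q := by linarith
  simp only [bot_eq_empty, prod_empty, one_mul]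
  rw [← prod_const]
  refine prod_le_prod (fun e _ => h2) fun e _ => ?_
  have h1 : 0 ≤ signal Θ z e := (hΘ _ _).1
  have := mul_nonneg h3 h1
  linarith

/-- Adding edge sets that are node-disjoint from the rest. -/
lemma pairMom_union_left {c : Finset (Sym2 (Fin n))} (hA : VDisj c A) (hB : VDisj c B) :
    pairMom q Θ (c ∪ A) B z = pairMom q Θ c ∅ z * pairMom q Θ A B z := by
  have h1 : Disjoint c A := hA.disjoint
  have h2 : Disjoint c B := hB.disjoint
  have e1 : (c ∪ A) ∆ B = c ∪ A ∆ B := by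
    ext e
    have h3 : e ∈ c → e ∉ A := fun h => disjoint_left.1 h1 h
    have h4 : e ∈ c → e ∉ B := fun h => disjoint_left.1 h2 h
    simp only [mem_symmDiff, mem_union]; tauto
  have e2 : (c ∪ A) ∩ B = A ∩ B := by
    rw [union_inter_distrib_right, disjoint_iff_inter_eq_empty.1 h2, empty_union]
  have hd : Disjoint c (A ∆ B) := by
    refine disjoint_left.2 fun e h h' => ?_
    rcases mem_symmDiff.1 h' with h' | h'
    exacts [disjoint_left.1 h1 h h'.1, disjoint_left.1 h2 h h'.1]
  rw [pairMom, pairMom, pairMom, e1, e2, prod_union hd]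
  have e3 : c ∆ ∅ = c := symmDiff_bot c
  rw [e3, inter_empty, prod_empty, mul_one, mul_assoc]

lemma pairMom_comm : pairMom q Θ A B z = pairMom q Θ B A z := by
  rw [pairMom, pairMom, symmDiff_comm, inter_comm]

lemma pairMom_biUnion_left {s : Finset (Finset (Sym2 (Fin n)))} (hs : IsConnFamily s)
    (hA : ∀ c ∈ s, VDisj c A) (hB : ∀ c ∈ s, VDisj c B) :
    pairMom q Θ (s.biUnion id ∪ A) B z = (∏ c ∈ s, pairMom q Θ c ∅ z) * pairMom q Θ A B z := by
  induction s using Finset.induction_on with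
  | empty => simp
  | insert c s hc ih =>
    rw [biUnion_insert, id, union_assoc, pairMom_union_left, ih (hs.mono (subset_insert _ _)),
      prod_insert hc, mul_assoc]
    · exact fun c' h => hA c' (mem_insert_of_mem h)
    · exact fun c' h => hB c' (mem_insert_of_mem h)
    · rw [vdisj_union_right, vdisj_biUnion_right]
      exact ⟨fun c' h => hs.2 c (mem_insert_self _ _) c' (mem_insert_of_mem h)
        fun h' => hc (h' ▸ h), hA c (mem_insert_self _ _)⟩
    · exact hB c (mem_insert_self _ _)

/-- The conditional expectation factors over node-disjoint components. -/
lemma pairMom_biUnion {s t : Finset (Finset (Sym2 (Fin n)))} (hst : IsConnFamily (s ∪ t))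
    (hd : Disjoint s t) (hA : ∀ c ∈ s ∪ t, VDisj c A) (hB : ∀ c ∈ s ∪ t, VDisj c B) :
    pairMom q Θ (s.biUnion id ∪ A) (t.biUnion id ∪ B) z =
      (∏ c ∈ s ∪ t, pairMom q Θ c ∅ z) * pairMom q Θ A B z := by
  rw [pairMom_biUnion_left (hst.mono subset_union_left), pairMom_comm (A := A),
    pairMom_biUnion_left (hst.mono subset_union_right), prod_union hd, mul_assoc,
    pairMom_comm (A := A)]
  · exact fun c hc => hB c (mem_union_right _ hc)
  · exact fun c hc => hA c (mem_union_right _ hc)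
  · exact fun c hc => hA c (mem_union_left _ hc)
  · intro c hc
    rw [vdisj_union_right, vdisj_biUnion_right]
    exact ⟨fun c' h => hst.2 c (mem_union_left _ hc) c' (mem_union_right _ h)
      fun h' => disjoint_left.1 hd hc (h' ▸ h), hB c (mem_union_left _ hc)⟩

end Moments

section Conditions

/- ### The conditions in terms of edge sets -/

variable {n : ℕ}

lemma monomial_eq (q : ℝ) (G : FinGraph) (π : Fin G.order ↪ Fin n) :
    monomial q G π = edgePoly q (edgeImage G.graph π) := by
  funext S
  rw [monomial, edgePoly, edgeImage, prod_map]
  rfl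

lemma edgeImage_subset_allEdges {m : ℕ} (G : SimpleGraph (Fin m)) (π : Fin m ↪ Fin n) :
    edgeImage G π ⊆ allEdges n := by
  intro e he
  obtain ⟨a, ha, rfl⟩ := mem_edgeImage.1 he
  rw [allEdges, mem_filter, Sym2.isDiag_map π.injective]
  exact ⟨mem_univ _, G.not_isDiag_of_mem_edgeSet ha⟩

lemma mem_edgeImage_iff_map_adj {m : ℕ} {G : SimpleGraph (Fin m)} {π : Fin m ↪ Fin n}
    {a b : Fin n} : s(a, b) ∈ edgeImage G π ↔ (G.map π).Adj a b := by
  rw [mem_edgeImage, SimpleGraph.map_adj]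
  constructor
  · rintro ⟨e, he, heq⟩
    induction e with | _ x y =>
    rw [Sym2.map_mk, Sym2.eq_iff] at heq
    rcases heq with ⟨h1, h2⟩ | ⟨h1, h2⟩
    · exact ⟨x, y, he, h1, h2⟩
    · exact ⟨y, x, SimpleGraph.Adj.symm he, h2, h1⟩
  · rintro ⟨x, y, h, rfl, rfl⟩
    exact ⟨s(x, y), h, rfl⟩

/-- Every nonempty edge set is the edge set of a labeled template. -/
lemma exists_template {D : ℕ} {F : Finset (Sym2 (Fin n))} (hF : F ⊆ allEdges n)
    (hne : F.Nonempty) (hD : F.card ≤ D) :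
    ∃ G : FinGraph, G.IsTemplate D ∧ ∃ π : Fin G.order ↪ Fin n, edgeImage G.graph π = F := by
  let π : Fin (verts F).card ↪ Fin n :=
    (verts F).equivFin.symm.toEmbedding.trans (Function.Embedding.subtype _)
  have hπ : ∀ v, v ∈ verts F ↔ ∃ x, π x = v := by
    intro v
    constructor
    · intro hv
      exact ⟨(verts F).equivFin ⟨v, hv⟩, by simp [π]⟩
    · rintro ⟨x, rfl⟩
      exact ((verts F).equivFin.symm x).2
  let G : FinGraph := ⟨(verts F).card, (SimpleGraph.fromEdgeSet (F : Set (Sym2 (Fin n)))).comap π⟩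
  have hadj : ∀ x y, G.graph.Adj x y ↔ s(π x, π y) ∈ F := by
    intro x y
    change (SimpleGraph.fromEdgeSet (F : Set (Sym2 (Fin n)))).Adj (π x) (π y) ↔ _
    rw [SimpleGraph.fromEdgeSet_adj, mem_coe, and_iff_left_iff_imp]
    intro h heq
    have := hF h
    rw [heq] at this
    simp [allEdges] at this
  have himg : edgeImage G.graph π = F := by
    ext e
    rw [mem_edgeImage]
    constructor
    · rintro ⟨a, ha, rfl⟩
      induction a with | _ x y =>
      exact (hadj x y).1 ha
    · intro he
      induction e with | _ a b =>
      obtain ⟨x, rfl⟩ := (hπ a).1 (mem_verts.2 ⟨_, he, Sym2.mem_mk_left _ _⟩)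
      obtain ⟨y, rfl⟩ := (hπ b).1 (mem_verts.2 ⟨_, he, Sym2.mem_mk_right _ _⟩)
      exact ⟨s(x, y), (hadj x y).2 he, rfl⟩
  have hsize : G.size = F.card := by
    rw [FinGraph.size, ← card_edgeImage (π := π), himg]
  refine ⟨G, ⟨?_, ?_, ?_⟩, π, himg⟩
  · rw [hsize]; exact hne.card_pos
  · rw [hsize]; exact hD
  · intro x
    obtain ⟨e, he, hx⟩ := mem_verts.1 ((hπ (π x)).2 ⟨x, rfl⟩)
    induction e with | _ a b =>
    obtain ⟨y, rfl⟩ := (hπ a).1 (mem_verts.2 ⟨_, he, Sym2.mem_mk_left _ _⟩)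
    obtain ⟨y', rfl⟩ := (hπ b).1 (mem_verts.2 ⟨_, he, Sym2.mem_mk_right _ _⟩)
    rw [Sym2.mem_iff] at hx
    rcases hx with h | h
    · exact ⟨y', (hadj _ _).2 (by rw [h]; exact he)⟩
    · exact ⟨y, (hadj _ _).2 (by rw [h, Sym2.eq_swap]; exact he)⟩

variable {D k : ℕ} {lam q : ℝ} {Θ : Matrix (Fin n) (Fin n) ℝ}

/-- `C-Moment` for edge sets. -/
lemma CMoment.permAvg_pairMom_le {cm : ℝ} (h : CMoment n D k lam q Θ cm)
    (hq : 0 ≤ q) (hq2 : q ≤ 1 / 2) (hΘ : ∀ i j, Θ i j ∈ Set.Icc 0 lam)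
    {F : Finset (Sym2 (Fin n))} (hF : F ⊆ allEdges n) (hne : F.Nonempty) (hD : F.card ≤ D) :
    permAvg (pairMom q Θ F ∅) ≤
      ((D : ℝ) ^ cm * lam) ^ F.card * ((D : ℝ) ^ cm * (k / n)) ^ rk F := by
  obtain ⟨G, hG, π, rfl⟩ := exists_template hF hne hD
  have h1 := h G hG π
  rw [monomial_eq, permExpect_eq] at h1
  simp only [condExpect_edgePoly hF] at h1
  rw [abs_of_nonneg (permAvg_nonneg fun z => pairMom_nonneg hq hq2 hΘ)] at h1
  rwa [rk_edgeImage_of_no_isolated hG.2.2, NearOrtho.card_edgeImage]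

/-! ### Merged graphs and their pure components as edge sets -/

section Merged

variable {G H : FinGraph} {π₁ : Fin G.order ↪ Fin n} {π₂ : Fin H.order ↪ Fin n}
  {A B : Finset (Sym2 (Fin n))}

lemma edgeImage_diffGraph :
    edgeImage (diffGraph π₁ π₂) (Function.Embedding.refl _) =
      edgeImage G.graph π₁ ∆ edgeImage H.graph π₂ := by
  ext e
  induction e with | _ a b =>
  rw [mem_symmDiff, mem_edgeImage_iff_map_adj, mem_edgeImage_iff_map_adj,
    mem_edgeImage_iff_map_adj]
  have : (diffGraph π₁ π₂).map (Function.Embedding.refl _) = diffGraph π₁ π₂ :=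
    SimpleGraph.map_id _
  rw [this]
  simp only [diffGraph, symmDiff, SimpleGraph.sup_adj, SimpleGraph.sdiff_adj]

lemma edgeImage_interGraph :
    edgeImage (interGraph π₁ π₂) (Function.Embedding.refl _) =
      edgeImage G.graph π₁ ∩ edgeImage H.graph π₂ := by
  ext e
  induction e with | _ a b =>
  rw [mem_inter, mem_edgeImage_iff_map_adj, mem_edgeImage_iff_map_adj,
    mem_edgeImage_iff_map_adj]
  have : (interGraph π₁ π₂).map (Function.Embedding.refl _) = interGraph π₁ π₂ :=
    SimpleGraph.map_id _
  rw [this]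
  simp only [interGraph, SimpleGraph.inf_adj]

lemma numDiffEdges_eq :
    numDiffEdges π₁ π₂ = (edgeImage G.graph π₁ ∆ edgeImage H.graph π₂).card := by
  rw [← edgeImage_diffGraph, NearOrtho.card_edgeImage, numDiffEdges]

lemma numInterEdges_eq :
    numInterEdges π₁ π₂ = (edgeImage G.graph π₁ ∩ edgeImage H.graph π₂).card := by
  rw [← edgeImage_interGraph, NearOrtho.card_edgeImage, numInterEdges]

lemma diffRank_eq :
    diffRank π₁ π₂ = rk (edgeImage G.graph π₁ ∆ edgeImage H.graph π₂) := by
  rw [← edgeImage_diffGraph, rk_edgeImage, diffRank, diffComponents]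

lemma range_eq_verts {m : ℕ} {G : SimpleGraph (Fin m)} {π : Fin m ↪ Fin n}
    (hG : ∀ v, ∃ w, G.Adj v w) : Set.range π = (verts (edgeImage G π) : Set (Fin n)) := by
  rw [verts_edgeImage, support_eq_univ hG, Set.image_univ]

variable (hG : ∀ v, ∃ w, G.graph.Adj v w) (hH : ∀ v, ∃ w, H.graph.Adj v w)
  (hA : edgeImage G.graph π₁ = A) (hB : edgeImage H.graph π₂ = B)

include hG hH hA hB

lemma mem_pureComponents_iff (C : (diffGraph π₁ π₂).ConnectedComponent) :
    C ∈ pureComponents π₁ π₂ ↔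
      compEdges (diffGraph π₁ π₂) (Function.Embedding.refl _) C ∈ pureBlocks A B := by
  have hdiff : edgeImage (diffGraph π₁ π₂) (Function.Embedding.refl _) = A ∆ B := by
    rw [edgeImage_diffGraph, hA, hB]
  have hr1 : Set.range π₁ = (verts A : Set (Fin n)) := by rw [range_eq_verts hG, hA]
  have hr2 : Set.range π₂ = (verts B : Set (Fin n)) := by rw [range_eq_verts hH, hB]
  set c := compEdges (diffGraph π₁ π₂) (Function.Embedding.refl _) C with hc
  constructor
  · rintro ⟨h1, h2⟩
    obtain ⟨v, hv⟩ := C.nonempty_supp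
    have hcn : c.Nonempty := compEdges_nonempty_iff.2 ⟨v, hv, h1 hv⟩
    have hcv : (verts c : Set (Fin n)) = C.supp := by
      rw [hc, verts_compEdges hcn]; simp
    rw [mem_comps_symmDiff_iff, ← hdiff]
    refine ⟨compEdges_mem_comps hcn, disjoint_left.2 fun w hw hw' => ?_⟩
    have hw1 : w ∈ C.supp := by rw [← hcv]; exact hw
    rw [mem_inter] at hw'
    rw [hr1, hr2] at h2
    rcases h2 with h2 | h2
    · exact (h2 hw1).2 hw'.2
    · exact (h2 hw1).2 hw'.1
  · intro h
    have hcn : c.Nonempty := isConnFamily_pureBlocks.1 c h |>.1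
    have hcv : (verts c : Set (Fin n)) = C.supp := by
      rw [hc, verts_compEdges hcn]; simp
    refine ⟨supp_subset_support (compEdges_nonempty_iff.1 hcn), ?_⟩
    rw [hr1, hr2, ← hcv]
    have key : ∀ X Y : Finset (Sym2 (Fin n)), c ∈ purePart X Y →
        (verts c : Set (Fin n)) ⊆ (verts X : Set (Fin n)) \ verts Y := by
      intro X Y hX v hv
      rw [mem_purePart] at hX
      exact ⟨verts_mono (subset_of_mem_comps hX.1) hv, fun hvY => disjoint_left.1 hX.2 hv hvY⟩
    rcases mem_union.1 h with h | h
    · exact Or.inl (key A B h)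
    · exact Or.inr (key B A h)

lemma exists_pureComponent {c : Finset (Sym2 (Fin n))} (hc : c ∈ pureBlocks A B) :
    ∃ C ∈ pureComponents π₁ π₂,
      compEdges (diffGraph π₁ π₂) (Function.Embedding.refl _) C = c := by
  have hdiff : edgeImage (diffGraph π₁ π₂) (Function.Embedding.refl _) = A ∆ B := by
    rw [edgeImage_diffGraph, hA, hB]
  have h1 := (mem_comps_symmDiff_iff.1 hc).1
  rw [← hdiff] at h1
  obtain ⟨C, rfl⟩ := exists_compEdges_eq h1
  exact ⟨C, (mem_pureComponents_iff hG hH hA hB C).2 hc, rfl⟩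

lemma supp_eq_of_mem_pureComponents {C : (diffGraph π₁ π₂).ConnectedComponent}
    (hC : C ∈ pureComponents π₁ π₂) :
    C.supp = (verts (compEdges (diffGraph π₁ π₂) (Function.Embedding.refl _) C) :
      Set (Fin n)) := by
  have h := (mem_pureComponents_iff hG hH hA hB C).1 hC
  rw [verts_compEdges (isConnFamily_pureBlocks.1 _ h).1]; simp

lemma numPure_eq : numPure π₁ π₂ = (pureBlocks A B).card := by
  rw [numPure, ← Set.ncard_coe_finset]
  have : (pureBlocks A B : Set _) =
      compEdges (diffGraph π₁ π₂) (Function.Embedding.refl _) '' pureComponents π₁ π₂ := by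
    ext c
    rw [mem_coe, Set.mem_image]
    constructor
    · exact exists_pureComponent hG hH hA hB
    · rintro ⟨C, hC, rfl⟩
      exact (mem_pureComponents_iff hG hH hA hB C).1 hC
  rw [this]
  refine (Set.InjOn.ncard_image fun C hC C' _ h => compEdges_injective ?_ h).symm
  exact (isConnFamily_pureBlocks.1 _ ((mem_pureComponents_iff hG hH hA hB C).1 hC)).1

lemma restNodes_eq : restNodes π₁ π₂ =
    (((verts A ∪ verts B) \ (pureBlocks A B).biUnion verts : Finset (Fin n)) :
      Set (Fin n)) := by
  have hr1 : Set.range π₁ = (verts A : Set (Fin n)) := by rw [range_eq_verts hG, hA]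
  have hr2 : Set.range π₂ = (verts B : Set (Fin n)) := by rw [range_eq_verts hH, hB]
  rw [restNodes, unionNodes, hr1, hr2, coe_sdiff, coe_union]
  congr 1
  ext v
  simp only [Set.mem_iUnion, coe_biUnion, mem_coe, exists_prop]
  constructor
  · rintro ⟨C, hC, hv⟩
    refine ⟨_, (mem_pureComponents_iff hG hH hA hB C).1 hC, ?_⟩
    rwa [supp_eq_of_mem_pureComponents hG hH hA hB hC] at hv
  · rintro ⟨c, hc, hv⟩
    obtain ⟨C, hC, rfl⟩ := exists_pureComponent hG hH hA hB hc
    refine ⟨C, hC, ?_⟩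
    rwa [supp_eq_of_mem_pureComponents hG hH hA hB hC]

/-- The graph `𝒩[z; G_∪]` is connected if the corresponding family of blocks is linked. -/
lemma labelGraph_connected {𝒦 : Finset (Option (Finset (Sym2 (Fin n))))}
    {b : Option (Finset (Sym2 (Fin n))) → Finset (Fin n)} (hne : 𝒦.Nonempty)
    (h𝒦 : ∀ c, some c ∈ 𝒦 ↔ c ∈ pureBlocks A B)
    (h𝒦' : none ∈ 𝒦 ↔ (verts A ∩ verts B).Nonempty)
    (hb : ∀ c, b (some c) = verts c)
    (hb' : none ∈ 𝒦 → b none = (verts A ∪ verts B) \ (pureBlocks A B).biUnion verts)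
    {z : Fin n → Fin n} (hz : Linked b 𝒦 z) : (labelGraph π₁ π₂ z).Connected := by
  classical
  have hr1 : Set.range π₁ = (verts A : Set (Fin n)) := by rw [range_eq_verts hG, hA]
  have hr2 : Set.range π₂ = (verts B : Set (Fin n)) := by rw [range_eq_verts hH, hB]
  have hinter : (interNodes π₁ π₂).Nonempty ↔ (verts A ∩ verts B).Nonempty := by
    rw [interNodes, hr1, hr2, ← coe_inter, coe_nonempty]
  have hmem : ∀ i ∈ 𝒦, (b i : Set (Fin n)) ∈ labelBlocks π₁ π₂ := by
    intro i hi
    cases i with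
    | none =>
      refine Or.inr ⟨hinter.2 (h𝒦'.1 hi), ?_⟩
      rw [hb' hi, restNodes_eq hG hH hA hB]
    | some c =>
      obtain ⟨C, hC, rfl⟩ := exists_pureComponent hG hH hA hB ((h𝒦 c).1 hi)
      exact Or.inl ⟨C, hC, by rw [hb, supp_eq_of_mem_pureComponents hG hH hA hB hC]⟩
  have hsurj : ∀ X ∈ labelBlocks π₁ π₂, ∃ i ∈ 𝒦, (b i : Set (Fin n)) = X := by
    rintro X (⟨C, hC, rfl⟩ | ⟨hi, rfl⟩)
    · refine ⟨some _, (h𝒦 _).2 ((mem_pureComponents_iff hG hH hA hB C).1 hC), ?_⟩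
      rw [hb, supp_eq_of_mem_pureComponents hG hH hA hB hC]
    · have := h𝒦'.2 (hinter.1 hi)
      exact ⟨none, this, by rw [hb' this, restNodes_eq hG hH hA hB]⟩
  obtain ⟨i₀, hi₀⟩ := hne
  have : Nonempty (labelBlocks π₁ π₂) := ⟨⟨_, hmem i₀ hi₀⟩⟩
  refine SimpleGraph.Connected.mk fun X Y => ?_
  obtain ⟨X, hX⟩ := X
  obtain ⟨Y, hY⟩ := Y
  obtain ⟨i, hi, rfl⟩ := hsurj X hX
  obtain ⟨j, hj, rfl⟩ := hsurj Y hY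
  -- The blocks reachable from the given one form a family closed under sharing labels, so
  -- linkedness makes it everything.
  let S := 𝒦.filter fun l => ∃ h : (b l : Set (Fin n)) ∈ labelBlocks π₁ π₂,
    (labelGraph π₁ π₂ z).Reachable ⟨_, hX⟩ ⟨_, h⟩
  have hS : S = 𝒦 := by
    refine hz S (filter_subset _ _) ⟨i, mem_filter.2 ⟨hi, hX, SimpleGraph.Reachable.refl _⟩⟩ ?_
    rintro l hl m hm ⟨a, ha, a', ha', haa⟩
    obtain ⟨hl, h1, h2⟩ := mem_filter.1 hl
    refine mem_filter.2 ⟨hm, hmem m hm, h2.trans ?_⟩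
    by_cases heq : (b l : Set (Fin n)) = b m
    · simp only [heq]; exact SimpleGraph.Reachable.refl _
    · refine SimpleGraph.Adj.reachable ((SimpleGraph.fromRel_adj _ _ _).2
        ⟨fun h => heq (congrArg Subtype.val h), Or.inl ⟨a, ha, a', ha', haa⟩⟩)
  have hjS : j ∈ S := hS ▸ hj
  exact (mem_filter.1 hjS).2.2

end Merged

/-- `C-Variance-Permutation` for edge sets. -/
lemma CVariancePerm.avg_linked_le {cvd1 cvd2 : ℝ} (h : CVariancePerm n D k lam q Θ cvd1 cvd2)
    (hq : 0 ≤ q) (hq2 : q ≤ 1 / 2) (hΘ : ∀ i j, Θ i j ∈ Set.Icc 0 lam)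
    {A B : Finset (Sym2 (Fin n))} (hA : A ⊆ allEdges n) (hB : B ⊆ allEdges n)
    (hAn : A.Nonempty) (hBn : B.Nonempty) (hAD : A.card ≤ D) (hBD : B.card ≤ D) (hAB : A ≠ B)
    {𝒦 : Finset (Option (Finset (Sym2 (Fin n))))}
    {b : Option (Finset (Sym2 (Fin n))) → Finset (Fin n)} (hne : 𝒦.Nonempty)
    (h𝒦 : ∀ c, some c ∈ 𝒦 ↔ c ∈ pureBlocks A B)
    (h𝒦' : none ∈ 𝒦 ↔ (verts A ∩ verts B).Nonempty)
    (hb : ∀ c, b (some c) = verts c)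
    (hb' : none ∈ 𝒦 → b none = (verts A ∪ verts B) \ (pureBlocks A B).biUnion verts) :
    avg (fun z => ind (Linked b 𝒦 z) * pairMom q Θ A B z) ≤
      cvd2 * (D : ℝ) ^ cvd1 * ((D : ℝ) ^ cvd1 * lam) ^ (A ∆ B).card *
          pbar lam q ^ (A ∩ B).card * ((D : ℝ) ^ cvd1 * (k / n)) ^ rk (A ∆ B) *
          (cvd2 * ((D : ℝ) ^ cvd1 / √n)) ^ (pureBlocks A B).card := by
  classical
  obtain ⟨G, hG, π₁, hGA⟩ := exists_template hA hAn hAD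
  obtain ⟨H, hH, π₂, hHB⟩ := exists_template hB hBn hBD
  -- The only matching compatible with the two labelings; were it perfect, the labeled edge sets
  -- would coincide.
  let M : Set (Fin G.order × Fin H.order) := {p | π₁ p.1 = π₂ p.2}
  have hM : IsNodeMatching M := by
    intro a ha c hc
    have ha' : π₁ a.1 = π₂ a.2 := ha
    have hc' : π₁ c.1 = π₂ c.2 := hc
    rw [← π₁.injective.eq_iff, ha', hc', π₂.injective.eq_iff]
  have hMp : ¬ IsPerfectMatching M := by
    rintro ⟨_, h1, h2, h3⟩
    refine hAB ?_
    rw [← hGA, ← hHB]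
    ext e
    induction e with | _ a c =>
    rw [mem_edgeImage_iff_map_adj, mem_edgeImage_iff_map_adj, SimpleGraph.map_adj,
      SimpleGraph.map_adj]
    constructor
    · rintro ⟨x, y, hxy, rfl, rfl⟩
      obtain ⟨x', hx⟩ := h1 x
      obtain ⟨y', hy⟩ := h1 y
      exact ⟨x', y', (h3 _ hx _ hy).1 hxy, Eq.symm hx, Eq.symm hy⟩
    · rintro ⟨x', y', hxy, rfl, rfl⟩
      obtain ⟨x, hx⟩ := h2 x'
      obtain ⟨y, hy⟩ := h2 y'
      exact ⟨x, y, (h3 _ hx _ hy).2 hxy, hx, hy⟩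
  have h1 := h G H hG hH M hM hMp π₁ π₂ fun v w => Iff.rfl
  rw [numDiffEdges_eq, numInterEdges_eq, diffRank_eq, numPure_eq hG.2.2 hH.2.2 hGA hHB,
    indepExpect_eq, hGA, hHB] at h1
  refine le_trans ?_ ((le_abs_self _).trans h1)
  refine avg_mono fun z => ?_
  rw [condExpect_mul_left, monomial_eq, monomial_eq, hGA, hHB, condExpect_edgePoly_mul hA hB]
  refine mul_le_mul_of_nonneg_right ?_ (pairMom_nonneg hq hq2 hΘ)
  by_cases hz : Linked b 𝒦 z
  · rw [ind_of_true hz, if_pos (labelGraph_connected hG.2.2 hH.2.2 hGA hHB hne h𝒦 h𝒦' hb hb' hz)]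
  · rw [ind_of_false hz]
    split_ifs <;> norm_num

end Conditions

section Clusters

/- ### Bounds for clusters of blocks -/

variable {n D : ℕ} {q lam Λ κ s : ℝ} {Θ : Matrix (Fin n) (Fin n) ℝ}

/-- Moment bounds for edge sets, under permutation sampling for a single edge set and under
independent sampling, on the event that the blocks are linked, for a pair of edge sets. -/
structure MomentBounds (n D : ℕ) (q lam Λ κ s : ℝ) (Θ : Matrix (Fin n) (Fin n) ℝ) : Prop where
  q_nonneg : 0 ≤ q
  q_le : q ≤ 1 / 2
  signal_mem : ∀ i j, Θ i j ∈ Set.Icc 0 lam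
  rate_nonneg : 0 ≤ Λ
  density_nonneg : 0 ≤ κ
  density_le : κ ≤ 1
  s_nonneg : 0 ≤ s
  s_le : s ≤ 1
  sq_mul : s ^ 2 * n = 1
  moment : ∀ F : Finset (Sym2 (Fin n)), F ⊆ allEdges n → F.Nonempty → F.card ≤ D →
    permAvg (pairMom q Θ F ∅) ≤ Λ ^ F.card * κ ^ rk F
  linked : ∀ A B : Finset (Sym2 (Fin n)), A ⊆ allEdges n → B ⊆ allEdges n →
    A.Nonempty → B.Nonempty → A.card ≤ D → B.card ≤ D → A ≠ B →
    ∀ (𝒦 : Finset (Option (Finset (Sym2 (Fin n)))))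
      (b : Option (Finset (Sym2 (Fin n))) → Finset (Fin n)), 𝒦.Nonempty →
    (∀ c, some c ∈ 𝒦 ↔ c ∈ pureBlocks A B) → (none ∈ 𝒦 ↔ (verts A ∩ verts B).Nonempty) →
    (∀ c, b (some c) = verts c) →
    (none ∈ 𝒦 → b none = (verts A ∪ verts B) \ (pureBlocks A B).biUnion verts) →
    avg (fun z => ind (Linked b 𝒦 z) * pairMom q Θ A B z) ≤
      Λ ^ (A ∆ B).card * pbar lam q ^ (A ∩ B).card * κ ^ rk (A ∆ B) *
        s ^ (pureBlocks A B).card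

lemma prod_option {α : Type*} [DecidableEq α] (K : Finset (Option α)) (g : Option α → ℝ) :
    ∏ j ∈ K, g j = (if none ∈ K then g none else 1) * ∏ c ∈ eraseNone K, g (some c) := by
  split_ifs with h
  · rw [← prod_insertNone, insertNone_eraseNone, insert_eq_of_mem h]
  · have := map_some_eraseNone K
    rw [erase_eq_of_notMem h] at this
    conv_lhs => rw [← this, prod_map]
    simp

/-- The edge sets `⋃ K₁ ∪ Z₁` and `⋃ K₂ ∪ Z₂` with pure components `K₁ ∪ K₂`. -/
structure PureDecomp (K₁ K₂ : Finset (Finset (Sym2 (Fin n)))) (Z₁ Z₂ : Finset (Sym2 (Fin n))) :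
    Prop where
  family : IsConnFamily (K₁ ∪ K₂)
  disj : Disjoint K₁ K₂
  left : ∀ c ∈ K₁ ∪ K₂, VDisj c Z₁
  right : ∀ c ∈ K₁ ∪ K₂, VDisj c Z₂
  pure_eq : pureBlocks Z₁ Z₂ = ∅

namespace PureDecomp

variable {K₁ K₂ : Finset (Finset (Sym2 (Fin n)))} {Z₁ Z₂ : Finset (Sym2 (Fin n))}

lemma vdisj_of_mem (h : PureDecomp K₁ K₂ Z₁ Z₂) {c : Finset (Sym2 (Fin n))} (hc : c ∈ K₁) :
    VDisj c (K₂.biUnion id ∪ Z₂) := by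
  rw [vdisj_union_right, vdisj_biUnion_right]
  exact ⟨fun c' hc' => h.family.2 c (mem_union_left _ hc) c' (mem_union_right _ hc')
    fun h' => disjoint_left.1 h.disj hc (h' ▸ hc'), h.right c (mem_union_left _ hc)⟩

lemma symm (h : PureDecomp K₁ K₂ Z₁ Z₂) : PureDecomp K₂ K₁ Z₂ Z₁ where
  family := by rw [union_comm]; exact h.family
  disj := h.disj.symm
  left := by rw [union_comm]; exact h.right
  right := by rw [union_comm]; exact h.left
  pure_eq := by rw [pureBlocks, union_comm]; exact h.pure_eq

lemma comps_eq (h : PureDecomp K₁ K₂ Z₁ Z₂) :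
    comps (K₁.biUnion id ∪ Z₁) = K₁ ∪ comps Z₁ := by
  rw [comps_union, comps_biUnion (h.family.mono subset_union_left)]
  rw [vdisj_biUnion_left]
  exact fun c hc => h.left c (mem_union_left _ hc)

lemma purePart_eq (h : PureDecomp K₁ K₂ Z₁ Z₂) :
    purePart (K₁.biUnion id ∪ Z₁) (K₂.biUnion id ∪ Z₂) = K₁ := by
  ext c
  rw [mem_purePart, h.comps_eq, mem_union]
  constructor
  · rintro ⟨hc | hc, hv⟩
    · exact hc
    · have : c ∈ pureBlocks Z₁ Z₂ := mem_union_left _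
        (mem_purePart.2 ⟨hc, hv.mono Subset.rfl subset_union_right⟩)
      rw [h.pure_eq] at this
      exact absurd this (notMem_empty _)
  · exact fun hc => ⟨Or.inl hc, h.vdisj_of_mem hc⟩

lemma pureBlocks_eq (h : PureDecomp K₁ K₂ Z₁ Z₂) :
    pureBlocks (K₁.biUnion id ∪ Z₁) (K₂.biUnion id ∪ Z₂) = K₁ ∪ K₂ := by
  rw [pureBlocks, h.purePart_eq, h.symm.purePart_eq]

lemma vdisj_biUnion (h : PureDecomp K₁ K₂ Z₁ Z₂) :
    VDisj ((K₁ ∪ K₂).biUnion id) (Z₁ ∪ Z₂) := by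
  rw [vdisj_biUnion_left]
  exact fun c hc => vdisj_union_right.2 ⟨h.left c hc, h.right c hc⟩

lemma vdisj_biUnion_biUnion (h : PureDecomp K₁ K₂ Z₁ Z₂) :
    VDisj (K₁.biUnion id) (K₂.biUnion id ∪ Z₂) := by
  rw [vdisj_biUnion_left]
  exact fun c hc => h.vdisj_of_mem hc

lemma symmDiff_eq (h : PureDecomp K₁ K₂ Z₁ Z₂) :
    (K₁.biUnion id ∪ Z₁) ∆ (K₂.biUnion id ∪ Z₂) = (K₁ ∪ K₂).biUnion id ∪ Z₁ ∆ Z₂ := by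
  have h1 := h.vdisj_biUnion_biUnion.disjoint
  have h2 := h.symm.vdisj_biUnion_biUnion.disjoint
  rw [Finset.union_biUnion]
  ext e
  have h3 : e ∈ K₁.biUnion id → e ∉ K₂.biUnion id ∪ Z₂ := fun h => disjoint_left.1 h1 h
  have h4 : e ∈ K₂.biUnion id → e ∉ K₁.biUnion id ∪ Z₁ := fun h => disjoint_left.1 h2 h
  simp only [mem_symmDiff, mem_union] at h3 h4 ⊢
  tauto

lemma inter_eq (h : PureDecomp K₁ K₂ Z₁ Z₂) :
    (K₁.biUnion id ∪ Z₁) ∩ (K₂.biUnion id ∪ Z₂) = Z₁ ∩ Z₂ := by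
  have h1 := h.vdisj_biUnion_biUnion.disjoint
  have h2 := h.symm.vdisj_biUnion_biUnion.disjoint
  ext e
  have h3 : e ∈ K₁.biUnion id → e ∉ K₂.biUnion id ∪ Z₂ := fun h => disjoint_left.1 h1 h
  have h4 : e ∈ K₂.biUnion id → e ∉ K₁.biUnion id ∪ Z₁ := fun h => disjoint_left.1 h2 h
  simp only [mem_inter, mem_union] at h3 h4 ⊢
  tauto

lemma vdisj_symmDiff (h : PureDecomp K₁ K₂ Z₁ Z₂) :
    VDisj ((K₁ ∪ K₂).biUnion id) (Z₁ ∆ Z₂) :=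
  h.vdisj_biUnion.mono Subset.rfl (by
    intro e he
    rw [mem_union]
    rcases mem_symmDiff.1 he with h | h
    exacts [Or.inl h.1, Or.inr h.1])

lemma card_symmDiff (h : PureDecomp K₁ K₂ Z₁ Z₂) :
    ((K₁.biUnion id ∪ Z₁) ∆ (K₂.biUnion id ∪ Z₂)).card =
      ∑ c ∈ K₁ ∪ K₂, c.card + (Z₁ ∆ Z₂).card := by
  rw [h.symmDiff_eq, card_union_of_disjoint h.vdisj_symmDiff.disjoint, h.family.card_biUnion]

lemma rk_symmDiff (h : PureDecomp K₁ K₂ Z₁ Z₂) :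
    rk ((K₁.biUnion id ∪ Z₁) ∆ (K₂.biUnion id ∪ Z₂)) =
      ∑ c ∈ K₁ ∪ K₂, rk c + rk (Z₁ ∆ Z₂) := by
  rw [h.symmDiff_eq, rk_union h.vdisj_symmDiff, rk_biUnion h.family]

lemma verts_inter (h : PureDecomp K₁ K₂ Z₁ Z₂) :
    verts (K₁.biUnion id ∪ Z₁) ∩ verts (K₂.biUnion id ∪ Z₂) = verts Z₁ ∩ verts Z₂ := by
  have h1 : Disjoint _ _ := h.vdisj_biUnion_biUnion
  have h2 : Disjoint _ _ := h.symm.vdisj_biUnion_biUnion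
  ext v
  have h3 : v ∈ verts (K₁.biUnion id) → v ∉ verts (K₂.biUnion id ∪ Z₂) :=
    fun h => disjoint_left.1 h1 h
  have h4 : v ∈ verts (K₂.biUnion id) → v ∉ verts (K₁.biUnion id ∪ Z₁) :=
    fun h => disjoint_left.1 h2 h
  simp only [verts_union, mem_inter, mem_union] at h3 h4 ⊢
  tauto

lemma verts_rest (h : PureDecomp K₁ K₂ Z₁ Z₂) :
    (verts (K₁.biUnion id ∪ Z₁) ∪ verts (K₂.biUnion id ∪ Z₂)) \ (K₁ ∪ K₂).biUnion verts =
      verts Z₁ ∪ verts Z₂ := by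
  have h1 : Disjoint _ _ := h.vdisj_biUnion
  have h2 : (K₁ ∪ K₂).biUnion verts = verts (K₁.biUnion id) ∪ verts (K₂.biUnion id) := by
    rw [← verts_union, ← Finset.union_biUnion, verts_biUnion]; rfl
  rw [Finset.union_biUnion, verts_union] at h1
  rw [h2]
  ext v
  have h3 : v ∈ verts (K₁.biUnion id) ∪ verts (K₂.biUnion id) → v ∉ verts (Z₁ ∪ Z₂) :=
    fun h => disjoint_left.1 h1 h
  simp only [verts_union, mem_sdiff, mem_union] at h3 ⊢
  tauto

lemma pairMom_eq (h : PureDecomp K₁ K₂ Z₁ Z₂) (z : Fin n → Fin n) :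
    pairMom q Θ (K₁.biUnion id ∪ Z₁) (K₂.biUnion id ∪ Z₂) z =
      (∏ c ∈ K₁ ∪ K₂, pairMom q Θ c ∅ z) * pairMom q Θ Z₁ Z₂ z :=
  pairMom_biUnion h.family h.disj h.left h.right

/-- A component of `Z₁` avoiding `Z₂` would be pure. Hence the block `none` carries edges exactly
when a matched node exists, in accordance with the convention for `ω₀`. -/
lemma verts_inter_nonempty (h : PureDecomp K₁ K₂ Z₁ Z₂) (hZ : (Z₁ ∪ Z₂).Nonempty) :
    (verts Z₁ ∩ verts Z₂).Nonempty := by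
  have key : ∀ X Y : Finset (Sym2 (Fin n)), pureBlocks X Y = ∅ → X.Nonempty →
      (verts X ∩ verts Y).Nonempty := by
    rintro X Y hXY ⟨e, he⟩
    obtain ⟨c, hc, -⟩ := exists_comp he
    have : ¬ VDisj c Y := fun hv => by
      have : c ∈ pureBlocks X Y := mem_union_left _ (mem_purePart.2 ⟨hc, hv⟩)
      rw [hXY] at this
      exact absurd this (notMem_empty _)
    obtain ⟨v, hv1, hv2⟩ := not_disjoint_iff.1 this
    exact ⟨v, mem_inter.2 ⟨verts_mono (subset_of_mem_comps hc) hv1, hv2⟩⟩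
  rcases union_nonempty.1 hZ with hZ | hZ
  · exact key _ _ h.pure_eq hZ
  · rw [inter_comm]; exact key _ _ h.symm.pure_eq hZ

/-- The cluster bound. -/
lemma avg_linked_le (h : PureDecomp K₁ K₂ Z₁ Z₂) (hb : MomentBounds n D q lam Λ κ s Θ)
    (h1 : K₁.biUnion id ∪ Z₁ ⊆ allEdges n) (h2 : K₂.biUnion id ∪ Z₂ ⊆ allEdges n)
    (h1n : (K₁.biUnion id ∪ Z₁).Nonempty) (h2n : (K₂.biUnion id ∪ Z₂).Nonempty)
    (h1D : (K₁.biUnion id ∪ Z₁).card ≤ D) (h2D : (K₂.biUnion id ∪ Z₂).card ≤ D)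
    (hne : (K₁ ∪ K₂).Nonempty ∨ Z₁ ≠ Z₂)
    (𝒦 : Finset (Option (Finset (Sym2 (Fin n)))))
    (b : Option (Finset (Sym2 (Fin n))) → Finset (Fin n))
    (h𝒦 : eraseNone 𝒦 = K₁ ∪ K₂) (h𝒦' : none ∈ 𝒦 ↔ (Z₁ ∪ Z₂).Nonempty)
    (hbs : ∀ c, b (some c) = verts c) (hbn : none ∈ 𝒦 → b none = verts Z₁ ∪ verts Z₂) :
    avg (fun z => ind (Linked b 𝒦 z) *
        ((∏ c ∈ K₁ ∪ K₂, pairMom q Θ c ∅ z) * pairMom q Θ Z₁ Z₂ z)) ≤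
      (∏ c ∈ K₁ ∪ K₂, Λ ^ c.card * κ ^ rk c) *
        (Λ ^ (Z₁ ∆ Z₂).card * pbar lam q ^ (Z₁ ∩ Z₂).card * κ ^ rk (Z₁ ∆ Z₂)) *
        s ^ (K₁ ∪ K₂).card := by
  have hneq : K₁.biUnion id ∪ Z₁ ≠ K₂.biUnion id ∪ Z₂ := by
    intro heq
    have hz : (K₁.biUnion id ∪ Z₁) ∆ (K₂.biUnion id ∪ Z₂) = ∅ := by rw [heq, symmDiff_self]; rfl
    rw [h.symmDiff_eq, union_eq_empty] at hz
    rcases hne with ⟨c, hc⟩ | hne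
    · obtain ⟨e, he⟩ := (h.family.1 c hc).1
      have : e ∈ (K₁ ∪ K₂).biUnion id := mem_biUnion.2 ⟨c, hc, he⟩
      rw [hz.1] at this
      exact absurd this (notMem_empty _)
    · exact hne (symmDiff_eq_bot.1 hz.2)
  have hinter : (verts Z₁ ∩ verts Z₂).Nonempty ↔ (Z₁ ∪ Z₂).Nonempty := by
    refine ⟨fun ⟨v, hv⟩ => ?_, h.verts_inter_nonempty⟩
    obtain ⟨e, he, _⟩ := mem_verts.1 (mem_inter.1 hv).1
    exact ⟨e, mem_union_left _ he⟩
  have h𝒦n : 𝒦.Nonempty := by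
    rcases hne with ⟨c, hc⟩ | hne
    · rw [← h𝒦] at hc
      exact ⟨some c, mem_eraseNone.1 hc⟩
    · refine ⟨none, h𝒦'.2 ?_⟩
      by_contra hcon
      rw [not_nonempty_iff_eq_empty, union_eq_empty] at hcon
      exact hne (hcon.1.trans hcon.2.symm)
  have := hb.linked _ _ h1 h2 h1n h2n h1D h2D hneq 𝒦 b h𝒦n
    (fun c => by rw [h.pureBlocks_eq, ← h𝒦, mem_eraseNone])
    (by rw [h.verts_inter, hinter, h𝒦']) hbs
    (fun hn => by rw [h.pureBlocks_eq, h.verts_rest, hbn hn])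
  simp only [h.pairMom_eq] at this
  rw [h.card_symmDiff, h.inter_eq, h.rk_symmDiff, h.pureBlocks_eq, pow_add, pow_add,
    ← prod_pow_eq_pow_sum, ← prod_pow_eq_pow_sum] at this
  refine this.trans (le_of_eq ?_)
  rw [prod_mul_distrib]
  ring

end PureDecomp

/-- The part of `A` outside the pure components. -/
def restPart (A B : Finset (Sym2 (Fin n))) : Finset (Sym2 (Fin n)) :=
  A \ (purePart A B).biUnion id

variable {A B : Finset (Sym2 (Fin n))}

lemma biUnion_purePart_subset : (purePart A B).biUnion id ⊆ A :=
  biUnion_subset.2 fun _ hc => subset_of_mem_comps (purePart_subset hc)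

lemma biUnion_purePart_union_restPart : (purePart A B).biUnion id ∪ restPart A B = A :=
  union_sdiff_of_subset biUnion_purePart_subset

lemma vdisj_restPart {c : Finset (Sym2 (Fin n))} (hc : c ∈ purePart A B) :
    VDisj c (restPart A B) := by
  by_contra hcon
  obtain ⟨e, he, e', he', v, hv, hv'⟩ := not_vdisj_iff.1 hcon
  obtain ⟨he', hn⟩ := mem_sdiff.1 he'
  exact hn (mem_biUnion.2 ⟨c, hc, (mem_comps.1 (purePart_subset hc)).1.2 e' he' e he
    ⟨v, hv', hv⟩⟩)

/-- Removing the pure components creates no new ones: a component of the rest of `A` is a component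
of `A`, and if it avoids the rest of `B` it also avoids the pure components of `B`, hence all of
`B`, so it was already removed. Any subfamily `K` of pure components can then be put back. -/
lemma pureDecomp_restPart {K : Finset (Finset (Sym2 (Fin n)))} (hK : K ⊆ pureBlocks A B) :
    PureDecomp (K ∩ purePart A B) (K ∩ purePart B A) (restPart A B) (restPart B A) := by
  have hKeq : K ∩ purePart A B ∪ K ∩ purePart B A = K := by
    rw [← inter_union_distrib_left]; exact inter_eq_left.2 hK
  have key : ∀ A B : Finset (Sym2 (Fin n)), ∀ c ∈ pureBlocks A B, VDisj c (restPart A B) := by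
    intro A B c hc
    rcases mem_union.1 hc with hc | hc
    · exact vdisj_restPart hc
    · exact (mem_purePart.1 hc).2.mono Subset.rfl sdiff_subset
  have key2 : ∀ A B : Finset (Sym2 (Fin n)), purePart (restPart A B) (restPart B A) = ∅ := by
    intro A B
    refine eq_empty_of_forall_notMem fun c hc => ?_
    rw [mem_purePart] at hc
    have hcA : c ∈ comps A := by
      rw [← biUnion_purePart_union_restPart (A := A) (B := B), comps_union]
      · exact mem_union_right _ hc.1
      · rw [vdisj_biUnion_left]
        exact fun c hc => vdisj_restPart hc
    have hcB : VDisj c B := by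
      rw [← biUnion_purePart_union_restPart (A := B) (B := A), vdisj_union_right,
        vdisj_biUnion_right]
      refine ⟨fun c' hc' => ?_, hc.2⟩
      exact ((mem_purePart.1 hc').2.mono Subset.rfl (subset_of_mem_comps hcA)).symm
    obtain ⟨e, he⟩ := nonempty_of_mem_comps hcA
    exact (mem_sdiff.1 (subset_of_mem_comps hc.1 he)).2
      (mem_biUnion.2 ⟨c, mem_purePart.2 ⟨hcA, hcB⟩, he⟩)
  refine ⟨?_, ?_, ?_, ?_, ?_⟩
  · rw [hKeq]; exact isConnFamily_pureBlocks.mono hK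
  · exact purePart_disjoint.mono inter_subset_right inter_subset_right
  · rw [hKeq]; exact fun c hc => key A B c (hK hc)
  · rw [hKeq]
    intro c hc
    refine key B A c ?_
    rw [pureBlocks, union_comm]
    exact hK hc
  · rw [pureBlocks, key2, key2, empty_union]

lemma pureDecomp_empty {K₁ K₂ : Finset (Finset (Sym2 (Fin n)))} (h : IsConnFamily (K₁ ∪ K₂))
    (hd : Disjoint K₁ K₂) : PureDecomp K₁ K₂ ∅ ∅ :=
  ⟨h, hd, fun _ _ => vdisj_empty_right, fun _ _ => vdisj_empty_right, by
    simp [pureBlocks, purePart]⟩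

/-- The node set of a block of the pair `A`, `B`; `none` stands for the rest. -/
def blockNodes (A B : Finset (Sym2 (Fin n))) :
    Option (Finset (Sym2 (Fin n))) → Finset (Fin n)
  | none => verts (restPart A B) ∪ verts (restPart B A)
  | some c => verts c

/-- The conditional moment of a block. -/
def blockFun (q : ℝ) (Θ : Matrix (Fin n) (Fin n) ℝ) (A B : Finset (Sym2 (Fin n))) :
    Option (Finset (Sym2 (Fin n))) → (Fin n → Fin n) → ℝ
  | none => pairMom q Θ (restPart A B) (restPart B A)
  | some c => pairMom q Θ c ∅

/-- The bound for a block. -/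
def blockWeight (lam q Λ κ : ℝ) (A B : Finset (Sym2 (Fin n))) :
    Option (Finset (Sym2 (Fin n))) → ℝ
  | none => Λ ^ (restPart A B ∆ restPart B A).card *
      pbar lam q ^ (restPart A B ∩ restPart B A).card * κ ^ rk (restPart A B ∆ restPart B A)
  | some c => Λ ^ c.card * κ ^ rk c

lemma blockFun_nonneg (hb : MomentBounds n D q lam Λ κ s Θ) (j) (z : Fin n → Fin n) :
    0 ≤ blockFun q Θ A B j z := by
  cases j <;> exact pairMom_nonneg hb.q_nonneg hb.q_le hb.signal_mem

lemma pbar_nonneg (hb : MomentBounds n D q lam Λ κ s Θ) (hlam : 0 ≤ lam) : 0 ≤ pbar lam q := by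
  have h1 := hb.q_nonneg
  have h2 := hb.q_le
  rw [pbar_eq, qbar]
  have h3 : 0 ≤ 1 - q := by linarith
  have h4 : 0 ≤ 1 - 2 * q := by linarith
  positivity

lemma blockWeight_nonneg (hb : MomentBounds n D q lam Λ κ s Θ) (hlam : 0 ≤ lam) (j) :
    0 ≤ blockWeight lam q Λ κ A B j := by
  have h1 := hb.rate_nonneg
  have h2 := hb.density_nonneg
  have h3 := pbar_nonneg hb hlam
  cases j <;> simp only [blockWeight] <;> positivity

lemma dependsOn_blockFun (j) :
    DependsOn (blockFun q Θ A B j) (blockNodes A B j : Set (Fin n)) := by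
  cases j with
  | none => exact dependsOn_pairMom
  | some c => exact dependsOn_mono dependsOn_pairMom (by simp [blockNodes])

/-- The bound for an arbitrary cluster of blocks. -/
lemma avg_linked_blocks_le (hb : MomentBounds n D q lam Λ κ s Θ) (hlam : 0 ≤ lam)
    (hA : A ⊆ allEdges n) (hB : B ⊆ allEdges n) (hAD : A.card ≤ D) (hBD : B.card ≤ D)
    (T : Finset (Option (Finset (Sym2 (Fin n))))) (hT : none ∉ T)
    (K : Finset (Option (Finset (Sym2 (Fin n))))) (hK : eraseNone K ⊆ pureBlocks A B)
    (hKn : K.Nonempty) :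
    avg (fun z => ind (Linked (blockNodes A B) K z) *
        ∏ j ∈ K, (injInd (blockNodes A B j) z * blockFun q Θ A B j z)) ≤
      ∏ j ∈ K, (blockWeight lam q Λ κ A B j * if 2 ≤ K.card ∧ j ∈ T then s else 1) := by
  have hf0 : ∀ j z, 0 ≤ blockFun q Θ A B j z := blockFun_nonneg hb
  have hw0 : ∀ j, 0 ≤ blockWeight lam q Λ κ A B j := blockWeight_nonneg hb hlam
  have hdrop : ∀ z, ind (Linked (blockNodes A B) K z) *
        ∏ j ∈ K, (injInd (blockNodes A B j) z * blockFun q Θ A B j z) ≤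
      ind (Linked (blockNodes A B) K z) * ∏ j ∈ K, blockFun q Θ A B j z := fun z =>
    mul_le_mul_of_nonneg_left (prod_le_prod
      (fun j _ => mul_nonneg (injInd_nonneg _ _) (hf0 j z))
      fun j _ => mul_le_of_le_one_left (hf0 j z) (ind_le_one _)) (ind_nonneg _)
  have hcard : ∀ {X Y : Finset (Sym2 (Fin n))}, X ⊆ Y → Y.card ≤ D → X.card ≤ D :=
    fun h h' => (card_le_card h).trans h'
  have hKeq : eraseNone K ∩ purePart A B ∪ eraseNone K ∩ purePart B A = eraseNone K := by
    rw [← inter_union_distrib_left]; exact inter_eq_left.2 hK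
  have hsub1 : ∀ A B : Finset (Sym2 (Fin n)),
      (eraseNone K ∩ purePart A B).biUnion id ∪ restPart A B ⊆ A := fun A B =>
    union_subset ((biUnion_subset_biUnion_of_subset_left _ inter_subset_right).trans
      biUnion_purePart_subset) sdiff_subset
  -- clusters with the distinguished block
  have hnone : none ∈ K → ((eraseNone K).Nonempty ∨ restPart A B ≠ restPart B A) →
      (restPart A B ∪ restPart B A).Nonempty →
      avg (fun z => ind (Linked (blockNodes A B) K z) * ∏ j ∈ K, blockFun q Θ A B j z) ≤
        (∏ j ∈ K, blockWeight lam q Λ κ A B j) * s ^ (eraseNone K).card := by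
    intro hn hne hZ
    have hdec := pureDecomp_restPart hK
    obtain ⟨v, hv⟩ := hdec.verts_inter_nonempty hZ
    obtain ⟨e, he, -⟩ := mem_verts.1 (mem_inter.1 hv).1
    obtain ⟨e', he', -⟩ := mem_verts.1 (mem_inter.1 hv).2
    have := hdec.avg_linked_le hb ((hsub1 A B).trans hA) ((hsub1 B A).trans hB)
      ⟨e, mem_union_right _ he⟩ ⟨e', mem_union_right _ he'⟩ (hcard (hsub1 A B) hAD)
      (hcard (hsub1 B A) hBD) (by rwa [hKeq]) K (blockNodes A B) hKeq.symm
      (iff_of_true hn hZ) (fun _ => rfl) (fun _ => rfl)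
    rw [hKeq] at this
    simp only [prod_option K, if_pos hn]
    calc _ = avg (fun z => ind (Linked (blockNodes A B) K z) *
          ((∏ c ∈ eraseNone K, pairMom q Θ c ∅ z) *
            pairMom q Θ (restPart A B) (restPart B A) z)) := by
          congr 1; funext z; rw [mul_comm (∏ c ∈ eraseNone K, _)]; rfl
      _ ≤ _ := this
      _ = _ := by simp only [blockWeight]; ring
  rcases Nat.lt_or_ge K.card 2 with hK2 | hK2
  · -- a single block
    have hK1 : K.card = 1 := by have := hKn.card_pos; omega
    obtain ⟨j, rfl⟩ := card_eq_one.1 hK1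
    have hrhs : ∏ i ∈ {j}, (blockWeight lam q Λ κ A B i *
        if 2 ≤ ({j} : Finset (Option (Finset (Sym2 (Fin n))))).card ∧ i ∈ T then s else 1) =
        blockWeight lam q Λ κ A B j := by simp
    rw [hrhs]
    cases j with
    | none =>
      -- The `linked` bound is for distinct edge sets only. If the two rest parts coincide, all
      -- their edges are doubled and the pointwise bound by `p̄` suffices.
      by_cases hZ : restPart A B = restPart B A
      · refine (avg_mono hdrop).trans ?_
        calc _ ≤ avg (fun _ : Fin n → Fin n => pbar lam q ^ (restPart A B).card) := by
              refine avg_mono fun z => ?_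
              rw [prod_singleton]
              refine (mul_le_of_le_one_left (hf0 _ z) (ind_le_one _)).trans ?_
              simp only [blockFun, ← hZ]
              exact pairMom_self_le hb.q_nonneg hb.q_le hb.signal_mem
          _ = _ := by
              rw [avg_const]
              simp [blockWeight, ← hZ]
      · refine (avg_mono hdrop).trans ((hnone (mem_singleton_self _) (Or.inr hZ) ?_).trans ?_)
        · by_contra hcon
          rw [not_nonempty_iff_eq_empty, union_eq_empty] at hcon
          exact hZ (hcon.1.trans hcon.2.symm)
        · rw [prod_singleton]
          exact mul_le_of_le_one_right (hw0 _) (pow_le_one₀ hb.s_nonneg hb.s_le)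
    | some c =>
      have hc : c ∈ pureBlocks A B := hK (by simp)
      have hcs : c ⊆ allEdges n ∧ c.card ≤ D := by
        rcases mem_union.1 hc with h | h
        · have := subset_of_mem_comps (purePart_subset h)
          exact ⟨this.trans hA, hcard this hAD⟩
        · have := subset_of_mem_comps (purePart_subset h)
          exact ⟨this.trans hB, hcard this hBD⟩
      -- A single pure component carries no link event. Injectivity within the block turns the
      -- average into one over permutations, where the bound `moment` applies.
      calc _ ≤ avg (fun z => blockFun q Θ A B (some c) z * injInd (blockNodes A B (some c)) z) := by
            refine avg_mono fun z => ?_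
            rw [prod_singleton, mul_comm (blockFun q Θ A B (some c) z)]
            exact mul_le_of_le_one_left (mul_nonneg (injInd_nonneg _ _) (hf0 _ z)) (ind_le_one _)
        _ = avg (injInd (blockNodes A B (some c))) * permAvg (blockFun q Θ A B (some c)) :=
            avg_mul_injInd (dependsOn_blockFun _)
        _ ≤ permAvg (blockFun q Θ A B (some c)) := by
            refine mul_le_of_le_one_left (permAvg_nonneg (hf0 _)) ?_
            calc avg (injInd (blockNodes A B (some c))) ≤ avg (fun _ => 1) :=
                  avg_mono fun z => ind_le_one _
              _ = 1 := avg_const 1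
        _ ≤ _ := hb.moment c hcs.1 (isConnFamily_pureBlocks.1 c hc).1 hcs.2
  · -- several blocks
    -- The cluster bound yields `s` for every pure component, but only those in `T` need it; the
    -- surplus factors are at most one.
    have hrhs : (∏ j ∈ K, blockWeight lam q Λ κ A B j) * s ^ (eraseNone K).card ≤
        ∏ j ∈ K, (blockWeight lam q Λ κ A B j * if 2 ≤ K.card ∧ j ∈ T then s else 1) := by
      rw [prod_mul_distrib]
      refine mul_le_mul_of_nonneg_left ?_ (prod_nonneg fun j _ => hw0 j)
      simp only [hK2, true_and]
      rw [prod_option, ← prod_const]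
      rw [if_neg hT, ite_self, one_mul]
      refine prod_le_prod (fun _ _ => hb.s_nonneg) fun c _ => ?_
      split_ifs
      · exact le_rfl
      · exact hb.s_le
    refine le_trans ?_ hrhs
    by_cases hn : none ∈ K
    · have hKc : (eraseNone K).Nonempty := by
        obtain ⟨j, hj, hjn⟩ := exists_mem_ne (by omega : 1 < K.card) none
        obtain ⟨c, rfl⟩ := Option.ne_none_iff_exists'.1 hjn
        exact ⟨c, mem_eraseNone.2 hj⟩
      by_cases hZ : (restPart A B ∪ restPart B A).Nonempty
      · exact (avg_mono hdrop).trans (hnone hn (Or.inl hKc) hZ)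
      -- A block without nodes shares no label, so a cluster of several blocks containing it is
      -- never linked.
      · have hbn : blockNodes A B none = ∅ := by
          rw [not_nonempty_iff_eq_empty, union_eq_empty] at hZ
          simp [blockNodes, hZ.1, hZ.2]
        have hnl : ∀ z, ¬ Linked (blockNodes A B) K z := by
          intro z hz
          have := hz {none} (singleton_subset_iff.2 hn) (singleton_nonempty _) (by
            intro i hi j hj ⟨a, ha, _⟩
            rw [mem_singleton.1 hi, hbn] at ha
            exact absurd ha (notMem_empty _))
          rw [← this, card_singleton] at hK2
          omega
        calc _ = avg (fun _ : Fin n → Fin n => (0 : ℝ)) := by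
              congr 1; funext z; rw [ind_of_false (hnl z), zero_mul]
          _ = 0 := avg_const 0
          _ ≤ _ := mul_nonneg (prod_nonneg fun j _ => hw0 j) (pow_nonneg hb.s_nonneg _)
    · have hmap : (eraseNone K).card = K.card := by
        rw [← card_map Function.Embedding.some, map_some_eraseNone, erase_eq_of_notMem hn]
      obtain ⟨c₀, hc₀⟩ : (eraseNone K).Nonempty := card_pos.1 (by omega)
      obtain ⟨c₁, hc₁, hne⟩ := exists_mem_ne (by omega : 1 < (eraseNone K).card) c₀
      have hfam : IsConnFamily (eraseNone K) := isConnFamily_pureBlocks.mono hK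
      -- The `linked` bound needs two nonempty edge sets of at most `D` edges, but the cluster may
      -- come entirely from one side. The blocks are node-disjoint, so the conditional moment is a
      -- product and does not depend on how they are distributed; one block can be moved to the
      -- other side.
      obtain ⟨K₁, K₂, hun, hd, h1n, h2n, h1D, h2D⟩ :
          ∃ K₁ K₂ : Finset (Finset (Sym2 (Fin n))), K₁ ∪ K₂ = eraseNone K ∧ Disjoint K₁ K₂ ∧
            K₁.Nonempty ∧ K₂.Nonempty ∧ (K₁.biUnion id).card ≤ D ∧ (K₂.biUnion id).card ≤ D := by
        have hsplit : ∀ A : Finset (Sym2 (Fin n)), A.card ≤ D → (∀ c ∈ eraseNone K, c ⊆ A) →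
            ∃ K₁ K₂ : Finset (Finset (Sym2 (Fin n))), K₁ ∪ K₂ = eraseNone K ∧ Disjoint K₁ K₂ ∧
            K₁.Nonempty ∧ K₂.Nonempty ∧ (K₁.biUnion id).card ≤ D ∧
              (K₂.biUnion id).card ≤ D := by
          intro A hAD hcA
          refine ⟨{c₀}, (eraseNone K).erase c₀, by rw [← insert_eq, insert_erase hc₀],
            disjoint_singleton_left.2 (notMem_erase _ _), singleton_nonempty _,
            ⟨c₁, mem_erase.2 ⟨hne, hc₁⟩⟩, hcard ?_ hAD, hcard ?_ hAD⟩
          · rw [singleton_biUnion]; exact hcA c₀ hc₀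
          · exact biUnion_subset.2 fun c hc => hcA c (mem_of_mem_erase hc)
        by_cases h1 : (eraseNone K ∩ purePart A B).Nonempty
        · by_cases h2 : (eraseNone K ∩ purePart B A).Nonempty
          · exact ⟨_, _, hKeq, purePart_disjoint.mono inter_subset_right inter_subset_right, h1,
              h2, hcard (subset_union_left.trans (hsub1 A B)) hAD,
              hcard (subset_union_left.trans (hsub1 B A)) hBD⟩
          · rw [not_nonempty_iff_eq_empty] at h2
            rw [h2, union_empty] at hKeq
            refine hsplit A hAD fun c hc => ?_
            rw [← hKeq] at hc
            exact subset_of_mem_comps (purePart_subset (mem_inter.1 hc).2)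
        · rw [not_nonempty_iff_eq_empty] at h1
          rw [h1, empty_union] at hKeq
          refine hsplit B hBD fun c hc => ?_
          rw [← hKeq] at hc
          exact subset_of_mem_comps (purePart_subset (mem_inter.1 hc).2)
      have hdec : PureDecomp K₁ K₂ ∅ ∅ := pureDecomp_empty (by rwa [hun]) hd
      have hcsub : ∀ c ∈ eraseNone K, c ⊆ allEdges n := by
        intro c hc
        rcases mem_union.1 (hK hc) with h | h
        · exact (subset_of_mem_comps (purePart_subset h)).trans hA
        · exact (subset_of_mem_comps (purePart_subset h)).trans hB
      have hne' : ∀ X ⊆ eraseNone K, X.Nonempty → (X.biUnion id ∪ ∅).Nonempty := by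
        rintro X hX ⟨c, hc⟩
        obtain ⟨e, he⟩ := (hfam.1 c (hX hc)).1
        exact ⟨e, mem_union_left _ (mem_biUnion.2 ⟨c, hc, he⟩)⟩
      have hs1 : K₁ ⊆ eraseNone K := hun ▸ subset_union_left
      have hs2 : K₂ ⊆ eraseNone K := hun ▸ subset_union_right
      have := hdec.avg_linked_le hb
        (by rw [union_empty]; exact biUnion_subset.2 fun c hc => hcsub c (hs1 hc))
        (by rw [union_empty]; exact biUnion_subset.2 fun c hc => hcsub c (hs2 hc))
        (hne' _ hs1 h1n) (hne' _ hs2 h2n) (by rwa [union_empty]) (by rwa [union_empty])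
        (Or.inl (h1n.mono subset_union_left)) K (blockNodes A B) hun.symm
        (by simp [hn]) (fun _ => rfl) (fun h => absurd h hn)
      rw [hun] at this
      refine (avg_mono hdrop).trans ?_
      simp only [prod_option K, if_neg hn, one_mul]
      have he : ∀ z, pairMom q Θ ∅ ∅ z = 1 := fun z => by simp [pairMom]
      simp only [he, mul_one] at this
      refine this.trans (le_of_eq ?_)
      simp [blockWeight]

end Clusters

/-! ### The decoupling bound for a pair of edge sets -/

section CenteredBlocks

variable {n D : ℕ} {q lam Λ κ s : ℝ} {Θ : Matrix (Fin n) (Fin n) ℝ}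
  {A B : Finset (Sym2 (Fin n))}

/-- All blocks of the pair `A`, `B`. -/
def allBlocks (A B : Finset (Sym2 (Fin n))) : Finset (Option (Finset (Sym2 (Fin n)))) :=
  insertNone (pureBlocks A B)

lemma pureDecomp_self : PureDecomp (purePart A B) (purePart B A) (restPart A B)
    (restPart B A) := by
  have h := pureDecomp_restPart (Subset.refl (pureBlocks A B))
  rwa [inter_eq_right.2 (show purePart A B ⊆ pureBlocks A B from subset_union_left),
    inter_eq_right.2 (show purePart B A ⊆ pureBlocks A B from subset_union_right)] at h

lemma card_symmDiff_eq : (A ∆ B).card =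
    ∑ c ∈ pureBlocks A B, c.card + (restPart A B ∆ restPart B A).card := by
  have h := (pureDecomp_self (A := A) (B := B)).card_symmDiff
  rwa [biUnion_purePart_union_restPart, biUnion_purePart_union_restPart] at h

/-- Simple edges, doubled edges and rank are all additive over the blocks, so the block weights
multiply to the bound for the whole pair. -/
lemma prod_blockWeight : ∏ j ∈ allBlocks A B, blockWeight lam q Λ κ A B j =
    Λ ^ (A ∆ B).card * pbar lam q ^ (A ∩ B).card * κ ^ rk (A ∆ B) := by
  have h1 := card_symmDiff_eq (A := A) (B := B)
  have h2 := (pureDecomp_self (A := A) (B := B)).rk_symmDiff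
  have h3 := (pureDecomp_self (A := A) (B := B)).inter_eq
  rw [biUnion_purePart_union_restPart, biUnion_purePart_union_restPart] at h2 h3
  rw [allBlocks, prod_insertNone, h1, h2, h3, pow_add, pow_add, ← prod_pow_eq_pow_sum,
    ← prod_pow_eq_pow_sum]
  simp only [blockWeight]
  rw [prod_mul_distrib, pureBlocks]
  ring

lemma disjoint_blockNodes {i j : Option (Finset (Sym2 (Fin n)))} (hi : i ∈ allBlocks A B)
    (hj : j ∈ allBlocks A B) (hne : i ≠ j) :
    Disjoint (blockNodes A B i) (blockNodes A B j) := by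
  have hdec := pureDecomp_self (A := A) (B := B)
  have key : ∀ c ∈ pureBlocks A B, Disjoint (verts c)
      (verts (restPart A B) ∪ verts (restPart B A)) := by
    intro c hc
    rw [disjoint_union_right]
    exact ⟨hdec.left c hc, hdec.right c hc⟩
  cases i with
  | none =>
    cases j with
    | none => exact absurd rfl hne
    | some c => exact (key c (some_mem_insertNone.1 hj)).symm
  | some c =>
    cases j with
    | none => exact key c (some_mem_insertNone.1 hi)
    | some c' =>
      exact isConnFamily_pureBlocks.2 c (some_mem_insertNone.1 hi) c'
        (some_mem_insertNone.1 hj) fun h => hne (congrArg some h)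

lemma biUnion_blockNodes_subset :
    (allBlocks A B).biUnion (blockNodes A B) ⊆ verts A ∪ verts B := by
  refine biUnion_subset.2 fun j hj => ?_
  cases j with
  | none => exact union_subset_union (verts_mono sdiff_subset) (verts_mono sdiff_subset)
  | some c =>
    rcases mem_union.1 (some_mem_insertNone.1 hj) with h | h
    · exact (verts_mono (subset_of_mem_comps (purePart_subset h))).trans subset_union_left
    · exact (verts_mono (subset_of_mem_comps (purePart_subset h))).trans subset_union_right

lemma card_pureBlocks_le : (pureBlocks A B).card ≤ (A ∆ B).card := by
  rw [card_symmDiff_eq]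
  refine le_trans ?_ (Nat.le_add_right _ _)
  rw [card_eq_sum_ones]
  exact sum_le_sum fun c hc => (isConnFamily_pureBlocks.1 c hc).1.card_pos

/-- Crude bound for the combinatorial factors. -/
lemma combinatorial_factor_le {D p L : ℕ} (hD : 2 ≤ D) (hpL : p ≤ L) (hL : L ≤ 2 * D) :
    (2 : ℝ) * (2 ^ p * (2 ^ p * (((p + 1 : ℕ) : ℝ) ^ (p + 1) *
      (1 + (4 * D : ℕ) : ℝ) ^ (2 * L)))) ≤ 2 * ((D : ℝ) ^ 16) ^ L := by
  have hD' : (2 : ℝ) ≤ D := by exact_mod_cast hD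
  have hD1 : (1 : ℝ) ≤ D := by linarith
  have h1 : (2 : ℝ) ^ p ≤ (D : ℝ) ^ L :=
    (pow_le_pow_left₀ (by norm_num) hD' p).trans (pow_le_pow_right₀ hD1 hpL)
  have h3 : (1 + (4 * D : ℕ) : ℝ) ^ (2 * L) ≤ (D : ℝ) ^ (8 * L) := by
    have : (1 + (4 * D : ℕ) : ℝ) ≤ (D : ℝ) ^ 4 := by
      push_cast
      have : (8 : ℝ) ≤ (D : ℝ) ^ 3 := by
        calc (8 : ℝ) = 2 ^ 3 := by norm_num
          _ ≤ (D : ℝ) ^ 3 := pow_le_pow_left₀ (by norm_num) hD' 3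
      nlinarith
    calc (1 + (4 * D : ℕ) : ℝ) ^ (2 * L) ≤ ((D : ℝ) ^ 4) ^ (2 * L) :=
          pow_le_pow_left₀ (by positivity) this _
      _ = (D : ℝ) ^ (8 * L) := by rw [← pow_mul]; congr 1; ring
  have h2 : ((p + 1 : ℕ) : ℝ) ^ (p + 1) ≤ (D : ℝ) ^ (6 * L) := by
    rcases Nat.eq_zero_or_pos L with h0 | hpos
    · have : p = 0 := by omega
      subst this; subst h0; norm_num
    · have : ((p + 1 : ℕ) : ℝ) ≤ (D : ℝ) ^ 3 := by
        have h4 : ((p + 1 : ℕ) : ℝ) ≤ 2 * D + 1 := by exact_mod_cast (by omega)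
        have h5 : (4 : ℝ) ≤ (D : ℝ) ^ 2 := by nlinarith
        nlinarith
      calc ((p + 1 : ℕ) : ℝ) ^ (p + 1) ≤ ((D : ℝ) ^ 3) ^ (p + 1) :=
            pow_le_pow_left₀ (by positivity) this _
        _ = (D : ℝ) ^ (3 * (p + 1)) := by rw [← pow_mul]
        _ ≤ (D : ℝ) ^ (6 * L) := pow_le_pow_right₀ hD1 (by omega)
  refine mul_le_mul_of_nonneg_left ?_ (by norm_num)
  calc (2 : ℝ) ^ p * (2 ^ p * (((p + 1 : ℕ) : ℝ) ^ (p + 1) * (1 + (4 * D : ℕ) : ℝ) ^ (2 * L)))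
      ≤ (D : ℝ) ^ L * ((D : ℝ) ^ L * ((D : ℝ) ^ (6 * L) * (D : ℝ) ^ (8 * L))) := by gcongr
    _ = ((D : ℝ) ^ 16) ^ L := by rw [← pow_add, ← pow_add, ← pow_add, ← pow_mul]; congr 1; ring

/-- The decoupling bound: each centered pure component gains a factor `s = n^{-1/2}`. -/
theorem abs_permAvg_centered_le (hb : MomentBounds n D q lam Λ κ s Θ) (hlam : 0 ≤ lam)
    (hD : 2 ≤ D) (hn : 32 * D ^ 2 ≤ n)
    (hA : A ⊆ allEdges n) (hB : B ⊆ allEdges n) (hAD : A.card ≤ D) (hBD : B.card ≤ D)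
    (P : Finset (Finset (Sym2 (Fin n)))) (hP : P ⊆ pureBlocks A B) :
    |permAvg fun z => (pairMom q Θ (restPart A B) (restPart B A) z *
        ∏ c ∈ pureBlocks A B \ P, pairMom q Θ c ∅ z) *
        ∏ c ∈ P, (pairMom q Θ c ∅ z - permAvg (pairMom q Θ c ∅))| ≤
      2 * ((D : ℝ) ^ 16 * Λ) ^ (A ∆ B).card * pbar lam q ^ (A ∩ B).card * κ ^ rk (A ∆ B) *
        s ^ P.card := by
  classical
  set b := blockNodes A B with hbdef
  set f := blockFun q Θ A B with hfdef
  set W := blockWeight lam q Λ κ A B with hWdef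
  set J₀ : Finset (Option (Finset (Sym2 (Fin n)))) := insertNone (pureBlocks A B \ P) with hJ₀
  set P' : Finset (Option (Finset (Sym2 (Fin n)))) := P.map Function.Embedding.some with hP'
  have hf0 : ∀ j z, 0 ≤ f j z := blockFun_nonneg hb
  have hw0 : ∀ j, 0 ≤ W j := blockWeight_nonneg hb hlam
  have hdJP : Disjoint J₀ P' := by
    refine disjoint_left.2 fun j hj hj' => ?_
    obtain ⟨c, hc, rfl⟩ := mem_map.1 hj'
    exact (mem_sdiff.1 (some_mem_insertNone.1 hj)).2 hc
  have hJP : J₀ ∪ P' = allBlocks A B := by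
    ext j
    cases j with
    | none => simp [hJ₀, allBlocks]
    | some c =>
      simp only [hJ₀, hP', allBlocks, mem_union, some_mem_insertNone, mem_sdiff, mem_map,
        Function.Embedding.some_apply, Option.some.injEq, exists_eq_right]
      constructor
      · rintro (h | h)
        exacts [h.1, hP h]
      · intro h
        by_cases h' : c ∈ P
        exacts [Or.inr h', Or.inl ⟨h, h'⟩]
  have hJall : J₀ ⊆ allBlocks A B := hJP ▸ subset_union_left
  have hPall : P' ⊆ allBlocks A B := hJP ▸ subset_union_right
  have hPcard : P'.card = P.card := card_map _
  set B₀ := J₀.biUnion b with hB₀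
  set V := B₀ ∪ P'.biUnion b with hV
  have hVeq : V = (allBlocks A B).biUnion b := by rw [hV, hB₀, ← Finset.union_biUnion, hJP]
  have hVcard : V.card ≤ 4 * D := by
    rw [hVeq]
    refine (card_le_card biUnion_blockNodes_subset).trans ((card_union_le _ _).trans ?_)
    have h1 := card_verts_le (F := A)
    have h2 := card_verts_le (F := B)
    omega
  have hx0 : ∀ j, 0 ≤ permAvg (f j) := fun j => permAvg_nonneg (hf0 j)
  have hcsub : ∀ c ∈ P, c ⊆ allEdges n ∧ c.card ≤ D ∧ c.Nonempty := by
    intro c hc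
    have hne := (isConnFamily_pureBlocks.1 c (hP hc)).1
    rcases mem_union.1 (hP hc) with h | h
    · have h := subset_of_mem_comps (purePart_subset h)
      exact ⟨h.trans hA, (card_le_card h).trans hAD, hne⟩
    · have h := subset_of_mem_comps (purePart_subset h)
      exact ⟨h.trans hB, (card_le_card h).trans hBD, hne⟩
  have hxW : ∀ j ∈ P', permAvg (f j) ≤ W j := by
    intro j hj
    obtain ⟨c, hc, rfl⟩ := mem_map.1 hj
    obtain ⟨h1, h2, h3⟩ := hcsub c hc
    exact hb.moment c h1 h3 h2
  have hclaim := permAvg_centered_le P' b B₀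
    (fun i hi j hj hne => disjoint_blockNodes (hPall hi) (hPall hj) hne)
    (fun i hi => by
      rw [hB₀, disjoint_biUnion_right]
      exact fun j hj => disjoint_blockNodes (hPall hi) (hJall hj)
        fun h => disjoint_left.1 hdJP (h ▸ hj) hi)
    f (fun z => ∏ j ∈ J₀, f j z) (fun i _ => dependsOn_blockFun i)
    (dependsOn_prod _ fun j hj => dependsOn_mono (dependsOn_blockFun j)
      (subset_biUnion_of_mem b hj))
    (fun i _ z => hf0 i z) (fun z => prod_nonneg fun j _ => hf0 j z)
  have hrw : (fun z => (pairMom q Θ (restPart A B) (restPart B A) z *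
        ∏ c ∈ pureBlocks A B \ P, pairMom q Θ c ∅ z) *
        ∏ c ∈ P, (pairMom q Θ c ∅ z - permAvg (pairMom q Θ c ∅))) =
      fun z => (∏ j ∈ J₀, f j z) * ∏ i ∈ P', (f i z - permAvg (f i)) := by
    funext z
    rw [hJ₀, prod_insertNone, hP', prod_map]
    rfl
  rw [hrw]
  -- At most `4 D` nodes are involved, so two labels coincide with probability at most `16 D² / n ≤
  -- 1/2`. Conditioning on distinct labels then costs only a factor two.
  have hc : (1 : ℝ) / 2 ≤ avg (injInd V) := by
    have hnpos : 0 < n := lt_of_lt_of_le (by positivity) hn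
    refine le_trans ?_ (one_sub_le_avg_injInd hnpos V)
    have hn' : (32 : ℝ) * D ^ 2 ≤ n := by exact_mod_cast hn
    have hn0 : (0 : ℝ) < n := by exact_mod_cast hnpos
    have hV' : (V.card : ℝ) ≤ 4 * D := by exact_mod_cast hVcard
    have : (V.card : ℝ) ^ 2 / n ≤ 1 / 2 := by
      rw [div_le_iff₀ hn0]
      nlinarith [pow_le_pow_left₀ (Nat.cast_nonneg _) hV' 2]
    linarith
  set p := (pureBlocks A B).card with hp
  set L := (A ∆ B).card with hL
  have hs0 := hb.s_nonneg
  set M : ℝ := ((p + 1 : ℕ) : ℝ) ^ (p + 1) * (1 + (4 * D : ℕ) : ℝ) ^ (2 * L) with hM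
  have hWall0 : 0 ≤ ∏ j ∈ allBlocks A B, W j := prod_nonneg fun j _ => hw0 j
  -- In the expansion of the product of `f i + permAvg (f i)`, the blocks in `T` keep their
  -- function. The others become constants and are the free blocks of `avg_prod_hits_le`: they still
  -- have to meet another block.
  have hterm : ∀ T ∈ P'.powerset,
      avg (fun z => injInd B₀ z * (∏ i ∈ P', injInd (b i) z) *
        ind (∀ i ∈ P', Hits z (b i) (V \ b i)) *
        ((∏ j ∈ J₀, f j z) * ((∏ i ∈ T, f i z) * ∏ i ∈ P' \ T, permAvg (f i)))) ≤
      M * (∏ j ∈ allBlocks A B, W j) * s ^ P.card := by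
    intro T hT
    rw [mem_powerset] at hT
    have hJT : Disjoint J₀ T := hdJP.mono_right hT
    have hJTF : Disjoint (J₀ ∪ T) (P' \ T) := disjoint_union_left.2
      ⟨hdJP.mono_right sdiff_subset, disjoint_sdiff⟩
    have hJTFeq : (J₀ ∪ T) ∪ (P' \ T) = allBlocks A B := by
      rw [union_assoc, union_sdiff_of_subset hT, hJP]
    have hTF : T ∪ P' \ T = P' := union_sdiff_of_subset hT
    have hT0 : none ∉ T := fun h => by
      obtain ⟨c, _, hc⟩ := mem_map.1 (hT h)
      exact absurd hc (by simp)
    have h2 := avg_prod_hits_le (J₀ ∪ T) (P' \ T) T hJTF subset_union_right b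
      (fun i hi j hj hne => disjoint_blockNodes (hJTFeq ▸ hi) (hJTFeq ▸ hj) hne) f
      (fun i _ => dependsOn_blockFun i) (fun i _ z => hf0 i z) W hb.s_nonneg hb.s_le hb.sq_mul
      (fun K hK hKn => avg_linked_blocks_le hb hlam hA hB hAD hBD T hT0 K (fun c hc => by
        have h3 : some c ∈ allBlocks A B := hJTFeq ▸ mem_union_left _ (hK (mem_eraseNone.1 hc))
        exact some_mem_insertNone.1 h3) hKn)
      (N := 4 * D) (by rw [hJTFeq, ← hVeq]; exact hVcard)
    rw [hJTFeq, hTF, ← hVeq] at h2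
    have hxF0 : 0 ≤ ∏ i ∈ P' \ T, permAvg (f i) := prod_nonneg fun i _ => hx0 i
    have hcardJ : (J₀ ∪ T).card ≤ p + 1 := by
      have : J₀ ∪ T ⊆ allBlocks A B := hJTFeq ▸ subset_union_left
      refine (card_le_card this).trans ?_
      rw [allBlocks, card_insertNone]
    have hcardF : ((P' \ T).biUnion b).card ≤ 2 * L := by
      calc ((P' \ T).biUnion b).card ≤ (P'.biUnion b).card :=
            card_le_card (biUnion_subset_biUnion_of_subset_left _ sdiff_subset)
        _ ≤ ∑ i ∈ P', (b i).card := card_biUnion_le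
        _ = ∑ c ∈ P, (verts c).card := by rw [hP', sum_map]; rfl
        _ ≤ ∑ c ∈ P, 2 * c.card := sum_le_sum fun c _ => card_verts_le
        _ ≤ ∑ c ∈ pureBlocks A B, 2 * c.card :=
            sum_le_sum_of_subset_of_nonneg hP fun _ _ _ => Nat.zero_le _
        _ ≤ 2 * L := by rw [← mul_sum, hL, card_symmDiff_eq]; omega
    have hpow1 : ((J₀ ∪ T).card : ℝ) ^ (J₀ ∪ T).card ≤ ((p + 1 : ℕ) : ℝ) ^ (p + 1) := by
      exact_mod_cast (Nat.pow_le_pow_left hcardJ _).trans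
        (Nat.pow_le_pow_right (Nat.succ_pos _) hcardJ)
    have hpow2 : (1 + (4 * D : ℕ) : ℝ) ^ ((P' \ T).biUnion b).card ≤
        (1 + (4 * D : ℕ) : ℝ) ^ (2 * L) :=
      pow_le_pow_right₀ (by simp) hcardF
    have hWJ0 : 0 ≤ ∏ j ∈ J₀ ∪ T, W j := prod_nonneg fun j _ => hw0 j
    calc avg (fun z => injInd B₀ z * (∏ i ∈ P', injInd (b i) z) *
        ind (∀ i ∈ P', Hits z (b i) (V \ b i)) *
        ((∏ j ∈ J₀, f j z) * ((∏ i ∈ T, f i z) * ∏ i ∈ P' \ T, permAvg (f i))))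
        ≤ avg (fun z => (∏ i ∈ P' \ T, permAvg (f i)) *
            ((∏ j ∈ J₀ ∪ T, (injInd (b j) z * f j z)) *
              ind (∀ i ∈ P', Hits z (b i) (V \ b i)))) := by
          refine avg_mono fun z => ?_
          have e1 : injInd B₀ z ≤ ∏ j ∈ J₀, injInd (b j) z := by
            by_cases hz : Set.InjOn z B₀
            · refine (ind_le_one _).trans (le_of_eq (prod_eq_one fun j hj => ?_).symm)
              exact ind_of_true (hz.mono (subset_biUnion_of_mem b hj))
            · rw [injInd, ind_of_false hz]
              exact prod_nonneg fun j _ => injInd_nonneg _ _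
          have e2 : ∏ i ∈ P', injInd (b i) z ≤ ∏ i ∈ T, injInd (b i) z := by
            rw [← prod_sdiff hT]
            exact mul_le_of_le_one_left (prod_nonneg fun i _ => injInd_nonneg _ _)
              (prod_le_one (fun i _ => injInd_nonneg _ _) fun i _ => ind_le_one _)
          have e3 : injInd B₀ z * ∏ i ∈ P', injInd (b i) z ≤
              (∏ j ∈ J₀, injInd (b j) z) * ∏ i ∈ T, injInd (b i) z :=
            mul_le_mul e1 e2 (prod_nonneg fun i _ => injInd_nonneg _ _)
              (prod_nonneg fun i _ => injInd_nonneg _ _)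
          have e4 : 0 ≤ ind (∀ i ∈ P', Hits z (b i) (V \ b i)) *
              ((∏ j ∈ J₀, f j z) * ((∏ i ∈ T, f i z) * ∏ i ∈ P' \ T, permAvg (f i))) :=
            mul_nonneg (ind_nonneg _) (mul_nonneg (prod_nonneg fun j _ => hf0 j z)
              (mul_nonneg (prod_nonneg fun j _ => hf0 j z) hxF0))
          rw [prod_union hJT, prod_mul_distrib, prod_mul_distrib]
          calc _ = (injInd B₀ z * ∏ i ∈ P', injInd (b i) z) *
              (ind (∀ i ∈ P', Hits z (b i) (V \ b i)) *
              ((∏ j ∈ J₀, f j z) * ((∏ i ∈ T, f i z) * ∏ i ∈ P' \ T, permAvg (f i)))) := by ring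
            _ ≤ _ := mul_le_mul_of_nonneg_right e3 e4
            _ = _ := by ring
      _ = (∏ i ∈ P' \ T, permAvg (f i)) *
            avg (fun z => (∏ j ∈ J₀ ∪ T, (injInd (b j) z * f j z)) *
              ind (∀ i ∈ P', Hits z (b i) (V \ b i))) := avg_mul_left _ _
      _ ≤ (∏ i ∈ P' \ T, W i) * (((J₀ ∪ T).card : ℝ) ^ (J₀ ∪ T).card *
            (1 + (4 * D : ℕ) : ℝ) ^ ((P' \ T).biUnion b).card * (∏ j ∈ J₀ ∪ T, W j) *
            s ^ (T.card + (P' \ T).card)) := by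
          refine mul_le_mul (prod_le_prod (fun i _ => hx0 i)
            fun i hi => hxW i (mem_sdiff.1 hi).1) h2 (avg_nonneg fun z => ?_)
            (prod_nonneg fun i _ => hw0 i)
          exact mul_nonneg (prod_nonneg fun j _ => mul_nonneg (injInd_nonneg _ _) (hf0 j z))
            (ind_nonneg _)
      _ ≤ (∏ i ∈ P' \ T, W i) * (((p + 1 : ℕ) : ℝ) ^ (p + 1) *
            (1 + (4 * D : ℕ) : ℝ) ^ (2 * L) * (∏ j ∈ J₀ ∪ T, W j) *
            s ^ (T.card + (P' \ T).card)) := by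
          refine mul_le_mul_of_nonneg_left ?_ (prod_nonneg fun i _ => hw0 i)
          gcongr
      _ = _ := by
          have e5 : T.card + (P' \ T).card = P.card := by
            rw [← hPcard, card_sdiff_of_subset hT]
            have := card_le_card hT
            omega
          rw [e5, ← hJTFeq, prod_union hJTF]
          ring
  have hsum : avg (fun z => injInd B₀ z * (∏ i ∈ P', injInd (b i) z) *
        ind (∀ i ∈ P', Hits z (b i) (V \ b i)) *
        ((∏ j ∈ J₀, f j z) * ∏ i ∈ P', (f i z + permAvg (f i)))) ≤
      2 ^ P.card * (M * (∏ j ∈ allBlocks A B, W j) * s ^ P.card) := by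
    simp only [prod_add, mul_sum]
    rw [avg_sum]
    refine (sum_le_sum hterm).trans (le_of_eq ?_)
    rw [sum_const, card_powerset, hPcard, nsmul_eq_mul]
    norm_num
  rw [hPcard] at hclaim
  -- One factor `2 ^ P.card` comes from the inclusion-exclusion, the other from the expansion over
  -- `T`; the leading `2` undoes the conditioning.
  have hfin : |permAvg fun z => (∏ j ∈ J₀, f j z) * ∏ i ∈ P', (f i z - permAvg (f i))| ≤
      2 * (2 ^ P.card * (2 ^ P.card * (M * (∏ j ∈ allBlocks A B, W j) * s ^ P.card))) := by
    have h1 := hclaim.trans (mul_le_mul_of_nonneg_left hsum (by positivity))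
    have h2 := mul_le_mul_of_nonneg_right hc
      (abs_nonneg (permAvg fun z => (∏ j ∈ J₀, f j z) * ∏ i ∈ P', (f i z - permAvg (f i))))
    linarith
  refine hfin.trans ?_
  have hPp : P.card ≤ p := card_le_card hP
  have hpL : p ≤ L := card_pureBlocks_le
  have hL2 : L ≤ 2 * D := by
    have h1 : L ≤ (A ∪ B).card := card_le_card symmDiff_le_sup
    have h2 := card_union_le A B
    omega
  have hfac := combinatorial_factor_le hD hpL hL2
  have h2P : (2 : ℝ) ^ P.card ≤ 2 ^ p := pow_le_pow_right₀ (by norm_num) hPp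
  have hM0 : 0 ≤ M := by positivity
  rw [← hM] at hfac
  calc 2 * (2 ^ P.card * (2 ^ P.card * (M * (∏ j ∈ allBlocks A B, W j) * s ^ P.card)))
      ≤ 2 * (2 ^ p * (2 ^ p * (M * (∏ j ∈ allBlocks A B, W j) * s ^ P.card))) := by gcongr
    _ = (2 * (2 ^ p * (2 ^ p * M))) * ((∏ j ∈ allBlocks A B, W j) * s ^ P.card) := by ring
    _ ≤ (2 * ((D : ℝ) ^ 16) ^ L) * ((∏ j ∈ allBlocks A B, W j) * s ^ P.card) := by gcongr
    _ = _ := by rw [prod_blockWeight, mul_pow]; ring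

end CenteredBlocks

section Covariances

/- ### Covariances of the centered monomials -/

variable {n D : ℕ} {q lam Λ κ s : ℝ} {Θ : Matrix (Fin n) (Fin n) ℝ}
  {H H₁ H₂ : Finset (Sym2 (Fin n))} {A A₁ A₂ : Finset (Finset (Sym2 (Fin n)))}

/-- The mean of the monomial of an edge set. -/
def meanMom (q : ℝ) (Θ : Matrix (Fin n) (Fin n) ℝ) (c : Finset (Sym2 (Fin n))) : ℝ :=
  permAvg (pairMom q Θ c ∅)

/-- The product of the centered monomials of the components of an edge set. -/
def centeredEdgePoly (q : ℝ) (Θ : Matrix (Fin n) (Fin n) ℝ) (F S : Finset (Sym2 (Fin n))) : ℝ :=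
  ∏ c ∈ comps F, (edgePoly q c S - meanMom q Θ c)

/-- The edge set that is left when the components in `A` are removed. -/
def survivors (H : Finset (Sym2 (Fin n))) (A : Finset (Finset (Sym2 (Fin n)))) :
    Finset (Sym2 (Fin n)) := (comps H \ A).biUnion id

lemma comps_survivors : comps (survivors H A) = comps H \ A :=
  comps_biUnion (isConnFamily_comps.mono sdiff_subset)

lemma survivors_subset : survivors H A ⊆ H := by
  conv_rhs => rw [← biUnion_comps (F := H)]
  exact biUnion_subset_biUnion_of_subset_left _ sdiff_subset

lemma survivors_union (hA : A ⊆ comps H) : survivors H A ∪ A.biUnion id = H := by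
  rw [survivors, ← Finset.union_biUnion, sdiff_union_of_subset hA, biUnion_comps]

lemma vdisj_survivors (hA : A ⊆ comps H) : VDisj (survivors H A) (A.biUnion id) := by
  rw [survivors, vdisj_biUnion_left]
  intro c hc
  rw [vdisj_biUnion_right]
  intro c' hc'
  refine comps_vdisj (mem_sdiff.1 hc).1 (hA hc') fun h => (mem_sdiff.1 hc).2 (h ▸ hc')

lemma card_survivors_add (hA : A ⊆ comps H) :
    (survivors H A).card + (A.biUnion id).card = H.card := by
  rw [← card_union_of_disjoint (vdisj_survivors hA).disjoint, survivors_union hA]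

/-- The nonpure components of `H₁`, relative to `H₂`. -/
def mixedPart (H₁ H₂ : Finset (Sym2 (Fin n))) : Finset (Finset (Sym2 (Fin n))) :=
  comps H₁ \ purePart H₁ H₂

lemma mixedPart_subset : mixedPart H₁ H₂ ⊆ comps H₁ := sdiff_subset

/-- Replacing nonpure components by means leaves the original pure components pure, although further
components may become pure. -/
lemma purePart_subset_survivors (hA₁ : A₁ ⊆ mixedPart H₁ H₂) :
    purePart H₁ H₂ ⊆ purePart (survivors H₁ A₁) (survivors H₂ A₂) := by
  intro c hc
  have h := mem_purePart.1 hc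
  rw [mem_purePart, comps_survivors]
  exact ⟨mem_sdiff.2 ⟨h.1, fun h' => (mem_sdiff.1 (hA₁ h')).2 hc⟩,
    h.2.mono Subset.rfl survivors_subset⟩

lemma pureBlocks_subset_survivors (hA₁ : A₁ ⊆ mixedPart H₁ H₂) (hA₂ : A₂ ⊆ mixedPart H₂ H₁) :
    pureBlocks H₁ H₂ ⊆ pureBlocks (survivors H₁ A₁) (survivors H₂ A₂) :=
  union_subset_union (purePart_subset_survivors hA₁) (purePart_subset_survivors hA₂)

/-- The nonpure components that survive split into those that have become pure, through removals on
the other side, and the new rest part. -/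
lemma biUnion_mixedPart_sdiff (hA₁ : A₁ ⊆ mixedPart H₁ H₂) :
    (mixedPart H₁ H₂ \ A₁).biUnion id =
      ((pureBlocks (survivors H₁ A₁) (survivors H₂ A₂) \ pureBlocks H₁ H₂) ∩
        purePart (survivors H₁ A₁) (survivors H₂ A₂)).biUnion id ∪
      restPart (survivors H₁ A₁) (survivors H₂ A₂) := by
  set R₁ := survivors H₁ A₁
  set R₂ := survivors H₂ A₂
  have hsub : purePart H₁ H₂ ⊆ purePart R₁ R₂ := purePart_subset_survivors hA₁
  have hcR : comps R₁ = comps H₁ \ A₁ := comps_survivors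
  have hne : ∀ c ∈ mixedPart H₁ H₂, c ∉ pureBlocks H₁ H₂ := by
    intro c hc h
    rcases mem_union.1 h with h | h
    · exact (mem_sdiff.1 hc).2 h
    · exact not_vdisj_self (nonempty_of_mem_comps (mem_sdiff.1 hc).1)
        ((mem_purePart.1 h).2.mono Subset.rfl (subset_of_mem_comps (mem_sdiff.1 hc).1))
  ext e
  simp only [mem_union, mem_biUnion, id, restPart]
  constructor
  · rintro ⟨c, hc, he⟩
    rw [mem_sdiff] at hc
    have hcR1 : c ∈ comps R₁ := by
      rw [hcR, mem_sdiff]; exact ⟨mixedPart_subset hc.1, hc.2⟩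
    by_cases hp : c ∈ purePart R₁ R₂
    · exact Or.inl ⟨c, mem_inter.2 ⟨mem_sdiff.2 ⟨mem_union_left _ hp, hne c hc.1⟩, hp⟩, he⟩
    · refine Or.inr (mem_sdiff.2 ⟨subset_of_mem_comps hcR1 he, fun h => ?_⟩)
      obtain ⟨c', hc', he'⟩ := mem_biUnion.1 h
      have := comps_vdisj hcR1 (purePart_subset hc') fun h => hp (h ▸ hc')
      exact disjoint_left.1 this.disjoint he he'
  · rintro (⟨c, hc, he⟩ | he)
    · rw [mem_inter, mem_sdiff] at hc
      have h := purePart_subset hc.2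
      rw [hcR, mem_sdiff] at h
      exact ⟨c, mem_sdiff.2 ⟨mem_sdiff.2 ⟨h.1, fun h' => hc.1.2 (mem_union_left _ h')⟩, h.2⟩, he⟩
    · rw [mem_sdiff] at he
      obtain ⟨c, hc, hec⟩ := exists_comp he.1
      have h := hc
      rw [hcR, mem_sdiff] at h
      refine ⟨c, mem_sdiff.2 ⟨mem_sdiff.2 ⟨h.1, fun h' => he.2 ?_⟩, h.2⟩, hec⟩
      exact mem_biUnion.2 ⟨c, hsub h', hec⟩

/-- Brings a term of the expansion into the form of `abs_permAvg_centered_le` for the survivors: the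
originally pure components are the centered ones, the newly pure ones are uncentered. -/
lemma pairMom_mixed (hA₁ : A₁ ⊆ mixedPart H₁ H₂) (hA₂ : A₂ ⊆ mixedPart H₂ H₁)
    (z : Fin n → Fin n) :
    pairMom q Θ ((mixedPart H₁ H₂ \ A₁).biUnion id) ((mixedPart H₂ H₁ \ A₂).biUnion id) z =
      pairMom q Θ (restPart (survivors H₁ A₁) (survivors H₂ A₂))
          (restPart (survivors H₂ A₂) (survivors H₁ A₁)) z *
        ∏ c ∈ pureBlocks (survivors H₁ A₁) (survivors H₂ A₂) \ pureBlocks H₁ H₂,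
          pairMom q Θ c ∅ z := by
  have hd := pureDecomp_restPart (A := survivors H₁ A₁) (B := survivors H₂ A₂)
    (K := pureBlocks (survivors H₁ A₁) (survivors H₂ A₂) \ pureBlocks H₁ H₂) sdiff_subset
  have h2 := biUnion_mixedPart_sdiff (A₂ := A₁) hA₂
  rw [pureBlocks, union_comm (purePart (survivors H₂ A₂) _), ← pureBlocks,
    show pureBlocks H₂ H₁ = pureBlocks H₁ H₂ from union_comm _ _] at h2
  rw [biUnion_mixedPart_sdiff (A₂ := A₂) hA₁, h2, hd.pairMom_eq, mul_comm]
  congr 1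
  rw [← inter_union_distrib_left, ← pureBlocks, inter_eq_left.2 sdiff_subset]

/-- The term of the expansion of `E[P̄₁ P̄₂]` in which the nonpure components in `A₁` and `A₂`
are replaced by their means. -/
def covTerm (q : ℝ) (Θ : Matrix (Fin n) (Fin n) ℝ) (H₁ H₂ : Finset (Sym2 (Fin n)))
    (A₁ A₂ : Finset (Finset (Sym2 (Fin n)))) : ℝ :=
  (∏ c ∈ A₁, -meanMom q Θ c) * (∏ c ∈ A₂, -meanMom q Θ c) *
    permAvg fun z => pairMom q Θ ((mixedPart H₁ H₂ \ A₁).biUnion id)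
      ((mixedPart H₂ H₁ \ A₂).biUnion id) z *
      ∏ c ∈ pureBlocks H₁ H₂, (pairMom q Θ c ∅ z - meanMom q Θ c)

/-- Only the nonpure components are expanded; the pure ones must stay centered in order to gain the
factor `s`. -/
lemma centeredEdgePoly_eq_sum (S : Finset (Sym2 (Fin n))) :
    centeredEdgePoly q Θ H₁ S = ∑ A ∈ (mixedPart H₁ H₂).powerset,
      (∏ c ∈ A, -meanMom q Θ c) * (edgePoly q ((mixedPart H₁ H₂ \ A).biUnion id) S *
        ∏ c ∈ purePart H₁ H₂, (edgePoly q c S - meanMom q Θ c)) := by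
  rw [centeredEdgePoly, ← prod_sdiff (purePart_subset (A := H₁) (B := H₂))]
  have h : ∀ c ∈ comps H₁ \ purePart H₁ H₂, edgePoly q c S - meanMom q Θ c =
      -meanMom q Θ c + edgePoly q c S := fun c _ => by ring
  rw [prod_congr rfl h, prod_add, sum_mul]
  refine sum_congr rfl fun A _ => ?_
  rw [mul_assoc]
  congr 2
  rw [edgePoly, prod_biUnion]
  · rfl
  · intro c hc c' hc' hne
    exact (comps_vdisj (mixedPart_subset (mem_sdiff.1 hc).1) (mixedPart_subset (mem_sdiff.1 hc').1)
      hne).disjoint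

lemma biUnion_subset_of_subset_comps (hA : A ⊆ comps H) : A.biUnion id ⊆ H :=
  biUnion_subset.2 fun _ hc => subset_of_mem_comps (hA hc)

lemma pureBlocks_subset_allEdges (h₁ : H₁ ⊆ allEdges n) (h₂ : H₂ ⊆ allEdges n)
    {c : Finset (Sym2 (Fin n))} (hc : c ∈ pureBlocks H₁ H₂) : c ⊆ allEdges n := by
  rcases mem_union.1 hc with h | h
  · exact (subset_of_mem_comps (purePart_subset h)).trans h₁
  · exact (subset_of_mem_comps (purePart_subset h)).trans h₂

lemma vdisj_pureBlocks_mixed {c : Finset (Sym2 (Fin n))} (hc : c ∈ purePart H₁ H₂)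
    {c' : Finset (Sym2 (Fin n))} (hc' : c' ∈ mixedPart H₁ H₂ ∪ mixedPart H₂ H₁) : VDisj c c' := by
  rw [mem_purePart] at hc
  rcases mem_union.1 hc' with h | h
  · refine comps_vdisj hc.1 (mixedPart_subset h) ?_
    rintro rfl
    exact (mem_sdiff.1 h).2 (mem_purePart.2 hc)
  · exact hc.2.mono Subset.rfl (subset_of_mem_comps (mixedPart_subset h))

/-- The pure components share no edge with each other or with the nonpure ones, so given the labels
their centered factors split off. -/
lemma permExpect_centered_mul (h₁ : H₁ ⊆ allEdges n) (h₂ : H₂ ⊆ allEdges n) :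
    permExpect q Θ (fun S => centeredEdgePoly q Θ H₁ S * centeredEdgePoly q Θ H₂ S) =
      ∑ A ∈ (mixedPart H₁ H₂).powerset ×ˢ (mixedPart H₂ H₁).powerset,
        covTerm q Θ H₁ H₂ A.1 A.2 := by
  have hrw : (fun S => centeredEdgePoly q Θ H₁ S * centeredEdgePoly q Θ H₂ S) = fun S =>
      ∑ A ∈ (mixedPart H₁ H₂).powerset ×ˢ (mixedPart H₂ H₁).powerset,
        ((∏ c ∈ A.1, -meanMom q Θ c) * (∏ c ∈ A.2, -meanMom q Θ c)) *
        ((∏ e ∈ allEdges n, centeredAdj q S e ^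
          pairMult ((mixedPart H₁ H₂ \ A.1).biUnion id) ((mixedPart H₂ H₁ \ A.2).biUnion id) e) *
        ∏ c ∈ pureBlocks H₁ H₂, (edgePoly q c S - meanMom q Θ c)) := by
    funext S
    rw [centeredEdgePoly_eq_sum (H₁ := H₁) (H₂ := H₂), centeredEdgePoly_eq_sum (H₁ := H₂)
      (H₂ := H₁), sum_mul_sum, sum_product]
    refine sum_congr rfl fun A hA => sum_congr rfl fun B hB => ?_
    rw [← edgePoly_mul, pureBlocks, prod_union purePart_disjoint]
    · ring
    · exact (biUnion_subset_of_subset_comps (sdiff_subset.trans mixedPart_subset)).trans h₁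
    · exact (biUnion_subset_of_subset_comps (sdiff_subset.trans mixedPart_subset)).trans h₂
  rw [hrw, permExpect_sum]
  refine sum_congr rfl fun A hA => ?_
  rw [permExpect_mul_left, covTerm, permExpect_eq]
  congr 2
  funext z
  rw [condExpect_mul_prod_sub, prod_edgeMom_pairMult]
  · exact (biUnion_subset_of_subset_comps (sdiff_subset.trans mixedPart_subset)).trans h₁
  · exact (biUnion_subset_of_subset_comps (sdiff_subset.trans mixedPart_subset)).trans h₂
  · exact fun c hc => pureBlocks_subset_allEdges h₁ h₂ hc
  · exact fun c hc c' hc' hne => (isConnFamily_pureBlocks.2 c hc c' hc' hne).disjoint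
  · intro c hc e he
    have key : ∀ c' ∈ mixedPart H₁ H₂ ∪ mixedPart H₂ H₁, e ∉ c' := by
      intro c' hc' he'
      rcases mem_union.1 hc with h | h
      · exact disjoint_left.1 (vdisj_pureBlocks_mixed h hc').disjoint he he'
      · rw [union_comm] at hc'
        exact disjoint_left.1 (vdisj_pureBlocks_mixed h hc').disjoint he he'
    rw [pairMult, if_neg, if_neg]
    · rw [mem_biUnion]
      rintro ⟨c', hc', he'⟩
      exact key c' (mem_union_right _ (mem_sdiff.1 hc').1) he'
    · rw [mem_biUnion]
      rintro ⟨c', hc', he'⟩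
      exact key c' (mem_union_left _ (mem_sdiff.1 hc').1) he'

lemma meanMom_nonneg (hb : MomentBounds n D q lam Λ κ s Θ) (c : Finset (Sym2 (Fin n))) :
    0 ≤ meanMom q Θ c :=
  permAvg_nonneg fun _ => pairMom_nonneg hb.q_nonneg hb.q_le hb.signal_mem

lemma abs_prod_meanMom_le (hb : MomentBounds n D q lam Λ κ s Θ) (hH : H ⊆ allEdges n)
    (hHD : H.card ≤ D) (hA : A ⊆ comps H) :
    |∏ c ∈ A, -meanMom q Θ c| ≤ Λ ^ (A.biUnion id).card * κ ^ rk (A.biUnion id) := by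
  have hfam : IsConnFamily A := isConnFamily_comps.mono hA
  rw [abs_prod, hfam.card_biUnion, rk_biUnion hfam, ← prod_pow_eq_pow_sum,
    ← prod_pow_eq_pow_sum, ← prod_mul_distrib]
  refine prod_le_prod (fun _ _ => abs_nonneg _) fun c hc => ?_
  rw [abs_neg, abs_of_nonneg (meanMom_nonneg hb c)]
  have h := subset_of_mem_comps (hA hc)
  exact hb.moment c (h.trans hH) (nonempty_of_mem_comps (hA hc)) ((card_le_card h).trans hHD)

/-- The number of edges, with multiplicity, that are not doubled in a term of the expansion. -/
def simpleEdges (H₁ H₂ : Finset (Sym2 (Fin n))) (A₁ A₂ : Finset (Finset (Sym2 (Fin n)))) : ℕ :=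
  (survivors H₁ A₁ ∆ survivors H₂ A₂).card + (A₁.biUnion id).card + (A₂.biUnion id).card

lemma card_symmDiff_add (A B : Finset (Sym2 (Fin n))) :
    (A ∆ B).card + 2 * (A ∩ B).card = A.card + B.card := by
  have h1 := card_sdiff_add_card_inter A B
  have h2 := card_sdiff_add_card_inter B A
  have h3 : (A ∆ B).card = (A \ B).card + (B \ A).card :=
    card_union_of_disjoint (disjoint_sdiff_sdiff)
  rw [inter_comm B A] at h2
  omega

/-- A doubled edge carries `p̄ ≈ w²` and a simple one `Λ ≤ u w` up to powers of `D`; this identity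
makes the total power of `w` match the normalisation of the two monomials. -/
lemma simpleEdges_add (hA₁ : A₁ ⊆ comps H₁) (hA₂ : A₂ ⊆ comps H₂) :
    simpleEdges H₁ H₂ A₁ A₂ + 2 * (survivors H₁ A₁ ∩ survivors H₂ A₂).card =
      H₁.card + H₂.card := by
  have h1 := card_symmDiff_add (survivors H₁ A₁) (survivors H₂ A₂)
  have h2 := card_survivors_add hA₁
  have h3 := card_survivors_add hA₂
  rw [simpleEdges]
  omega

lemma card_symmDiff_le_simpleEdges (hA₁ : A₁ ⊆ comps H₁) (hA₂ : A₂ ⊆ comps H₂) :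
    (H₁ ∆ H₂).card ≤ simpleEdges H₁ H₂ A₁ A₂ := by
  have h1 := simpleEdges_add hA₁ hA₂
  have h2 := card_symmDiff_add H₁ H₂
  have h3 : (survivors H₁ A₁ ∩ survivors H₂ A₂).card ≤ (H₁ ∩ H₂).card :=
    card_le_card (inter_subset_inter survivors_subset survivors_subset)
  omega

/-- Each component replaced by its mean leaves at least one simple edge, whose spare factor `1/D`
pays for the choice of that component. -/
lemma card_add_card_le_simpleEdges (hA₁ : A₁ ⊆ comps H₁) (hA₂ : A₂ ⊆ comps H₂) :
    A₁.card + A₂.card ≤ simpleEdges H₁ H₂ A₁ A₂ := by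
  have h1 := (isConnFamily_comps.mono hA₁).card_le
  have h2 := (isConnFamily_comps.mono hA₂).card_le
  rw [simpleEdges]
  omega

lemma rk_symmDiff_le_survivors (h₁ : H₁ ⊆ allEdges n) (h₂ : H₂ ⊆ allEdges n)
    (hA₁ : A₁ ⊆ comps H₁) (hA₂ : A₂ ⊆ comps H₂) :
    rk (H₁ ∆ H₂) ≤ rk (survivors H₁ A₁ ∆ survivors H₂ A₂) + rk (A₁.biUnion id) +
      rk (A₂.biUnion id) := by
  have hs1 := (survivors_subset (H := H₁) (A := A₁)).trans h₁
  have hs2 := (survivors_subset (H := H₂) (A := A₂)).trans h₂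
  have ha1 := (biUnion_subset_of_subset_comps hA₁).trans h₁
  have ha2 := (biUnion_subset_of_subset_comps hA₂).trans h₂
  have hsd : survivors H₁ A₁ ∆ survivors H₂ A₂ ⊆ allEdges n :=
    symmDiff_le_sup.trans (union_subset hs1 hs2)
  have hsub : H₁ ∆ H₂ ⊆ (survivors H₁ A₁ ∆ survivors H₂ A₂ ∪ A₁.biUnion id) ∪ A₂.biUnion id := by
    intro e he
    have e1 : e ∈ H₁ ↔ e ∈ survivors H₁ A₁ ∨ e ∈ A₁.biUnion id := by
      rw [← mem_union, survivors_union hA₁]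
    have e2 : e ∈ H₂ ↔ e ∈ survivors H₂ A₂ ∨ e ∈ A₂.biUnion id := by
      rw [← mem_union, survivors_union hA₂]
    simp only [mem_union, mem_symmDiff] at he ⊢
    tauto
  refine (rk_mono hsub (union_subset (union_subset hsd ha1) ha2)).trans ?_
  have h3 := rk_union_le (union_subset hsd ha1) ha2
  have h4 := rk_union_le hsd ha1
  omega

lemma abs_covTerm_le (hb : MomentBounds n D q lam Λ κ s Θ) (hlam : 0 ≤ lam)
    (hD : 2 ≤ D) (hn : 32 * D ^ 2 ≤ n) (h₁ : H₁ ⊆ allEdges n) (h₂ : H₂ ⊆ allEdges n)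
    (hD₁ : H₁.card ≤ D) (hD₂ : H₂.card ≤ D)
    (hA₁ : A₁ ⊆ mixedPart H₁ H₂) (hA₂ : A₂ ⊆ mixedPart H₂ H₁) :
    |covTerm q Θ H₁ H₂ A₁ A₂| ≤ 2 * ((D : ℝ) ^ 16 * Λ) ^ simpleEdges H₁ H₂ A₁ A₂ *
      pbar lam q ^ (survivors H₁ A₁ ∩ survivors H₂ A₂).card * κ ^ rk (H₁ ∆ H₂) *
      s ^ (pureBlocks H₁ H₂).card := by
  have hc1 := hA₁.trans mixedPart_subset
  have hc2 := hA₂.trans mixedPart_subset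
  have hmain := abs_permAvg_centered_le hb hlam hD hn
    ((survivors_subset (H := H₁) (A := A₁)).trans h₁)
    ((survivors_subset (H := H₂) (A := A₂)).trans h₂)
    ((card_le_card survivors_subset).trans hD₁) ((card_le_card survivors_subset).trans hD₂)
    _ (pureBlocks_subset_survivors hA₁ hA₂)
  simp only [← pairMom_mixed hA₁ hA₂] at hmain
  have hx1 := abs_prod_meanMom_le hb h₁ hD₁ hc1
  have hx2 := abs_prod_meanMom_le hb h₂ hD₂ hc2
  have hΛ := hb.rate_nonneg
  have hκ := hb.density_nonneg
  have hs := hb.s_nonneg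
  have hpb := pbar_nonneg hb hlam
  have hD16 : (1 : ℝ) ≤ (D : ℝ) ^ 16 :=
    one_le_pow₀ (by exact_mod_cast (by omega : 1 ≤ D))
  have hΛ' : Λ ≤ (D : ℝ) ^ 16 * Λ := le_mul_of_one_le_left hΛ hD16
  rw [covTerm, abs_mul, abs_mul]
  calc _ ≤ (((D : ℝ) ^ 16 * Λ) ^ (A₁.biUnion id).card * κ ^ rk (A₁.biUnion id)) *
        (((D : ℝ) ^ 16 * Λ) ^ (A₂.biUnion id).card * κ ^ rk (A₂.biUnion id)) * _ := by
        refine mul_le_mul (mul_le_mul (hx1.trans ?_) (hx2.trans ?_) (abs_nonneg _)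
          (by positivity)) hmain (abs_nonneg _) (by positivity)
        · gcongr
        · gcongr
    _ = 2 * ((D : ℝ) ^ 16 * Λ) ^ simpleEdges H₁ H₂ A₁ A₂ *
        pbar lam q ^ (survivors H₁ A₁ ∩ survivors H₂ A₂).card *
        κ ^ (rk (survivors H₁ A₁ ∆ survivors H₂ A₂) + rk (A₁.biUnion id) +
          rk (A₂.biUnion id)) * s ^ (pureBlocks H₁ H₂).card := by
        rw [simpleEdges, pow_add, pow_add, pow_add, pow_add]; ring
    _ ≤ _ := by
        have := pow_le_pow_of_le_one hκ hb.density_le (rk_symmDiff_le_survivors h₁ h₂ hc1 hc2)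
        gcongr

/-- The scale `w = √(q̄)`, and bounds `u`, `δ` for the signal relative to this scale. -/
structure Normalisation (D : ℕ) (q lam Λ w u δ : ℝ) : Prop where
  w_pos : 0 < w
  u_nonneg : 0 ≤ u
  u_le : u ≤ 1
  rate_le : (D : ℝ) ^ 17 * Λ ≤ u * w
  w_sq : w ^ 2 = qbar q
  δ_le : δ ≤ 1
  pbar_le : ∀ m ≤ D, pbar lam q ^ m ≤ (1 + δ) * w ^ (2 * m)

variable {w u δ : ℝ}

/-- `rate_le` has `D ^ 17` where the decoupling bound uses `D ^ 16`; the difference becomes `1/D`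
per replaced component. The parameter `m` is the number of factors `u` retained: `|H₁ ∆ H₂|` for the
covariance bound, one for the correction to the variance. -/
lemma abs_covTerm_normalised_le (hb : MomentBounds n D q lam Λ κ s Θ)
    (hw : Normalisation D q lam Λ w u δ) (hlam : 0 ≤ lam)
    (hD : 2 ≤ D) (hn : 32 * D ^ 2 ≤ n) (h₁ : H₁ ⊆ allEdges n) (h₂ : H₂ ⊆ allEdges n)
    (hD₁ : H₁.card ≤ D) (hD₂ : H₂.card ≤ D)
    (hA₁ : A₁ ⊆ mixedPart H₁ H₂) (hA₂ : A₂ ⊆ mixedPart H₂ H₁) {m : ℕ}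
    (hm : m ≤ simpleEdges H₁ H₂ A₁ A₂) :
    |covTerm q Θ H₁ H₂ A₁ A₂| ≤ (w ^ H₁.card * w ^ H₂.card) * (4 * u ^ m *
      κ ^ rk (H₁ ∆ H₂) * s ^ (pureBlocks H₁ H₂).card) *
        (((D : ℝ)⁻¹) ^ A₁.card * ((D : ℝ)⁻¹) ^ A₂.card) := by
  have hD0 : (0 : ℝ) < D := by exact_mod_cast (by omega : 0 < D)
  have hD1 : (D : ℝ)⁻¹ ≤ 1 := inv_le_one_of_one_le₀ (by exact_mod_cast (by omega : 1 ≤ D))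
  refine (abs_covTerm_le hb hlam hD hn h₁ h₂ hD₁ hD₂ hA₁ hA₂).trans ?_
  have hc1 := hA₁.trans mixedPart_subset
  have hc2 := hA₂.trans mixedPart_subset
  have hadd := simpleEdges_add hc1 hc2
  have hcard := card_add_card_le_simpleEdges hc1 hc2
  set L := simpleEdges H₁ H₂ A₁ A₂
  set M := (survivors H₁ A₁ ∩ survivors H₂ A₂).card with hM
  have hMD : M ≤ D := (card_le_card (inter_subset_left.trans survivors_subset)).trans hD₁
  have hκ := hb.density_nonneg
  have hs := hb.s_nonneg
  have hΛ := hb.rate_nonneg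
  have hw0 := hw.w_pos.le
  have hu0 := hw.u_nonneg
  have e1 : (D : ℝ) ^ 16 * Λ ≤ u * w * (D : ℝ)⁻¹ := by
    rw [← div_eq_mul_inv, le_div_iff₀ hD0]
    calc (D : ℝ) ^ 16 * Λ * D = (D : ℝ) ^ 17 * Λ := by ring
      _ ≤ _ := hw.rate_le
  have e2 : ((D : ℝ) ^ 16 * Λ) ^ L ≤ u ^ m * w ^ L * ((D : ℝ)⁻¹) ^ (A₁.card + A₂.card) := by
    calc ((D : ℝ) ^ 16 * Λ) ^ L ≤ (u * w * (D : ℝ)⁻¹) ^ L :=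
          pow_le_pow_left₀ (by positivity) e1 _
      _ = u ^ L * w ^ L * ((D : ℝ)⁻¹) ^ L := by rw [mul_pow, mul_pow]
      _ ≤ u ^ m * w ^ L * ((D : ℝ)⁻¹) ^ (A₁.card + A₂.card) := by
          have h1 := pow_le_pow_of_le_one hu0 hw.u_le hm
          have h2 := pow_le_pow_of_le_one (by positivity) hD1 hcard
          gcongr
  have e3 : pbar lam q ^ M ≤ 2 * w ^ (2 * M) :=
    (hw.pbar_le M hMD).trans (mul_le_mul_of_nonneg_right (by linarith [hw.δ_le]) (by positivity))
  have hpb := pbar_nonneg hb hlam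
  calc _ ≤ 2 * (u ^ m * w ^ L * ((D : ℝ)⁻¹) ^ (A₁.card + A₂.card)) * (2 * w ^ (2 * M)) *
        κ ^ rk (H₁ ∆ H₂) * s ^ (pureBlocks H₁ H₂).card := by gcongr
    _ = 4 * u ^ m * w ^ (L + 2 * M) * ((D : ℝ)⁻¹) ^ (A₁.card + A₂.card) *
        κ ^ rk (H₁ ∆ H₂) * s ^ (pureBlocks H₁ H₂).card := by rw [pow_add w]; ring
    _ = _ := by rw [hadd, pow_add, pow_add]; ring

lemma one_add_inv_pow_le {D m : ℕ} (hD : 2 ≤ D) (hm : m ≤ D) : (1 + (D : ℝ)⁻¹) ^ m ≤ 3 := by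
  have hD0 : (0 : ℝ) < D := by exact_mod_cast (by omega : 0 < D)
  calc (1 + (D : ℝ)⁻¹) ^ m ≤ (1 + (D : ℝ)⁻¹) ^ D :=
        pow_le_pow_right₀ (by simp) hm
    _ ≤ Real.exp ((D : ℝ)⁻¹) ^ D := by
        refine pow_le_pow_left₀ (by positivity) ?_ _
        rw [add_comm]; exact Real.add_one_le_exp _
    _ = Real.exp 1 := by
        rw [← Real.exp_nat_mul, mul_inv_cancel₀ hD0.ne']
    _ ≤ 3 := by linarith [Real.exp_one_lt_d9]

lemma sum_pow_card_le (hD : 2 ≤ D) (hD₁ : H₁.card ≤ D) (hD₂ : H₂.card ≤ D) :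
    ∑ A ∈ (mixedPart H₁ H₂).powerset ×ˢ (mixedPart H₂ H₁).powerset,
      ((D : ℝ)⁻¹) ^ A.1.card * ((D : ℝ)⁻¹) ^ A.2.card ≤ 9 := by
  have key : ∀ N : Finset (Finset (Sym2 (Fin n))), N.card ≤ D →
      ∑ A ∈ N.powerset, ((D : ℝ)⁻¹) ^ A.card ≤ 3 := by
    intro N hN
    have := prod_one_add (f := fun _ => (D : ℝ)⁻¹) N
    simp only [prod_const] at this
    rw [← this]
    exact one_add_inv_pow_le hD hN
  rw [sum_product]
  simp only
  rw [← sum_mul_sum]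
  have h1 := key (mixedPart H₁ H₂) ((card_le_card mixedPart_subset).trans
    (card_comps_le.trans hD₁))
  have h2 := key (mixedPart H₂ H₁) ((card_le_card mixedPart_subset).trans
    (card_comps_le.trans hD₂))
  calc _ ≤ (3 : ℝ) * 3 := mul_le_mul h1 h2 (by positivity) (by norm_num)
    _ = 9 := by norm_num

/-- Covariance of two centered monomials. -/
theorem abs_permExpect_centered_mul_le (hb : MomentBounds n D q lam Λ κ s Θ)
    (hw : Normalisation D q lam Λ w u δ) (hlam : 0 ≤ lam)
    (hD : 2 ≤ D) (hn : 32 * D ^ 2 ≤ n) (h₁ : H₁ ⊆ allEdges n) (h₂ : H₂ ⊆ allEdges n)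
    (hD₁ : H₁.card ≤ D) (hD₂ : H₂.card ≤ D) :
    |permExpect q Θ (fun S => centeredEdgePoly q Θ H₁ S * centeredEdgePoly q Θ H₂ S)| ≤
      (w ^ H₁.card * w ^ H₂.card) * (36 * u ^ (H₁ ∆ H₂).card *
      κ ^ rk (H₁ ∆ H₂) * s ^ (pureBlocks H₁ H₂).card) := by
  have hκ := hb.density_nonneg
  have hs := hb.s_nonneg
  have hw0 := hw.w_pos.le
  have hu0 := hw.u_nonneg
  rw [permExpect_centered_mul h₁ h₂]
  -- The constant is `36 = 4 · 9`, the `9` being the sum over all choices of replaced components.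
  refine (abs_sum_le_sum_abs _ _).trans ?_
  refine (sum_le_sum fun A hA => ?_).trans (?_ : ∑ A ∈ (mixedPart H₁ H₂).powerset ×ˢ
    (mixedPart H₂ H₁).powerset, (w ^ H₁.card * w ^ H₂.card) * (4 * u ^ (H₁ ∆ H₂).card *
      κ ^ rk (H₁ ∆ H₂) * s ^ (pureBlocks H₁ H₂).card) *
        (((D : ℝ)⁻¹) ^ A.1.card * ((D : ℝ)⁻¹) ^ A.2.card) ≤ _)
  · rw [mem_product, mem_powerset, mem_powerset] at hA
    exact abs_covTerm_normalised_le hb hw hlam hD hn h₁ h₂ hD₁ hD₂ hA.1 hA.2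
      (card_symmDiff_le_simpleEdges (hA.1.trans mixedPart_subset) (hA.2.trans mixedPart_subset))
  · rw [← mul_sum]
    calc _ ≤ (w ^ H₁.card * w ^ H₂.card) * (4 * u ^ (H₁ ∆ H₂).card *
      κ ^ rk (H₁ ∆ H₂) * s ^ (pureBlocks H₁ H₂).card) * 9 :=
          mul_le_mul_of_nonneg_left (sum_pow_card_le hD hD₁ hD₂) (by positivity)
      _ = _ := by ring

lemma purePart_self : purePart H H = ∅ := by
  refine eq_empty_of_forall_notMem fun c hc => ?_
  rw [mem_purePart] at hc
  exact not_vdisj_self (nonempty_of_mem_comps hc.1)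
    (hc.2.mono Subset.rfl (subset_of_mem_comps hc.1))

lemma covTerm_self_empty : covTerm q Θ H H ∅ ∅ = permAvg (pairMom q Θ H H) := by
  simp only [covTerm, pureBlocks, purePart_self, mixedPart, sdiff_empty, biUnion_comps,
    prod_empty, one_mul, mul_one, union_empty]

/-- Variance of a centered monomial. -/
theorem abs_permExpect_centered_sq_sub_le (hb : MomentBounds n D q lam Λ κ s Θ)
    (hw : Normalisation D q lam Λ w u δ) (hlam : 0 ≤ lam)
    (hD : 2 ≤ D) (hn : 32 * D ^ 2 ≤ n) (hH : H ⊆ allEdges n) (hHD : H.card ≤ D) :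
    |permExpect q Θ (fun S => centeredEdgePoly q Θ H S * centeredEdgePoly q Θ H S) -
      w ^ H.card * w ^ H.card| ≤ (w ^ H.card * w ^ H.card) * (δ + 36 * u) := by
  have hκ := hb.density_nonneg
  have hs := hb.s_nonneg
  have hw0 := hw.w_pos.le
  have hu0 := hw.u_nonneg
  have hmem : ((∅, ∅) : Finset (Finset (Sym2 (Fin n))) × Finset (Finset (Sym2 (Fin n)))) ∈
      (mixedPart H H).powerset ×ˢ (mixedPart H H).powerset := by simp
  rw [permExpect_centered_mul hH hH, ← add_sum_erase _ _ hmem, covTerm_self_empty]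
  have hnf : 0 < n := lt_of_lt_of_le (by positivity) hn
  have e0 : w ^ H.card * w ^ H.card = qbar q ^ H.card := by
    rw [← mul_pow, ← sq, hw.w_sq]
  have h1 : w ^ H.card * w ^ H.card ≤ permAvg (pairMom q Θ H H) := by
    rw [e0, ← permAvg_const (n := n) (qbar q ^ H.card)]
    exact permAvg_mono fun z => qbar_pow_le_pairMom_self hb.q_nonneg hb.q_le hb.signal_mem
  have h2 : permAvg (pairMom q Θ H H) ≤ (1 + δ) * (w ^ H.card * w ^ H.card) := by
    refine le_trans ?_ ((hw.pbar_le H.card hHD).trans (le_of_eq ?_))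
    · rw [← permAvg_const (n := n) (pbar lam q ^ H.card)]
      exact permAvg_mono fun z => pairMom_self_le hb.q_nonneg hb.q_le hb.signal_mem
    · rw [two_mul, pow_add]
  -- Every other term replaces at least one component by its mean, hence has a simple edge and
  -- carries a factor `u`.
  have h3 : |∑ A ∈ ((mixedPart H H).powerset ×ˢ (mixedPart H H).powerset).erase (∅, ∅),
      covTerm q Θ H H A.1 A.2| ≤ (w ^ H.card * w ^ H.card) * (36 * u) := by
    refine (abs_sum_le_sum_abs _ _).trans ?_
    refine (sum_le_sum fun A hA => ?_).trans (?_ : ∑ A ∈ ((mixedPart H H).powerset ×ˢ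
      (mixedPart H H).powerset).erase (∅, ∅), (w ^ H.card * w ^ H.card) * (4 * u) *
        (((D : ℝ)⁻¹) ^ A.1.card * ((D : ℝ)⁻¹) ^ A.2.card) ≤ _)
    · rw [mem_erase, mem_product, mem_powerset, mem_powerset] at hA
      have h4 : 1 ≤ simpleEdges H H A.1 A.2 := by
        refine le_trans ?_ (card_add_card_le_simpleEdges (hA.2.1.trans mixedPart_subset)
          (hA.2.2.trans mixedPart_subset))
        by_contra hcon
        have h5 : A.1 = ∅ := card_eq_zero.1 (by omega)
        have h6 : A.2 = ∅ := card_eq_zero.1 (by omega)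
        exact hA.1 (Prod.ext h5 h6)
      refine (abs_covTerm_normalised_le hb hw hlam hD hn hH hH hHD hHD hA.2.1 hA.2.2 h4).trans ?_
      refine mul_le_mul_of_nonneg_right (mul_le_mul_of_nonneg_left ?_ (by positivity))
        (by positivity)
      rw [pow_one]
      have h5 := pow_le_one₀ (n := rk (H ∆ H)) hκ hb.density_le
      have h6 := pow_le_one₀ (n := (pureBlocks H H).card) hs hb.s_le
      calc 4 * u * κ ^ rk (H ∆ H) * s ^ (pureBlocks H H).card ≤ 4 * u * 1 * 1 := by gcongr
        _ = 4 * u := by ring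
    · rw [← mul_sum]
      calc _ ≤ (w ^ H.card * w ^ H.card) * (4 * u) * 9 := by
            refine mul_le_mul_of_nonneg_left (le_trans ?_ (sum_pow_card_le hD hHD hHD))
              (by positivity)
            exact sum_le_sum_of_subset_of_nonneg (erase_subset _ _) fun _ _ _ => by positivity
        _ = _ := by ring
  rw [abs_le] at h3 ⊢
  constructor <;> linarith [h3.1, h3.2]

end Covariances

section GramMatrix

/- ### The Gram matrix of the centered monomials -/

/-- A weighted Schur test for symmetric kernels. -/
lemma abs_quadratic_form_le {ι : Type*} (I : Finset ι) (M K : ι → ι → ℝ) (ω : ι → ℝ) {η : ℝ}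
    (hω : ∀ i, 0 < ω i) (hM : ∀ i ∈ I, ∀ j ∈ I, |M i j| ≤ K i j) (hK : ∀ i j, K i j = K j i)
    (hrow : ∀ i ∈ I, ∑ j ∈ I, K i j * ω j ≤ η * ω i) (β : ι → ℝ) :
    |∑ i ∈ I, ∑ j ∈ I, β i * β j * M i j| ≤ η * ∑ i ∈ I, β i ^ 2 := by
  have hK0 : ∀ i ∈ I, ∀ j ∈ I, 0 ≤ K i j := fun i hi j hj => (abs_nonneg _).trans (hM i hi j hj)
  have hterm : ∀ i ∈ I, ∀ j ∈ I, |β i * β j * M i j| ≤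
      (1 / 2) * (β i ^ 2 / ω i * (K i j * ω j)) + (1 / 2) * (β j ^ 2 / ω j * (K j i * ω i)) := by
    intro i hi j hj
    -- Arithmetic-geometric mean inequality, with the ratio of the weights distributed so that row
    -- sums against `ω` appear.
    have h1 : |β i * β j| ≤ (1 / 2) * (β i ^ 2 / ω i * ω j) + (1 / 2) * (β j ^ 2 / ω j * ω i) := by
      have hi' := hω i
      have hj' := hω j
      have h2 : (1 / 2) * (β i ^ 2 / ω i * ω j) + (1 / 2) * (β j ^ 2 / ω j * ω i) =
          ((|β i| * ω j) ^ 2 + (|β j| * ω i) ^ 2) / (2 * (ω i * ω j)) := by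
        rw [mul_pow, mul_pow, sq_abs, sq_abs]
        field_simp
      rw [h2, le_div_iff₀ (by positivity), abs_mul]
      nlinarith [sq_nonneg (|β i| * ω j - |β j| * ω i)]
    rw [abs_mul]
    calc |β i * β j| * |M i j| ≤ ((1 / 2) * (β i ^ 2 / ω i * ω j) +
          (1 / 2) * (β j ^ 2 / ω j * ω i)) * K i j :=
          mul_le_mul h1 (hM i hi j hj) (abs_nonneg _) ((abs_nonneg _).trans h1)
      _ = _ := by rw [hK j i]; ring
  have hsum : ∑ i ∈ I, ∑ j ∈ I, β i ^ 2 / ω i * (K i j * ω j) ≤ η * ∑ i ∈ I, β i ^ 2 := by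
    rw [mul_sum]
    refine sum_le_sum fun i hi => ?_
    rw [← mul_sum]
    calc β i ^ 2 / ω i * ∑ j ∈ I, K i j * ω j ≤ β i ^ 2 / ω i * (η * ω i) :=
          mul_le_mul_of_nonneg_left (hrow i hi) (div_nonneg (sq_nonneg _) (hω i).le)
      _ = η * β i ^ 2 := by
          have := (hω i).ne'
          field_simp
  calc |∑ i ∈ I, ∑ j ∈ I, β i * β j * M i j|
      ≤ ∑ i ∈ I, ∑ j ∈ I, |β i * β j * M i j| :=
        (abs_sum_le_sum_abs _ _).trans (sum_le_sum fun i _ => abs_sum_le_sum_abs _ _)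
    _ ≤ ∑ i ∈ I, ∑ j ∈ I, ((1 / 2) * (β i ^ 2 / ω i * (K i j * ω j)) +
          (1 / 2) * (β j ^ 2 / ω j * (K j i * ω i))) :=
        sum_le_sum fun i hi => sum_le_sum fun j hj => hterm i hi j hj
    _ = (1 / 2) * (∑ i ∈ I, ∑ j ∈ I, β i ^ 2 / ω i * (K i j * ω j)) +
          (1 / 2) * ∑ i ∈ I, ∑ j ∈ I, β j ^ 2 / ω j * (K j i * ω i) := by
        simp only [sum_add_distrib, mul_sum]
    _ = ∑ i ∈ I, ∑ j ∈ I, β i ^ 2 / ω i * (K i j * ω j) := by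
        rw [sum_comm (f := fun i j => β j ^ 2 / ω j * (K j i * ω i))]
        ring
    _ ≤ _ := hsum

variable {n D : ℕ} {q lam Λ κ s w u δ τ x : ℝ} {Θ : Matrix (Fin n) (Fin n) ℝ}

/-- The edge sets with at most `D` edges. -/
def edgeSets (n D : ℕ) : Finset (Finset (Sym2 (Fin n))) :=
  (allEdges n).powerset.filter fun H => H.card ≤ D

lemma mem_edgeSets {H : Finset (Sym2 (Fin n))} :
    H ∈ edgeSets n D ↔ H ⊆ allEdges n ∧ H.card ≤ D := by
  rw [edgeSets, mem_filter, mem_powerset]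

lemma one_add_pow_le {m N : ℕ} (hm : m ≤ N) (hx0 : 0 ≤ x) (hx : N * x ≤ 1) :
    (1 + x) ^ m ≤ 1 + 2 * (N * x) := by
  have hNx : 0 ≤ N * x := by positivity
  calc (1 + x) ^ m ≤ (1 + x) ^ N := pow_le_pow_right₀ (by linarith) hm
    _ ≤ Real.exp x ^ N := by
        refine pow_le_pow_left₀ (by linarith) ?_ _
        rw [add_comm]; exact Real.add_one_le_exp _
    _ = Real.exp (N * x) := by rw [← Real.exp_nat_mul]
    _ ≤ 1 + 2 * (N * x) := by
        have := Real.abs_exp_sub_one_le (x := N * x) (by rwa [abs_of_nonneg hNx])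
        rw [abs_of_nonneg hNx] at this
        linarith [le_abs_self (Real.exp (N * x) - 1)]

/-- A sum over the nonempty subsets of a small set. -/
lemma sum_nonempty_pow_le {α : Type*} [DecidableEq α] (U : Finset α) {N : ℕ} (hU : U.card ≤ N)
    (hx0 : 0 ≤ x) (hx : N * x ≤ 1) : ∑ F ∈ U.powerset.erase ∅, x ^ F.card ≤ 2 * (N * x) := by
  have h1 := prod_one_add (f := fun _ => x) U
  simp only [prod_const] at h1
  have h2 := add_sum_erase U.powerset (fun F => x ^ F.card) (empty_mem_powerset U)
  rw [← h1] at h2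
  simp only [card_empty, pow_zero] at h2
  have h3 : (1 + x) ^ U.card ≤ 1 + 2 * (N * x) := one_add_pow_le hU hx0 hx
  linarith

/-- The neighbours of `H`, discounted by the number of new nodes and of changed edges. -/
lemma sum_neighbours_le (hD : 1 ≤ D) (hn : 2 ≤ n) (hx0 : 0 ≤ x) (hx : (16 * D ^ 2 : ℕ) * x ≤ 1)
    {H : Finset (Sym2 (Fin n))} (hH : H.card ≤ D) :
    ∑ H' ∈ (edgeSets n D).erase H, x ^ (H ∆ H').card * ((n : ℝ)⁻¹) ^ (verts H' \ verts H).card ≤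
      6 * ((16 * D ^ 2 : ℕ) * x) := by
  classical
  have hfib : ∀ W : Finset (Fin n), ∑ H' ∈ (edgeSets n D).erase H with verts H' \ verts H = W,
      x ^ (H ∆ H').card * ((n : ℝ)⁻¹) ^ (verts H' \ verts H).card ≤
        2 * ((16 * D ^ 2 : ℕ) * x) * ((n : ℝ)⁻¹) ^ W.card := by
    intro W
    by_cases hW : W.card ≤ 2 * D
    -- With the new nodes `W` fixed, `H'` is determined by `H ∆ H'`, a nonempty set of pairs on at
    -- most `4 D` nodes. There are at most `4D (4D + 1) / 2 ≤ 16 D²` such pairs, diagonal ones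
    -- included.
    · set U := (verts H ∪ W).sym2 with hU
      have hUcard : U.card ≤ 16 * D ^ 2 := by
        have h1 : (verts H ∪ W).card ≤ 4 * D := by
          have h2 := card_union_le (verts H) W
          have h3 := card_verts_le (F := H)
          omega
        rw [hU, card_sym2, Nat.choose_two_right, Nat.add_sub_cancel]
        refine Nat.div_le_of_le_mul ?_
        nlinarith [Nat.mul_le_mul h1 h1]
      have hinj : Set.InjOn (fun H' => H ∆ H')
          ((((edgeSets n D).erase H).filter fun H' => verts H' \ verts H = W :
            Finset (Finset (Sym2 (Fin n)))) : Set (Finset (Sym2 (Fin n)))) :=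
        (symmDiff_right_injective H).injOn
      calc ∑ H' ∈ (edgeSets n D).erase H with verts H' \ verts H = W,
            x ^ (H ∆ H').card * ((n : ℝ)⁻¹) ^ (verts H' \ verts H).card
          = (∑ H' ∈ (edgeSets n D).erase H with verts H' \ verts H = W, x ^ (H ∆ H').card) *
              ((n : ℝ)⁻¹) ^ W.card := by
            rw [sum_mul]
            refine sum_congr rfl fun H' hH' => ?_
            rw [(mem_filter.1 hH').2]
        _ ≤ (∑ F ∈ U.powerset.erase ∅, x ^ F.card) * ((n : ℝ)⁻¹) ^ W.card := by
            refine mul_le_mul_of_nonneg_right ?_ (by positivity)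
            rw [← sum_image (f := fun F : Finset (Sym2 (Fin n)) => x ^ F.card) hinj]
            refine sum_le_sum_of_subset_of_nonneg ?_ fun _ _ _ => by positivity
            intro F hF
            obtain ⟨H', hH', rfl⟩ := mem_image.1 hF
            rw [mem_filter, mem_erase] at hH'
            rw [mem_erase, mem_powerset]
            refine ⟨fun h => hH'.1.1 ?_, fun e he => ?_⟩
            · exact (symmDiff_eq_bot.1 h).symm
            · rw [hU, mem_sym2_iff]
              intro v hv
              have hsub : verts H ∪ W = verts H ∪ verts H' := by
                rw [← hH'.2, union_sdiff_self_eq_union]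
              rw [hsub, ← verts_union]
              refine mem_verts.2 ⟨e, ?_, hv⟩
              rw [mem_union]
              rcases mem_symmDiff.1 he with h | h
              exacts [Or.inl h.1, Or.inr h.1]
        _ ≤ _ := mul_le_mul_of_nonneg_right (sum_nonempty_pow_le U hUcard hx0 hx) (by positivity)
    · rw [filter_eq_empty_iff.2, sum_empty]
      · positivity
      · intro H' hH' h
        have h1 := (mem_edgeSets.1 (mem_of_mem_erase hH')).2
        have h2 := card_verts_le (F := H')
        have h3 := card_le_card (sdiff_subset (s := verts H') (t := verts H))
        rw [h] at h3
        omega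
  rw [← sum_fiberwise_of_maps_to (t := univ) (g := fun H' => verts H' \ verts H)
    fun _ _ => mem_univ _]
  refine (sum_le_sum fun W _ => hfib W).trans ?_
  rw [← mul_sum]
  -- The sum of `n ^ (-|W|)` over all node sets `W` is `(1 + 1/n) ^ n ≤ 3`.
  have h1 := prod_one_add (f := fun _ : Fin n => (n : ℝ)⁻¹) univ
  simp only [prod_const, card_univ, Fintype.card_fin, powerset_univ] at h1
  rw [← h1]
  have h2 := one_add_inv_pow_le hn le_rfl
  have h3 : 0 ≤ 2 * ((16 * D ^ 2 : ℕ) * x) := by positivity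
  calc _ ≤ 2 * ((16 * D ^ 2 : ℕ) * x) * 3 := mul_le_mul_of_nonneg_left h2 h3
    _ = _ := by ring

/-- The kernel that bounds the deviation of the Gram matrix from the identity. -/
def gramKernel (u δ κ s : ℝ) (H H' : Finset (Sym2 (Fin n))) : ℝ :=
  if H = H' then δ + 36 * u else 36 * u ^ (H ∆ H').card * κ ^ rk (H ∆ H') *
    s ^ (pureBlocks H H').card

lemma gramKernel_symm (H H' : Finset (Sym2 (Fin n))) :
    gramKernel u δ κ s H H' = gramKernel u δ κ s H' H := by
  rw [gramKernel, gramKernel, symmDiff_comm, pureBlocks, union_comm, ← pureBlocks]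
  simp only [eq_comm]

/-- Why the weights are `s ^ |V(H)|`. With `κ = τ s` the kernel has `s` to the power rank plus pure
components, which is at least the number of unmatched nodes. Together with the weight of `H'` the
exponent is at least `2 |V(H') \ V(H)| + |V(H)|`: a factor `1/n` per new node times the weight of
`H`. The number `τ` may exceed one and is absorbed by `u`, because the rank is at most the number of
edges. -/
lemma gramKernel_mul_le (hb : MomentBounds n D q lam Λ κ s Θ) (hu : 0 ≤ u) (hτ : 0 ≤ τ)
    (hκ : κ = τ * s) (hux : u ≤ x) (hutx : u * τ ≤ x) {H H' : Finset (Sym2 (Fin n))}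
    (hH : H ⊆ allEdges n) (hH' : H' ⊆ allEdges n) (hne : H ≠ H') :
    gramKernel u δ κ s H H' * s ^ (verts H').card ≤
      36 * (x ^ (H ∆ H').card * ((n : ℝ)⁻¹) ^ (verts H' \ verts H).card) * s ^ (verts H).card := by
  rw [gramKernel, if_neg hne]
  have hs := hb.s_nonneg
  have hx0 : 0 ≤ x := hu.trans hux
  have hn0 : (n : ℝ) ≠ 0 := fun h => by
    have := hb.sq_mul
    rw [h, mul_zero] at this
    exact zero_ne_one this
  have hninv : (n : ℝ)⁻¹ = s ^ 2 := by
    rw [eq_comm, ← mul_eq_one_iff_eq_inv₀ hn0]; exact hb.sq_mul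
  have hv := card_verts_symmDiff_le (A := H) (B := H')
  have hc1 : (verts H ∆ verts H').card =
      (verts H \ verts H').card + (verts H' \ verts H).card :=
    card_union_of_disjoint disjoint_sdiff_sdiff
  have hc2 := card_sdiff_add_card_inter (verts H) (verts H')
  have hc3 := card_sdiff_add_card_inter (verts H') (verts H)
  rw [inter_comm] at hc3
  have hrk : rk (H ∆ H') ≤ (H ∆ H').card :=
    rk_le_card (symmDiff_le_sup.trans (union_subset hH hH'))
  set E := (H ∆ H').card
  set r := rk (H ∆ H')
  have h1 : u ^ E * τ ^ r ≤ x ^ E := by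
    obtain ⟨d, hd⟩ := Nat.exists_eq_add_of_le hrk
    rw [hd, pow_add]
    calc u ^ r * u ^ d * τ ^ r = (u * τ) ^ r * u ^ d := by rw [mul_pow]; ring
      _ ≤ x ^ r * x ^ d := by gcongr
      _ = x ^ (r + d) := (pow_add _ _ _).symm
  have h2 : s ^ (r + (pureBlocks H H').card + (verts H').card) ≤
      s ^ (2 * (verts H' \ verts H).card + (verts H).card) :=
    pow_le_pow_of_le_one hs hb.s_le (by omega)
  calc _ = 36 * ((u ^ E * τ ^ r) * s ^ (r + (pureBlocks H H').card + (verts H').card)) := by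
        rw [hκ, mul_pow, pow_add, pow_add]; ring
    _ ≤ 36 * (x ^ E * s ^ (2 * (verts H' \ verts H).card + (verts H).card)) := by gcongr
    _ = _ := by rw [hninv, ← pow_mul, pow_add]; ring

/-- The off-diagonal constant is `3456 = 36 · 6 · 16`. -/
lemma sum_gramKernel_le (hb : MomentBounds n D q lam Λ κ s Θ) (hD : 1 ≤ D) (hn : 2 ≤ n)
    (hu : 0 ≤ u) (hτ : 0 ≤ τ)
    (hκ : κ = τ * s) (hux : u ≤ x) (hutx : u * τ ≤ x) (hx : (16 * D ^ 2 : ℕ) * x ≤ 1)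
    {H : Finset (Sym2 (Fin n))} (hH : H ∈ edgeSets n D) :
    ∑ H' ∈ edgeSets n D, gramKernel u δ κ s H H' * s ^ (verts H').card ≤
      (δ + 36 * u + 3456 * D ^ 2 * x) * s ^ (verts H).card := by
  have hs := hb.s_nonneg
  rw [← add_sum_erase _ _ hH]
  have h1 : ∑ H' ∈ (edgeSets n D).erase H, gramKernel u δ κ s H H' * s ^ (verts H').card ≤
      36 * (6 * ((16 * D ^ 2 : ℕ) * x)) * s ^ (verts H).card := by
    calc _ ≤ ∑ H' ∈ (edgeSets n D).erase H, 36 * (x ^ (H ∆ H').card *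
          ((n : ℝ)⁻¹) ^ (verts H' \ verts H).card) * s ^ (verts H).card := by
          refine sum_le_sum fun H' hH' => ?_
          rw [mem_erase] at hH'
          exact gramKernel_mul_le hb hu hτ hκ hux hutx (mem_edgeSets.1 hH).1
            (mem_edgeSets.1 hH'.2).1 (Ne.symm hH'.1)
      _ = 36 * (∑ H' ∈ (edgeSets n D).erase H, x ^ (H ∆ H').card *
          ((n : ℝ)⁻¹) ^ (verts H' \ verts H).card) * s ^ (verts H).card := by
          rw [mul_sum, sum_mul]
      _ ≤ _ := by
          have := sum_neighbours_le hD hn (hu.trans hux) hx (mem_edgeSets.1 hH).2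
          gcongr
  rw [gramKernel, if_pos rfl]
  calc _ ≤ (δ + 36 * u) * s ^ (verts H).card +
        36 * (6 * ((16 * D ^ 2 : ℕ) * x)) * s ^ (verts H).card := by linarith
    _ = _ := by push_cast; ring

/-- The normalised centered monomials are almost orthonormal. -/
theorem abs_permExpect_sq_sub_le (hb : MomentBounds n D q lam Λ κ s Θ)
    (hw : Normalisation D q lam Λ w u δ) (hlam : 0 ≤ lam)
    (hD : 2 ≤ D) (hn : 32 * D ^ 2 ≤ n) (hτ : 0 ≤ τ)
    (hκ : κ = τ * s) (hux : u ≤ x) (hutx : u * τ ≤ x) (hx : (16 * D ^ 2 : ℕ) * x ≤ 1)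
    (β : Finset (Sym2 (Fin n)) → ℝ) :
    |permExpect q Θ (fun S => (∑ H ∈ edgeSets n D,
        β H * (centeredEdgePoly q Θ H S / w ^ H.card)) ^ 2) - ∑ H ∈ edgeSets n D, β H ^ 2| ≤
      (δ + 36 * u + 3456 * D ^ 2 * x) * ∑ H ∈ edgeSets n D, β H ^ 2 := by
  have hw0 := hw.w_pos
  have hn2 : 2 ≤ n := by nlinarith
  have hspos : 0 < s := lt_of_le_of_ne hb.s_nonneg fun h => by
    have := hb.sq_mul
    rw [← h] at this
    norm_num at this
  set G : Finset (Sym2 (Fin n)) → Finset (Sym2 (Fin n)) → ℝ := fun H H' =>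
    permExpect q Θ (fun S => centeredEdgePoly q Θ H S * centeredEdgePoly q Θ H' S) with hG
  set M : Finset (Sym2 (Fin n)) → Finset (Sym2 (Fin n)) → ℝ := fun H H' =>
    (w ^ H.card * w ^ H'.card)⁻¹ * G H H' - if H = H' then 1 else 0 with hM
  have hexp : permExpect q Θ (fun S => (∑ H ∈ edgeSets n D,
        β H * (centeredEdgePoly q Θ H S / w ^ H.card)) ^ 2) - ∑ H ∈ edgeSets n D, β H ^ 2 =
      ∑ H ∈ edgeSets n D, ∑ H' ∈ edgeSets n D, β H * β H' * M H H' := by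
    have h1 : (fun S => (∑ H ∈ edgeSets n D,
        β H * (centeredEdgePoly q Θ H S / w ^ H.card)) ^ 2) = fun S =>
        ∑ H ∈ edgeSets n D, ∑ H' ∈ edgeSets n D, (β H * β H' * (w ^ H.card * w ^ H'.card)⁻¹) *
          (centeredEdgePoly q Θ H S * centeredEdgePoly q Θ H' S) := by
      funext S
      rw [sq, sum_mul_sum]
      refine sum_congr rfl fun H _ => sum_congr rfl fun H' _ => ?_
      rw [mul_inv]
      ring
    have h2 : ∑ H ∈ edgeSets n D, β H ^ 2 = ∑ H ∈ edgeSets n D, ∑ H' ∈ edgeSets n D,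
        β H * β H' * (if H = H' then 1 else 0) := by
      refine sum_congr rfl fun H hH => ?_
      simp [hH, sq]
    rw [h1, permExpect_sum, h2, ← sum_sub_distrib]
    refine sum_congr rfl fun H _ => ?_
    rw [permExpect_sum, ← sum_sub_distrib]
    refine sum_congr rfl fun H' _ => ?_
    rw [permExpect_mul_left]
    simp only [hM, hG]
    ring
  rw [hexp]
  refine abs_quadratic_form_le _ M (gramKernel u δ κ s) (fun H => s ^ (verts H).card)
    (fun H => pow_pos hspos _) (fun H hH H' hH' => ?_) gramKernel_symm
    (fun H hH => sum_gramKernel_le hb (by omega) hn2 hw.u_nonneg hτ hκ hux hutx hx hH) β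
  rw [mem_edgeSets] at hH hH'
  have hc : 0 < w ^ H.card * w ^ H'.card := by positivity
  by_cases heq : H = H'
  · subst heq
    have h := abs_permExpect_centered_sq_sub_le hb hw hlam hD hn hH.1 hH.2
    rw [gramKernel, if_pos rfl]
    have : M H H = (w ^ H.card * w ^ H.card)⁻¹ * (G H H - w ^ H.card * w ^ H.card) := by
      simp only [hM, if_true]
      rw [mul_sub, inv_mul_cancel₀ hc.ne']
    rw [this, abs_mul, abs_of_pos (inv_pos.2 hc), inv_mul_le_iff₀ hc]
    exact h
  · have h := abs_permExpect_centered_mul_le hb hw hlam hD hn hH.1 hH'.1 hH.2 hH'.2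
    rw [gramKernel, if_neg heq]
    simp only [hM, if_neg heq, sub_zero]
    rw [abs_mul, abs_of_pos (inv_pos.2 hc), inv_mul_le_iff₀ hc]
    exact h

end GramMatrix

section Copies

/- ### The basis polynomials as sums over labeled copies -/

variable {n D : ℕ} {q w : ℝ} {Θ : Matrix (Fin n) (Fin n) ℝ} {G G' : FinGraph}

lemma meanMom_eq {c : Finset (Sym2 (Fin n))} (hc : c ⊆ allEdges n) :
    permExpect q Θ (edgePoly q c) = meanMom q Θ c := by
  rw [permExpect_eq, meanMom]
  congr 1
  funext z
  exact condExpect_edgePoly hc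

lemma componentMonomial_eq (C : G.graph.ConnectedComponent) (π : Fin G.order ↪ Fin n) :
    componentMonomial q G C π = edgePoly q (compEdges G.graph π C) := by
  funext S
  rw [componentMonomial, edgePoly, compEdges, prod_map]
  rfl

/-- Without isolated nodes every component has an edge, so components of the graph and of its edge
set correspond, and the centered monomial depends on the labeling only through its edge set. -/
lemma centeredMonomial_eq (hG : ∀ v, ∃ w, G.graph.Adj v w) (π : Fin G.order ↪ Fin n) :
    centeredMonomial q Θ G π = centeredEdgePoly q Θ (edgeImage G.graph π) := by
  classical
  funext S
  have hne : ∀ C : G.graph.ConnectedComponent, (compEdges G.graph π C).Nonempty := by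
    intro C
    rw [compEdges_nonempty_iff]
    obtain ⟨v, hv⟩ := C.nonempty_supp
    exact ⟨v, hv, hG v⟩
  rw [centeredMonomial, centeredEdgePoly]
  refine prod_bij (fun C _ => compEdges G.graph π C)
    (fun C _ => compEdges_mem_comps (hne C)) (fun C _ C' _ h => compEdges_injective (hne C) h)
    (fun c hc => ?_) fun C _ => ?_
  · obtain ⟨C, hC⟩ := exists_compEdges_eq hc
    exact ⟨C, mem_univ _, hC⟩
  · rw [componentMonomial_eq, meanMom_eq (compEdges_subset.trans (edgeImage_subset_allEdges _ _))]

/-- Labeled graphs with the same edge set are isomorphic. -/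
lemma exists_iso (hG : ∀ v, ∃ w, G.graph.Adj v w) (hG' : ∀ v, ∃ w, G'.graph.Adj v w)
    {π : Fin G.order ↪ Fin n} {π' : Fin G'.order ↪ Fin n}
    (h : edgeImage G.graph π = edgeImage G'.graph π') :
    ∃ φ : G.graph ≃g G'.graph, ∀ v, π' (φ v) = π v := by
  have hr : Set.range π = Set.range π' := by
    rw [range_eq_verts hG, range_eq_verts hG', h]
  let e : Fin G.order ≃ Fin G'.order := (Equiv.ofInjective π π.injective).trans
    ((Equiv.setCongr hr).trans (Equiv.ofInjective π' π'.injective).symm)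
  have he : ∀ v, π' (e v) = π v := by
    intro v
    have := Equiv.apply_ofInjective_symm π'.injective
      (Equiv.setCongr hr (Equiv.ofInjective π π.injective v))
    exact this
  refine ⟨⟨e, fun {a b} => ?_⟩, he⟩
  have h1 : s(π a, π b) ∈ edgeImage G.graph π ↔ G.graph.Adj a b := by
    rw [mem_edgeImage_iff_map_adj]
    exact SimpleGraph.map_adj_apply
  have h2 : s(π' (e a), π' (e b)) ∈ edgeImage G'.graph π' ↔ G'.graph.Adj (e a) (e b) := by
    rw [mem_edgeImage_iff_map_adj]
    exact SimpleGraph.map_adj_apply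
  rw [← h1, ← h2, he, he, h]

lemma edgeImage_iso (φ : G.graph ≃g G'.graph) (π' : Fin G'.order ↪ Fin n) :
    edgeImage G.graph (φ.toEquiv.toEmbedding.trans π') = edgeImage G'.graph π' := by
  ext e
  rw [mem_edgeImage, mem_edgeImage]
  constructor
  · rintro ⟨a, ha, rfl⟩
    induction a with | _ x y =>
    exact ⟨s(φ x, φ y), φ.map_rel_iff.2 ha, rfl⟩
  · rintro ⟨a, ha, rfl⟩
    induction a with | _ x y =>
    refine ⟨s(φ.symm x, φ.symm y), φ.symm.map_rel_iff.2 ha, ?_⟩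
    change s(π' (φ (φ.symm x)), π' (φ (φ.symm y))) = s(π' x, π' y)
    rw [φ.apply_symm_apply, φ.apply_symm_apply]

/-- The edge sets of the labeled copies of a graph. -/
def copies (n : ℕ) (G : FinGraph) : Finset (Finset (Sym2 (Fin n))) :=
  univ.image fun π : Fin G.order ↪ Fin n => edgeImage G.graph π

lemma mem_copies {H : Finset (Sym2 (Fin n))} :
    H ∈ copies n G ↔ ∃ π : Fin G.order ↪ Fin n, edgeImage G.graph π = H := by
  simp [copies]

/-- The automorphism group acts simply transitively on the labelings with a given image. -/
lemma card_fiber_edgeImage (hG : ∀ v, ∃ w, G.graph.Adj v w) {H : Finset (Sym2 (Fin n))}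
    (hH : H ∈ copies n G) :
    (univ.filter fun π : Fin G.order ↪ Fin n => edgeImage G.graph π = H).card = G.numAut := by
  obtain ⟨π₀, rfl⟩ := mem_copies.1 hH
  have hf : Function.Bijective fun φ : G.graph ≃g G.graph =>
      (⟨φ.toEquiv.toEmbedding.trans π₀, edgeImage_iso φ π₀⟩ :
        {π : Fin G.order ↪ Fin n // edgeImage G.graph π = edgeImage G.graph π₀}) := by
    constructor
    · intro φ ψ h
      have h1 := congrArg Subtype.val h
      refine RelIso.ext fun v => π₀.injective ?_
      exact DFunLike.congr_fun h1 v
    · rintro ⟨π, hπ⟩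
      obtain ⟨φ, hφ⟩ := exists_iso hG hG hπ
      exact ⟨φ, Subtype.ext (DFunLike.ext _ _ hφ)⟩
  rw [FinGraph.numAut, Nat.card_congr (Equiv.ofBijective _ hf), Nat.card_eq_fintype_card,
    Fintype.card_subtype]

lemma sum_edgeImage_eq (hG : ∀ v, ∃ w, G.graph.Adj v w)
    (f : Finset (Sym2 (Fin n)) → ℝ) :
    ∑ π : Fin G.order ↪ Fin n, f (edgeImage G.graph π) = G.numAut * ∑ H ∈ copies n G, f H := by
  rw [← sum_fiberwise_of_maps_to (t := copies n G)
    (g := fun π : Fin G.order ↪ Fin n => edgeImage G.graph π) fun π _ => mem_copies.2 ⟨π, rfl⟩,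
    mul_sum]
  refine sum_congr rfl fun H hH => ?_
  rw [← card_fiber_edgeImage hG hH, ← nsmul_eq_mul, ← sum_const]
  exact sum_congr rfl fun π hπ => by rw [(mem_filter.1 hπ).2]

lemma descFactorial_eq (hG : ∀ v, ∃ w, G.graph.Adj v w) :
    (n.descFactorial G.order : ℝ) = G.numAut * (copies n G).card := by
  have h := sum_edgeImage_eq (n := n) hG fun _ => 1
  simpa [Fintype.card_embedding_eq] using h

lemma order_le (hG : ∀ v, ∃ w, G.graph.Adj v w) : G.order ≤ 2 * G.size := by
  have h1 := card_verts_le (F := edgeImage G.graph (Function.Embedding.refl _))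
  rwa [card_verts_edgeImage, card_edgeImage, support_eq_univ hG, Set.ncard_univ,
    Nat.card_eq_fintype_card, Fintype.card_fin] at h1

lemma card_of_mem_copies {H : Finset (Sym2 (Fin n))} (hH : H ∈ copies n G) : H.card = G.size := by
  obtain ⟨π, rfl⟩ := mem_copies.1 hH
  exact card_edgeImage

/-- The coefficient of the normalised monomial of a copy of `G` in `Ψ_G`. -/
def copyCoeff (n : ℕ) (G : FinGraph) : ℝ := √((copies n G).card : ℝ)⁻¹

/-- By orbit counting `𝕍(G)` is `|Aut G|² w^(2|E|)` times the number of copies, and `|Aut G|`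
cancels against the multiplicity of each copy. The assumption `2 D ≤ n` guarantees that copies
exist, since a template has at most `2 D` nodes. -/
lemma basisPoly_eq (hG : G.IsTemplate D) (hn : 2 * D ≤ n) (hw : 0 < w) (hwq : w ^ 2 = qbar q)
    (S : Finset (Sym2 (Fin n))) :
    basisPoly q Θ G S = ∑ H ∈ copies n G,
      copyCoeff n G * (centeredEdgePoly q Θ H S / w ^ H.card) := by
  have hord : G.order ≤ n := (order_le hG.2.2).trans (by have := hG.2.1; omega)
  have hdesc : (0 : ℝ) < n.descFactorial G.order := by
    exact_mod_cast Nat.descFactorial_pos.2 hord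
  have hd := descFactorial_eq (n := n) hG.2.2
  have ha : (0 : ℝ) < G.numAut := by
    refine lt_of_le_of_ne (Nat.cast_nonneg _) fun h => ?_
    rw [← h, zero_mul] at hd
    exact hdesc.ne' hd
  have hc : (0 : ℝ) < (copies n G).card := by
    refine lt_of_le_of_ne (Nat.cast_nonneg _) fun h => ?_
    rw [← h, mul_zero] at hd
    exact hdesc.ne' hd
  have hV : √(varianceProxy n q G) = G.numAut * (√((copies n G).card : ℝ) * w ^ G.size) := by
    have : varianceProxy n q G =
        (G.numAut * (√((copies n G).card : ℝ) * w ^ G.size)) ^ 2 := by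
      rw [varianceProxy, hd, ← hwq, mul_pow, mul_pow, Real.sq_sqrt hc.le]
      ring
    rw [this, Real.sqrt_sq (by positivity)]
  have hsum : ∑ π : Fin G.order ↪ Fin n, centeredMonomial q Θ G π S =
      G.numAut * ∑ H ∈ copies n G, centeredEdgePoly q Θ H S := by
    rw [← sum_edgeImage_eq hG.2.2 fun H => centeredEdgePoly q Θ H S]
    exact sum_congr rfl fun π _ => by rw [centeredMonomial_eq hG.2.2]
  rw [basisPoly, hsum, hV, mul_div_mul_left _ _ ha.ne', sum_div]
  refine sum_congr rfl fun H hH => ?_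
  rw [card_of_mem_copies hH, copyCoeff, Real.sqrt_inv, inv_mul_eq_div, div_div, mul_comm (w ^ _)]

lemma sum_copyCoeff_sq (hG : G.IsTemplate D) (hn : 2 * D ≤ n) :
    ∑ _H ∈ copies n G, copyCoeff n G ^ 2 = 1 := by
  have hord : G.order ≤ n := (order_le hG.2.2).trans (by have := hG.2.1; omega)
  have hdesc : (0 : ℝ) < n.descFactorial G.order := by
    exact_mod_cast Nat.descFactorial_pos.2 hord
  have hd := descFactorial_eq (n := n) hG.2.2
  have hc : ((copies n G).card : ℝ) ≠ 0 := by
    intro h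
    rw [h, mul_zero] at hd
    exact hdesc.ne' hd
  rw [sum_const, copyCoeff, Real.sq_sqrt (by positivity), nsmul_eq_mul, mul_inv_cancel₀ hc]

/-- The nonempty edge sets are partitioned into the copies of the templates. -/
lemma sum_edgeSets_eq {𝒢 : Finset FinGraph} (h𝒢 : IsTemplateCollection D 𝒢)
    (f : Finset (Sym2 (Fin n)) → ℝ) :
    ∑ H ∈ edgeSets n D, f H = f ∅ + ∑ G ∈ 𝒢, ∑ H ∈ copies n G, f H := by
  classical
  have h0 : ∅ ∈ edgeSets n D := mem_edgeSets.2 ⟨empty_subset _, by simp⟩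
  have hpart : (edgeSets n D).erase ∅ = 𝒢.biUnion (copies n) := by
    ext H
    rw [mem_erase, mem_edgeSets, mem_biUnion]
    constructor
    · rintro ⟨hne, hH, hHD⟩
      obtain ⟨G, hG, π, rfl⟩ := exists_template hH (nonempty_iff_ne_empty.2 hne) hHD
      obtain ⟨G', hG', ⟨φ⟩⟩ := h𝒢.2.2 G hG
      exact ⟨G', hG', mem_copies.2 ⟨_, edgeImage_iso φ.symm π⟩⟩
    · rintro ⟨G, hG, hH⟩
      have hT := h𝒢.1 G hG
      have hc := card_of_mem_copies hH
      obtain ⟨π, rfl⟩ := mem_copies.1 hH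
      refine ⟨fun h => ?_, edgeImage_subset_allEdges _ _, hc ▸ hT.2.1⟩
      rw [h, card_empty] at hc
      have := hT.1
      omega
  rw [← add_sum_erase _ _ h0, hpart, sum_biUnion]
  intro G hG G' hG' hne
  refine disjoint_left.2 fun H hH hH' => hne ?_
  obtain ⟨π, hπ⟩ := mem_copies.1 hH
  obtain ⟨π', hπ'⟩ := mem_copies.1 hH'
  obtain ⟨φ, -⟩ := exists_iso (h𝒢.1 G hG).2.2 (h𝒢.1 G' hG').2.2 (hπ.trans hπ'.symm)
  exact h𝒢.2.1 G hG G' hG' ⟨φ⟩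

/-- Every linear combination of the basis elements is a combination of the normalised centered
monomials with coefficients of the same norm. -/
lemma exists_coeff {𝒢 : Finset FinGraph} (h𝒢 : IsTemplateCollection D 𝒢) (hn : 2 * D ≤ n)
    (hw : 0 < w) (hwq : w ^ 2 = qbar q) (α₀ : ℝ) (α : FinGraph → ℝ) :
    ∃ β : Finset (Sym2 (Fin n)) → ℝ,
      ∑ H ∈ edgeSets n D, β H ^ 2 = α₀ ^ 2 + ∑ G ∈ 𝒢, α G ^ 2 ∧
      ∀ S, α₀ + ∑ G ∈ 𝒢, α G * basisPoly q Θ G S =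
        ∑ H ∈ edgeSets n D, β H * (centeredEdgePoly q Θ H S / w ^ H.card) := by
  classical
  -- The inner sum has at most one nonzero term, because copies of nonisomorphic templates are
  -- distinct; the empty edge set carries the constant.
  let β : Finset (Sym2 (Fin n)) → ℝ := fun H => if H = ∅ then α₀ else
    ∑ G ∈ 𝒢, if H ∈ copies n G then α G * copyCoeff n G else 0
  have hβ0 : β ∅ = α₀ := if_pos rfl
  have hβ : ∀ G ∈ 𝒢, ∀ H ∈ copies n G, β H = α G * copyCoeff n G := by
    intro G hG H hH
    have hne : H ≠ ∅ := by
      rintro rfl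
      have h1 := card_of_mem_copies hH
      have h2 := (h𝒢.1 G hG).1
      rw [card_empty] at h1
      omega
    simp only [β, if_neg hne]
    rw [sum_eq_single G, if_pos hH]
    · intro G' hG' hne'
      refine if_neg fun hH' => hne' ?_
      obtain ⟨π, hπ⟩ := mem_copies.1 hH
      obtain ⟨π', hπ'⟩ := mem_copies.1 hH'
      obtain ⟨φ, -⟩ := exists_iso (h𝒢.1 G' hG').2.2 (h𝒢.1 G hG).2.2 (hπ'.trans hπ.symm)
      exact h𝒢.2.1 G' hG' G hG ⟨φ⟩
    · exact fun h => absurd hG h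
  refine ⟨β, ?_, fun S => ?_⟩
  · rw [sum_edgeSets_eq h𝒢, hβ0]
    congr 1
    refine sum_congr rfl fun G hG => ?_
    rw [sum_congr rfl fun H hH => by rw [hβ G hG H hH, mul_pow], ← mul_sum,
      sum_copyCoeff_sq (h𝒢.1 G hG) hn, mul_one]
  · rw [sum_edgeSets_eq h𝒢, hβ0]
    have hcomp : comps (∅ : Finset (Sym2 (Fin n))) = ∅ :=
      card_eq_zero.1 (Nat.le_zero.1 (card_comps_le (F := (∅ : Finset (Sym2 (Fin n))))))
    have h0 : centeredEdgePoly q Θ ∅ S = 1 := by rw [centeredEdgePoly, hcomp, prod_empty]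
    rw [h0, card_empty, pow_zero, div_one, mul_one]
    congr 1
    refine sum_congr rfl fun G hG => ?_
    rw [basisPoly_eq (h𝒢.1 G hG) hn hw hwq, mul_sum]
    refine sum_congr rfl fun H hH => ?_
    rw [hβ G hG H hH, mul_assoc]

end Copies

section Constants

/- ### From the conditions to the moment bounds -/

variable {n D k a : ℕ} {q lam cm cvd1 cvd2 y : ℝ} {Θ : Matrix (Fin n) (Fin n) ℝ}

/-- All powers of `D` are moved into the rate per edge, leaving the bare `k/n` and `1/√n`. This is
possible because the rank and the number of pure components are at most the number of edges of the
symmetric difference, which is at least one. Prefactor, edges, rank and pure components contribute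
`2a`, `a`, `a` and `2a`, hence `6a`; constants up to `2 ^ a` are absorbed by `D ^ a`. -/
lemma momentBounds_of_conditions (hD : 2 ≤ D) (hn : 0 < n) (hk : k ≤ n) (hq : 0 ≤ q)
    (hq2 : q ≤ 1 / 2) (hlam : 0 ≤ lam) (hΘ : ∀ i j, Θ i j ∈ Set.Icc 0 lam)
    (hM : CMoment n D k lam q Θ cm) (hV : CVariancePerm n D k lam q Θ cvd1 cvd2)
    (hcvd2 : 0 ≤ cvd2) (hcma : cm ≤ a) (hcvd1a : cvd1 ≤ a) (hcvd2a : cvd2 ≤ 2 ^ a) :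
    MomentBounds n D q lam ((D : ℝ) ^ (6 * a) * lam) (k / n) (1 / √n) Θ := by
  have hD1 : (1 : ℝ) ≤ D := by exact_mod_cast (by omega : 1 ≤ D)
  have hD0 : (0 : ℝ) < D := by linarith
  have hn0 : (0 : ℝ) < n := by exact_mod_cast hn
  have hn1 : (1 : ℝ) ≤ n := by exact_mod_cast hn
  have hsn : 0 < √(n : ℝ) := Real.sqrt_pos.2 hn0
  have hpow : ∀ t : ℝ, t ≤ a → (D : ℝ) ^ t ≤ (D : ℝ) ^ a := fun t ht => by
    rw [← Real.rpow_natCast]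
    exact Real.rpow_le_rpow_of_exponent_le hD1 ht
  have hrpos : ∀ t : ℝ, 0 < (D : ℝ) ^ t := fun t => Real.rpow_pos_of_pos hD0 t
  have h2D : cvd2 ≤ (D : ℝ) ^ a :=
    hcvd2a.trans (pow_le_pow_left₀ (by norm_num) (by exact_mod_cast hD) a)
  have hκ0 : (0 : ℝ) ≤ k / n := by positivity
  refine ⟨hq, hq2, hΘ, by positivity, hκ0, ?_, by positivity, ?_, ?_, ?_, ?_⟩
  · rw [div_le_one hn0]; exact_mod_cast hk
  · rw [div_le_one hsn]; exact Real.one_le_sqrt.2 hn1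
  · rw [div_pow, one_pow, Real.sq_sqrt hn0.le, one_div, inv_mul_cancel₀ hn0.ne']
  · intro F hF hne hFD
    refine (hM.permAvg_pairMom_le hq hq2 hΘ hF hne hFD).trans ?_
    have hr := rk_le_card hF
    calc ((D : ℝ) ^ cm * lam) ^ F.card * ((D : ℝ) ^ cm * (k / n)) ^ rk F
        ≤ ((D : ℝ) ^ a * lam) ^ F.card * ((D : ℝ) ^ a * (k / n)) ^ rk F := by
          have := hpow cm hcma
          have := (hrpos cm).le
          gcongr
      _ = (D : ℝ) ^ (a * F.card + a * rk F) * (lam ^ F.card * (k / n : ℝ) ^ rk F) := by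
          rw [mul_pow, mul_pow, pow_add, pow_mul, pow_mul]; ring
      _ ≤ (D : ℝ) ^ (6 * a * F.card) * (lam ^ F.card * (k / n : ℝ) ^ rk F) := by
          refine mul_le_mul_of_nonneg_right (pow_le_pow_right₀ hD1 ?_) (by positivity)
          nlinarith [Nat.mul_le_mul_left a hr, Nat.zero_le (a * F.card)]
      _ = _ := by rw [mul_pow, ← pow_mul]; ring
  · intro A B hA hB hAn hBn hAD hBD hAB 𝒦 b h1 h2 h3 h4 h5
    refine (hV.avg_linked_le hq hq2 hΘ hA hB hAn hBn hAD hBD hAB h1 h2 h3 h4 h5).trans ?_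
    have hr : rk (A ∆ B) ≤ (A ∆ B).card :=
      rk_le_card (symmDiff_le_sup.trans (union_subset hA hB))
    have hp := card_pureBlocks_le (A := A) (B := B)
    have hE : 1 ≤ (A ∆ B).card :=
      card_pos.2 (nonempty_iff_ne_empty.2 fun h => hAB (symmDiff_eq_bot.1 h))
    set E := (A ∆ B).card
    set r := rk (A ∆ B)
    set p := (pureBlocks A B).card
    have hpb : 0 ≤ pbar lam q := by
      rw [pbar_eq]
      exact add_nonneg (mul_nonneg hq (by linarith)) (mul_nonneg (by linarith) hlam)
    calc _ ≤ (D : ℝ) ^ a * (D : ℝ) ^ a * ((D : ℝ) ^ a * lam) ^ E * pbar lam q ^ (A ∩ B).card *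
          ((D : ℝ) ^ a * (k / n)) ^ r * ((D : ℝ) ^ a * ((D : ℝ) ^ a / √n)) ^ p := by
          have := hpow cvd1 hcvd1a
          have := (hrpos cvd1).le
          gcongr
      _ = (D : ℝ) ^ (a + a + a * E + a * r + (a * p + a * p)) *
          (lam ^ E * pbar lam q ^ (A ∩ B).card * (k / n : ℝ) ^ r * (1 / √n) ^ p) := by
          rw [mul_pow, mul_pow, mul_pow, div_eq_mul_one_div _ (√(n : ℝ)), mul_pow, pow_add,
            pow_add, pow_add, pow_add, pow_add, pow_mul, pow_mul, pow_mul]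
          ring
      _ ≤ (D : ℝ) ^ (6 * a * E) *
          (lam ^ E * pbar lam q ^ (A ∩ B).card * (k / n : ℝ) ^ r * (1 / √n) ^ p) := by
          refine mul_le_mul_of_nonneg_right (pow_le_pow_right₀ hD1 ?_) (by positivity)
          have e1 := Nat.mul_le_mul_left a hr
          have e2 := Nat.mul_le_mul_left a hp
          have e3 := Nat.mul_le_mul_left a hE
          nlinarith
      _ = _ := by rw [mul_pow, ← pow_mul]; ring

/-- Consequences of `C-Signal` for the normalised signal. -/
lemma signal_div_le (hq : 0 < q) (hq2 : q ≤ 1 / 2) (hlam : 0 ≤ lam)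
    (h1 : lam * k / √(n * q) ≤ y) (h2 : lam / q ≤ y) :
    lam / √(qbar q) ≤ 2 * y ∧ lam / √(qbar q) * (k / √n) ≤ 2 * y := by
  have hsq : 0 < √q := Real.sqrt_pos.2 hq
  have hw : √q / 2 ≤ √(qbar q) := by
    refine Real.le_sqrt_of_sq_le ?_
    rw [div_pow, Real.sq_sqrt hq.le, qbar]
    nlinarith
  have hle : lam / √(qbar q) ≤ 2 * (lam / √q) := by
    calc lam / √(qbar q) ≤ lam / (√q / 2) := div_le_div_of_nonneg_left hlam (by positivity) hw
      _ = 2 * (lam / √q) := by field_simp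
  constructor
  · refine hle.trans (mul_le_mul_of_nonneg_left (le_trans ?_ h2) (by norm_num))
    refine div_le_div_of_nonneg_left hlam hq (Real.le_sqrt_of_sq_le ?_)
    nlinarith
  · calc lam / √(qbar q) * (k / √n) ≤ 2 * (lam / √q) * (k / √n) :=
          mul_le_mul_of_nonneg_right hle (by positivity)
      _ = 2 * (lam * k / √(n * q)) := by
          rw [Real.sqrt_mul (Nat.cast_nonneg n)]
          ring
      _ ≤ 2 * y := by linarith

/-- The exponent `17 + 6a` joins the `17` required by `rate_le` to the `6a` in the rate. The error
`δ` comes from `p̄ ≤ (1 + 2y) q̄` raised to a power of at most `D`. -/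
lemma normalisation_of_signal (hD : 2 ≤ D) (hq : 0 < q) (hq2 : q ≤ 1 / 2) (hlam : 0 ≤ lam)
    (h1 : lam * k / √(n * q) ≤ y) (h2 : lam / q ≤ y)
    (hy : 16 * ((D : ℝ) ^ (20 + 6 * a) * y) ≤ 1) :
    Normalisation D q lam ((D : ℝ) ^ (6 * a) * lam) √(qbar q)
      ((D : ℝ) ^ (17 + 6 * a) * (lam / √(qbar q))) (4 * (D * y)) := by
  have hD1 : (1 : ℝ) ≤ D := by exact_mod_cast (by omega : 1 ≤ D)
  have hqb : 0 < qbar q := mul_pos hq (by linarith)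
  have hw := Real.sqrt_pos.2 hqb
  have hy0 : 0 ≤ y := (div_nonneg hlam hq.le).trans h2
  have hmono : ∀ i ≤ 20 + 6 * a, (D : ℝ) ^ i * y ≤ (D : ℝ) ^ (20 + 6 * a) * y := fun i hi =>
    mul_le_mul_of_nonneg_right (pow_le_pow_right₀ hD1 hi) hy0
  have hDy : 16 * (D * y) ≤ 1 := by
    have := hmono 1 (by omega)
    rw [pow_one] at this
    linarith
  have hu := (signal_div_le (n := n) hq hq2 hlam h1 h2).1
  refine ⟨hw, by positivity, ?_, ?_, Real.sq_sqrt hqb.le, by linarith, fun m hm => ?_⟩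
  · calc (D : ℝ) ^ (17 + 6 * a) * (lam / √(qbar q)) ≤ (D : ℝ) ^ (17 + 6 * a) * (2 * y) :=
          mul_le_mul_of_nonneg_left hu (by positivity)
      _ ≤ 1 := by linarith [hmono (17 + 6 * a) (by omega), mul_nonneg (pow_nonneg (zero_le_one.trans hD1) (17 + 6 * a)) hy0]
  · rw [mul_assoc, div_mul_cancel₀ _ hw.ne', ← mul_assoc, ← pow_add]
  · have hpb : pbar lam q ≤ (1 + 2 * y) * qbar q := by
      have h3 : lam ≤ y * q := (div_le_iff₀ hq).1 h2
      rw [pbar_eq, qbar]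
      nlinarith [mul_nonneg hq.le hlam, mul_nonneg hy0 hq.le, mul_nonneg (mul_nonneg hy0 hq.le) (by linarith : (0:ℝ) ≤ 1 / 2 - q)]
    have hpb0 : 0 ≤ pbar lam q := by
      rw [pbar_eq]
      exact add_nonneg hqb.le (mul_nonneg (by linarith) hlam)
    have h4 : (1 + 2 * y) ^ m ≤ 1 + 4 * (D * y) := by
      have := one_add_pow_le (x := 2 * y) hm (by positivity) (by linarith)
      linarith
    calc pbar lam q ^ m ≤ ((1 + 2 * y) * qbar q) ^ m := pow_le_pow_left₀ hpb0 hpb m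
      _ = (1 + 2 * y) ^ m * √(qbar q) ^ (2 * m) := by
          rw [mul_pow, pow_mul, Real.sq_sqrt hqb.le]
      _ ≤ _ := mul_le_mul_of_nonneg_right h4 (by positivity)

/-- Almost orthonormality, with an explicit error. -/
theorem abs_permExpect_basis_sub_le (hD : 2 ≤ D) (hk : 1 ≤ k) (hkn : k ≤ n) (hq : 0 < q)
    (hq2 : q ≤ 1 / 2) (hlam : 0 ≤ lam) (hΘ : ∀ i j, Θ i j ∈ Set.Icc 0 lam)
    (h0 : (k : ℝ) / n ≤ y) (h1 : lam * k / √(n * q) ≤ y) (h2 : lam / q ≤ y)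
    (hM : CMoment n D k lam q Θ cm) (hV : CVariancePerm n D k lam q Θ cvd1 cvd2)
    (hcvd2 : 0 ≤ cvd2) (hcma : cm ≤ a) (hcvd1a : cvd1 ≤ a) (hcvd2a : cvd2 ≤ 2 ^ a)
    (hy : 32 * ((D : ℝ) ^ (20 + 6 * a) * y) ≤ 1)
    {𝒢 : Finset FinGraph} (h𝒢 : IsTemplateCollection D 𝒢) (α₀ : ℝ) (α : FinGraph → ℝ) :
    |permExpect q Θ (fun S => (α₀ + ∑ G ∈ 𝒢, α G * basisPoly q Θ G S) ^ 2) -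
      (α₀ ^ 2 + ∑ G ∈ 𝒢, α G ^ 2)| ≤
      7000 * ((D : ℝ) ^ (20 + 6 * a) * y) * (α₀ ^ 2 + ∑ G ∈ 𝒢, α G ^ 2) := by
  have hD1 : (1 : ℝ) ≤ D := by exact_mod_cast (by omega : 1 ≤ D)
  have hnpos : 0 < n := by omega
  have hn0 : (0 : ℝ) < n := by exact_mod_cast hnpos
  have hqb : 0 < qbar q := mul_pos hq (by linarith)
  have hy0 : 0 ≤ y := (div_nonneg hlam hq.le).trans h2
  have hmono : ∀ i ≤ 20 + 6 * a, (D : ℝ) ^ i * y ≤ (D : ℝ) ^ (20 + 6 * a) * y := fun i hi =>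
    mul_le_mul_of_nonneg_right (pow_le_pow_right₀ hD1 hi) hy0
  -- Since `k ≥ 1`, smallness of `k / n` forces `n ≥ 1 / y`.
  have hn : 32 * D ^ 2 ≤ n := by
    have hk' : (1 : ℝ) ≤ k := by exact_mod_cast hk
    have h3 : 1 ≤ y * n := by
      rw [div_le_iff₀ hn0] at h0
      linarith
    have h4 := hmono 2 (by omega)
    have h5 : (32 * (D : ℝ) ^ 2) * y ≤ 1 := by linarith
    have h6 : (32 * (D : ℝ) ^ 2) ≤ n := by
      calc (32 * (D : ℝ) ^ 2) ≤ (32 * (D : ℝ) ^ 2) * (y * n) :=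
            le_mul_of_one_le_right (by positivity) h3
        _ = ((32 * (D : ℝ) ^ 2) * y) * n := by ring
        _ ≤ 1 * n := mul_le_mul_of_nonneg_right h5 hn0.le
        _ = n := one_mul _
    exact_mod_cast h6
  have hn2 : 2 * D ≤ n := by nlinarith
  obtain ⟨β, hβ, hsum⟩ := exists_coeff (n := n) (q := q) (Θ := Θ) h𝒢 hn2 (Real.sqrt_pos.2 hqb)
    (Real.sq_sqrt hqb.le) α₀ α
  have hb := momentBounds_of_conditions (n := n) hD hnpos hkn hq.le hq2 hlam hΘ hM hV hcvd2 hcma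
    hcvd1a hcvd2a
  have hw := normalisation_of_signal (n := n) (a := a) hD hq hq2 hlam h1 h2 (by
    have := hmono 0 (by omega)
    rw [pow_zero, one_mul] at this
    linarith)
  have hsig := signal_div_le (n := n) hq hq2 hlam h1 h2
  -- With `τ = k / √n` and `s = 1 / √n`, both `u` and `u τ` are at most `x`: the former by the bound
  -- on `λ / q`, the latter by the bound on `λ k / √(n q)`.
  set x : ℝ := (D : ℝ) ^ (17 + 6 * a) * (2 * y) with hx
  have hxD : (D : ℝ) ^ 2 * x ≤ 2 * ((D : ℝ) ^ (20 + 6 * a) * y) := by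
    have := hmono (19 + 6 * a) (by omega)
    calc (D : ℝ) ^ 2 * x = 2 * ((D : ℝ) ^ (19 + 6 * a) * y) := by rw [hx]; ring
      _ ≤ _ := by linarith
  have hux : (D : ℝ) ^ (17 + 6 * a) * (lam / √(qbar q)) ≤ x :=
    mul_le_mul_of_nonneg_left hsig.1 (by positivity)
  have hmain := abs_permExpect_sq_sub_le hb hw hlam hD hn (τ := k / √n) (x := x) (by positivity)
    (by
      rw [div_mul_div_comm, mul_one, Real.mul_self_sqrt hn0.le]) hux
    (by
      rw [mul_assoc]
      exact mul_le_mul_of_nonneg_left hsig.2 (by positivity))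
    (by push_cast; linarith) β
  simp only [← hsum] at hmain
  rw [hβ] at hmain
  -- In units of `D ^ (20 + 6a) y`, the terms `δ`, `36 u` and `3456 D² x` are at most `4`, `72` and
  -- `6912`, which add up to less than `7000`.
  refine hmain.trans (mul_le_mul_of_nonneg_right ?_ ?_)
  · have h7 := hmono 1 (by omega)
    have h8 : x ≤ 2 * ((D : ℝ) ^ (20 + 6 * a) * y) := by
      have := hmono (17 + 6 * a) (by omega)
      rw [hx]
      linarith
    have h9 : 0 ≤ (D : ℝ) ^ (20 + 6 * a) * y := by positivity
    rw [pow_one] at h7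
    linarith
  · exact add_nonneg (sq_nonneg _) (sum_nonneg fun _ _ => sq_nonneg _)

end Constants

end NearOrtho

end

/-! ### Choice of the constants -/

theorem mainTheorem6
    (cm cv1 cv2 cv3 cv4 cvd1 cvd2 : ℝ)
    (hcm : 0 ≤ cm) (hcv1 : 0 ≤ cv1) (hcv2 : 0 ≤ cv2) (hcv3 : 0 ≤ cv3) (hcv4 : 1 ≤ cv4)
    (hcvd1 : 0 ≤ cvd1) (hcvd2 : 0 ≤ cvd2) :
    ∃ c₀ : ℝ, 1 < c₀ ∧ ∃ c : ℝ, 0 < c ∧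
      ∀ cs : ℝ, c₀ ≤ cs →
      ∀ (D n k : ℕ) (lam q : ℝ) (Θ : Matrix (Fin n) (Fin n) ℝ),
        2 ≤ D → 1 ≤ k → k ≤ n → 0 < q → q ≤ 1 / 2 → 0 ≤ lam → lam ≤ 1 - q → Θ.IsSymm →
        NearOrtho.CSignal n D k lam q Θ cs →
        NearOrtho.CMoment n D k lam q Θ cm →
        NearOrtho.CVariance n D k lam q Θ cv1 cv2 cv3 cv4 →
        NearOrtho.CVariancePerm n D k lam q Θ cvd1 cvd2 →
        ∀ 𝒢 : Finset NearOrtho.FinGraph, NearOrtho.IsTemplateCollection D 𝒢 →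
        ∀ (α₀ : ℝ) (α : NearOrtho.FinGraph → ℝ),
          (1 - c * (D : ℝ) ^ (-(cs / 2))) * (α₀ ^ 2 + ∑ G ∈ 𝒢, α G ^ 2) ≤
              NearOrtho.permExpect q Θ
                (fun S => (α₀ + ∑ G ∈ 𝒢, α G * NearOrtho.basisPoly q Θ G S) ^ 2) ∧
            NearOrtho.permExpect q Θ
                (fun S => (α₀ + ∑ G ∈ 𝒢, α G * NearOrtho.basisPoly q Θ G S) ^ 2) ≤
              (1 + c * (D : ℝ) ^ (-(cs / 2))) * (α₀ ^ 2 + ∑ G ∈ 𝒢, α G ^ 2) := by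
  obtain ⟨a₁, ha₁⟩ := exists_nat_ge (max cm cvd1)
  obtain ⟨a₂, ha₂⟩ := pow_unbounded_of_one_lt cvd2 (one_lt_two (α := ℝ))
  set a := max a₁ a₂ with ha
  have hmax : max cm cvd1 ≤ (a : ℝ) := ha₁.trans (by exact_mod_cast le_max_left _ _)
  have hcvd2a : cvd2 ≤ 2 ^ a :=
    ha₂.le.trans (pow_le_pow_right₀ one_le_two (le_max_right _ _))
  -- With this `c₀` the loss `D ^ (20 + 6a)` is at most `D ^ cs`, so the signal bound `D ^ (-8 cs)`
  -- leaves `D ^ (-7 cs)`. This is below `D ^ (-cs/2)`, and also below `1/32` because `32 ≤ D ^ 5`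
  -- and `cs ≥ 20`.
  refine ⟨((20 + 6 * a : ℕ) : ℝ), by exact_mod_cast (by omega : 1 < 20 + 6 * a), 7000,
    by norm_num, ?_⟩
  intro cs hcs D n k lam q Θ hD hk hkn hq hq2 hlam _ _ hS hM _ hV 𝒢 h𝒢 α₀ α
  obtain ⟨hΘ, hmx⟩ := hS
  have hD2 : (2 : ℝ) ≤ D := by exact_mod_cast hD
  have hD0 : (0 : ℝ) < D := by linarith
  have hcs20 : (20 : ℝ) ≤ cs := by
    refine le_trans ?_ hcs
    push_cast
    linarith [Nat.cast_nonneg (α := ℝ) a]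
  have hz : (D : ℝ) ^ (20 + 6 * a) * (D : ℝ) ^ (-(8 * cs)) ≤ (D : ℝ) ^ (-(7 * cs)) := by
    rw [← Real.rpow_natCast, ← Real.rpow_add hD0]
    exact Real.rpow_le_rpow_of_exponent_le (by linarith) (by linarith)
  have hz1 : 32 * ((D : ℝ) ^ (20 + 6 * a) * (D : ℝ) ^ (-(8 * cs))) ≤ 1 := by
    have h32 : (32 : ℝ) ≤ (D : ℝ) ^ (5 : ℝ) := by
      calc (32 : ℝ) = 2 ^ (5 : ℝ) := by norm_num
        _ ≤ (D : ℝ) ^ (5 : ℝ) := Real.rpow_le_rpow (by norm_num) hD2 (by norm_num)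
    calc _ ≤ (D : ℝ) ^ (5 : ℝ) * (D : ℝ) ^ (-(7 * cs)) :=
          mul_le_mul h32 hz (by positivity) (by positivity)
      _ = (D : ℝ) ^ (5 + -(7 * cs)) := (Real.rpow_add hD0 _ _).symm
      _ ≤ 1 := Real.rpow_le_one_of_one_le_of_nonpos (by linarith) (by linarith)
  have hz2 : (D : ℝ) ^ (-(7 * cs)) ≤ (D : ℝ) ^ (-(cs / 2)) :=
    Real.rpow_le_rpow_of_exponent_le (by linarith) (by linarith)
  have hmain := NearOrtho.abs_permExpect_basis_sub_le hD hk hkn hq hq2 hlam hΘ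
    ((le_max_left _ _).trans ((le_max_left _ _).trans hmx))
    ((le_max_right _ _).trans ((le_max_left _ _).trans hmx)) ((le_max_right _ _).trans hmx)
    hM hV hcvd2 ((le_max_left _ _).trans hmax) ((le_max_right _ _).trans hmax) hcvd2a hz1 h𝒢 α₀ α
  have hnn : 0 ≤ α₀ ^ 2 + ∑ G ∈ 𝒢, α G ^ 2 :=
    add_nonneg (sq_nonneg _) (sum_nonneg fun _ _ => sq_nonneg _)
  have hfin := hmain.trans (mul_le_mul_of_nonneg_right
    (mul_le_mul_of_nonneg_left (hz.trans hz2) (by norm_num : (0 : ℝ) ≤ 7000)) hnn)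
  rw [abs_le] at hfin
  constructor <;> linarith [hfin.1, hfin.2]
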